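/- Let $d\ge 0$ and let $\mathcal B_d=\{0,1\}^d$ with the coordinatewise order; write $X_1,\dots,X_d$ for the coordinates and $N=\sum_j X_j$. A complex polynomial $q(z_1,\dots,z_m)$ is \emph{stable} if $q(z)\ne 0$ whenever $\Im z_j>0$ for all $j$, and \emph{real stable} if moreover its coefficients are real. A probability measure $\mu$ on $\mathcal B_d$ is \emph{strong Rayleigh} if its generating polynomial $f_\mu(z)=\sum_{\omega\in\mathcal B_d}\mu(\omega)z^\omega$ is real stable. Definitions. (a) $\mu$ is \emph{negatively associated} if $\mathbb E fg\le \mathbb E f\,\mathbb E g$ for all nondecreasing $f,g:\mathcal B_d\to\mathbb R$ such that, for some $S\subseteq\{1,\dots,d\}$, $f$ depends only on $\{X_j:j\in S\}$ and $g$ only on $\{X_j:j\notin S\}$. (b) $\mu$ has \emph{stochastically increasing levels} if, for every $k$ with $\mu(N=k)>0$ and $\mu(N=k+1)>0$, every upwardly closed $A\subseteq\mathcal B_d$ satisfies $\mu(A\mid N=k)\le\mu(A\mid N=k+1)$. (c) $\mu$ has the \emph{stochastic covering property} if, for every $j$ with $\mu(X_j=0)>0$ and $\mu(X_j=1)>0$,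 there is a coupling $(X,Y)$ of the conditional laws $(\mu\mid X_j=0)$ and $(\mu\mid X_j=1)$ of the remaining $d-1$ coordinates such that almost surely $X=Y$ or $X$ covers $Y$ (that is, $X>Y$ with nothing strictly between). (d) The rank sequence $a_k=\mu(N=k)$, $0\le k\le d$, is \emph{ultra log-concave} if it has no internal zeros (the indices of its nonzero terms form an interval) and $$\left(\frac{a_k}{\binom dk}\right)^2\ge\frac{a_{k-1}}{\binom d{k-1}}\cdot\frac{a_{k+1}}{\binom d{k+1}}\qquad(1\le k\le d-1).$$ Theorem. Let $\mu$ be a strong Rayleigh measure on $\mathcal B_d$. (i) $\mu$ is negatively associated. (ii) $\mu$ has stochastically increasing levels, the stochastic covering property and an ultra log-concave rank sequence. If $b_0,\dots,b_d\ge 0$ are such that $\sum_{i=0}^d b_iz^i$ is a stable polynomial and $Z:=\sum_{i=0}^d b_i\,\mu(N=i)>0$, then the rank rescaling $\mu_b(x)=b_{N(x)}\mu(x)/Z$ is strong Rayleigh. In particular, $(\mu\mid N=k)$ and $(\mu\mid k\le N\le k+1)$ are strong Rayleigh for every $k$ for which the conditioning event has positive probability. (iii) The following probability measures are strong Rayleigh: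 the product measure $\mu\times\nu$ on $\mathcal B_{d+e}$, for every strong Rayleigh measure $\nu$ on $\mathcal B_e$; the projection of $\mu$ to any subset of the coordinates; for all $\lambda_1,\dots,\lambda_d>0$, the measure $\mu'(x)=\prod_j\lambda_j^{x_j}\mu(x)\big/\sum_y\prod_j\lambda_j^{y_j}\mu(y)$ obtained by imposing an external field; the total symmetrization $x\mapsto\frac1{d!}\sum_{\pi\in S_d}\mu(\pi x)$, where $\pi$ permutes the coordinates; for all swap rates $\lambda_{\{i,j\}}\ge 0$ and all $t\ge 0$, the law at time $t$ of the symmetric exclusion process with initial law $\mu$, that is, of the continuous time Markov chain on $\mathcal B_d$ in which, independently over the unordered pairs $\{i,j\}$, the values $x_i$ and $x_j$ are interchanged at rate $\lambda_{\{i,j\}}$. -/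

import Mathlib

open MeasureTheory

universe u v

noncomputable section

namespace StrongRayleigh

/-! The Boolean lattice `{0,1}^d` is `ι → Bool` for a finite index type `ι` with `d` elements, with
the coordinatewise order `false ≤ true` and the product (that is, discrete) σ-algebra.  Measures
on it are Mathlib measures. -/

/-! ### Stability -/

/-- A complex polynomial is stable if it has no zero all of whose coordinates lie in the open
upper half-plane. -/
def IsStable {σ : Type*} (f : MvPolynomial σ ℂ) : Prop :=
  ∀ z : σ → ℂ, (∀ j, 0 < (z j).im) → MvPolynomial.eval z f ≠ 0

/-- Real stable: the coefficients are real and the polynomial is stable. -/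
def IsRealStable {σ : Type*} (f : MvPolynomial σ ℂ) : Prop :=
  (∀ m, (MvPolynomial.coeff m f).im = 0) ∧ IsStable f

/-- The univariate polynomial `b 0 + b 1 z + ⋯ + b d z ^ d`. -/
def coeffPoly (d : ℕ) (b : ℕ → ℝ) : MvPolynomial Unit ℂ :=
  ∑ i ∈ Finset.range (d + 1), MvPolynomial.C (b i : ℂ) * MvPolynomial.X () ^ i

/-! ### Strong Rayleigh measures -/

section Basic

variable {ι : Type u} [Fintype ι]

/-- The number `N(x) = ∑ j, x_j` of coordinates of `x` that equal `1`. -/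
def rank (x : ι → Bool) : ℕ := (Finset.univ.filter fun j => x j = true).card

/-- The generating polynomial `f(z) = ∑ ω, μ(ω) z ^ ω`. -/
def genPoly [DecidableEq ι] (μ : Measure (ι → Bool)) : MvPolynomial ι ℂ :=
  ∑ x : ι → Bool, MvPolynomial.C ((μ.real {x} : ℝ) : ℂ) *
    ∏ j ∈ Finset.univ.filter (fun j => x j = true), MvPolynomial.X j

/-- `μ` is a probability measure on `{0,1}^d` whose generating polynomial is real stable. -/
structure IsStrongRayleigh [DecidableEq ι] (μ : Measure (ι → Bool)) : Prop where
  isProbabilityMeasure : IsProbabilityMeasure μ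
  realStable : IsRealStable (genPoly μ)

end Basic

/-! ### Negative dependence properties -/

/-- Negative association: `E[f g] ≤ E[f] E[g]` for nondecreasing `f`, `g` that depend on disjoint
sets of coordinates. -/
def NegativelyAssociated {ι : Type u} (μ : Measure (ι → Bool)) : Prop :=
  ∀ (S : Set ι) (f g : (ι → Bool) → ℝ), Monotone f → Monotone g →
    DependsOn f S → DependsOn g Sᶜ →
    ∫ x, f x * g x ∂μ ≤ (∫ x, f x ∂μ) * ∫ x, g x ∂μ

/-- `ν` stochastically dominates `μ`. -/
def StochDominates {W : Type*} [PartialOrder W] [MeasurableSpace W] (ν μ : Measure W) : Prop :=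
  ∀ A : Set W, IsUpperSet A → μ A ≤ ν A

/-- `ν` stochastically covers `μ`: they have a coupling supported on the pairs `(x, y)` such that
`x = y` or `x` covers `y`. -/
def StochCovers {W : Type*} [PartialOrder W] [MeasurableSpace W] (ν μ : Measure W) : Prop :=
  ∃ Q : Measure (W × W), Q.map Prod.fst = ν ∧ Q.map Prod.snd = μ ∧
    Q {p : W × W | ¬ (p.1 = p.2 ∨ p.2 ⋖ p.1)} = 0

/-- Stochastically increasing levels. -/
def HasStochIncreasingLevels {ι : Type u} [Fintype ι] (μ : Measure (ι → Bool)) : Prop :=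
  ∀ k : ℕ, μ {x | rank x = k} ≠ 0 → μ {x | rank x = k + 1} ≠ 0 →
    StochDominates (ProbabilityTheory.cond μ {x | rank x = k + 1})
      (ProbabilityTheory.cond μ {x | rank x = k})

/-- The law, on `{0,1}^(d-1)`, of the coordinates other than `j` when `x` has law `μ`. -/
def dropCoord {ι : Type u} (j : ι) (μ : Measure (ι → Bool)) :
    Measure ({i : ι // i ≠ j} → Bool) :=
  μ.map fun x i => x i.1

/-- The stochastic covering property: `(μ | X_j = 0)` stochastically covers `(μ | X_j = 1)`, both
viewed as measures on the remaining coordinates, whenever both are defined. -/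
def HasStochCoveringProperty {ι : Type u} (μ : Measure (ι → Bool)) : Prop :=
  ∀ j : ι, μ {x | x j = false} ≠ 0 → μ {x | x j = true} ≠ 0 →
    StochCovers (dropCoord j (ProbabilityTheory.cond μ {x | x j = false}))
      (dropCoord j (ProbabilityTheory.cond μ {x | x j = true}))

/-- The rank sequence `a_k = μ {N = k}`. -/
def rankSeq {ι : Type u} [Fintype ι] (μ : Measure (ι → Bool)) (k : ℕ) : ℝ :=
  μ.real {x | rank x = k}

/-- Ultra log-concavity of the sequence `a_0, …, a_d`: no internal zeros, and Newton's
inequalities. -/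
def UltraLogConcave (d : ℕ) (a : ℕ → ℝ) : Prop :=
  (∀ i j k, i < j → j < k → k ≤ d → a i ≠ 0 → a k ≠ 0 → a j ≠ 0) ∧
  ∀ k, 1 ≤ k → k < d →
    a (k - 1) / (d.choose (k - 1) : ℝ) * (a (k + 1) / (d.choose (k + 1) : ℝ)) ≤
      (a k / (d.choose k : ℝ)) ^ 2

/-! ### Operations on measures -/

/-- The measure on a finite set whose mass function is the nonnegative function `w`. -/
def ofMass {α : Type*} [Fintype α] [MeasurableSpace α] (w : α → ℝ) : Measure α :=
  ∑ x, ENNReal.ofReal (w x) • Measure.dirac x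

section Operations

variable {ι : Type u} [Fintype ι] [DecidableEq ι]

/-- The rank rescaling `μ_b(x) = b_{N(x)} μ(x) / Z`, with `Z = ∑ i, b_i μ {N = i}`. -/
def rankRescale (b : ℕ → ℝ) (μ : Measure (ι → Bool)) : Measure (ι → Bool) :=
  ofMass fun x => b (rank x) * μ.real {x} /
    ∑ i ∈ Finset.range (Fintype.card ι + 1), b i * rankSeq μ i

/-- The perturbation of `μ` by the external field `lam`:
`μ'(x) = (∏ j, lam_j ^ x_j) μ(x) / Z`. -/
def externalField (lam : ι → ℝ) (μ : Measure (ι → Bool)) : Measure (ι → Bool) :=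
  ofMass fun x => (∏ j ∈ Finset.univ.filter (fun j => x j = true), lam j) * μ.real {x} /
    ∑ y : ι → Bool, (∏ j ∈ Finset.univ.filter (fun j => y j = true), lam j) * μ.real {y}

/-- The total symmetrization `x ↦ (1 / d!) ∑ π, μ(π x)`. -/
def totalSymm (μ : Measure (ι → Bool)) : Measure (ι → Bool) :=
  ofMass fun x => (∑ π : Equiv.Perm ι, μ.real {fun j => x (π j)}) /
    ((Fintype.card ι).factorial : ℝ)

/-- The transposition of the two elements of an unordered pair (the identity for a degenerate
pair). -/
def pairSwap (e : Sym2 ι) : Equiv.Perm ι :=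
  Sym2.lift ⟨fun i j => Equiv.swap i j, fun i j => Equiv.swap_comm i j⟩ e

/-- The generator of the symmetric exclusion process with swap rates `lam`: for every unordered
pair `{i,j}`, the values at `i` and `j` are interchanged at rate `lam_{i,j}`.  The entry `(x, y)`,
`x ≠ y`, is the rate of jumping from `x` to `y`, and rows sum to zero.  Degenerate pairs do not
contribute. -/
def exclusionGenerator (lam : Sym2 ι → ℝ) : Matrix (ι → Bool) (ι → Bool) ℝ :=
  fun x y => ∑ e : Sym2 ι, lam e *
    ((if y = fun j => x (pairSwap e j) then 1 else 0) - (if y = x then 1 else 0))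

/-- The law at time `t` of the symmetric exclusion process with initial law `μ`: its mass function
is that of `μ` times the transition matrix `exp (t L)`. -/
def exclusionLaw (lam : Sym2 ι → ℝ) (t : ℝ) (μ : Measure (ι → Bool)) : Measure (ι → Bool) :=
  ofMass (Matrix.vecMul (fun x => μ.real {x}) (NormedSpace.exp (t • exclusionGenerator lam)))

end Operations

/-- The product of `μ` and `ν`, as a measure on `{0,1}^(d+e)`. -/
def prodMeasure {ι : Type u} {κ : Type v} (μ : Measure (ι → Bool)) (ν : Measure (κ → Bool)) :
    Measure (ι ⊕ κ → Bool) :=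
  (μ.prod ν).map fun p => Sum.elim p.1 p.2

/-- The projection of `μ` to the coordinates in `S`. -/
def proj {ι : Type u} (S : Finset ι) (μ : Measure (ι → Bool)) : Measure (S → Bool) :=
  μ.map fun x i => x i.1

end StrongRayleigh

end

/-! Everything is deduced from a few facts about the zeros of stable multi-affine polynomials `f(z)
= ∑ w(x) z^x`.

Limits: a stable `f` satisfies a Harnack inequality whose constant does not depend on `w`, so a
limit of stable polynomials is stable or zero. Conditioning on a coordinate, projecting, and taking
the top or bottom homogeneous part are limits of rescalings and substitutions.

Symmetrization: averaging `f` with its image under a transposition of two variables keeps it stable,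
by a bivariate computation. Minimizing the sum of squared moduli of the coefficients among stable
polynomials with a given symmetrization turns this into the Grace–Walsh–Szegő theorem, and so into
the stability of polarizations of univariate stable polynomials.

Homogenization: if `w ≥ 0` and `z` lies in the upper half-space, all nonzero zeros of `s ↦ f(s z)`
lie in the upper half-plane. This is proved by deforming `z` to a purely imaginary vector, during
which no zero can cross the real line. Polarizing the homogenizing variable gives a homogeneous
stable weight on `2d` coordinates with marginal `w`. Combined with Gauss–Lucas the same fact gives
rank rescaling, since the rescaled polynomial is one coefficient of the product of `s ↦ f(s z)` with
a polynomial whose nonzero zeros are negative reals.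

Negative dependence: non-vanishing of `p + q t` for `t` in the upper half-plane forces `Im (p q̄) ≥
0`, which yields the Rayleigh inequality for two coordinates. For homogeneous weights the
Feder–Mihail induction then shows that an increasing function is negatively correlated with a
coordinate on which it does not depend (`SRWeight.cov_nonpos`), and hence negative association.
Applied to suitable homogenizations, `SRWeight.cov_nonpos` also gives stochastically increasing
levels and, through Strassen's theorem, the covering property. Ultra log-concavity is the Rayleigh
inequality for the polarization of `f(s, …, s)`.

Exclusion process: for short times one swap acts as a swap average; Chernoff's product formula and
closedness under limits pass to the full semigroup. -/

open Polynomial in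
/-- A Harnack inequality: a polynomial of degree at most `N` without zeros in the disc of radius
`ε` around `0` satisfies `|p(1)| ≤ (1 + 1/ε)^N |p(0)|`. -/
theorem Polynomial.norm_eval_one_le (p : ℂ[X]) {ε : ℝ} (hε : 0 < ε)
    (hp : ∀ s, p.eval s = 0 → ε ≤ ‖s‖) {N : ℕ} (hN : p.natDegree ≤ N) :
    ‖p.eval 1‖ ≤ (1 + 1 / ε) ^ N * ‖p.eval 0‖ := by
  by_cases hp0 : p = 0
  · simp [hp0]
  have key : ∀ m : Multiset ℂ, (∀ r ∈ m, ε ≤ ‖r‖) →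
      ‖(m.map fun r => 1 - r).prod‖ ≤ (1 + 1 / ε) ^ (Multiset.card m) *
        ‖(m.map fun r => 0 - r).prod‖ := by
    intro m
    induction m using Multiset.induction with
    | empty => simp
    | cons a m ih =>
      intro h
      have ha := h a (Multiset.mem_cons_self a m)
      have ih' := ih fun r hr => h r (Multiset.mem_cons_of_mem hr)
      simp only [Multiset.map_cons, Multiset.prod_cons, norm_mul, Multiset.card_cons, zero_sub,
        norm_neg] at ih' ⊢
      have h1 : ‖1 - a‖ ≤ (1 + 1 / ε) * ‖a‖ := by
        have : ‖1 - a‖ ≤ 1 + ‖a‖ := by simpa using norm_sub_le (1 : ℂ) a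
        have h2 : 1 ≤ 1 / ε * ‖a‖ := by
          rw [one_div, inv_mul_eq_div, le_div_iff₀ hε]; linarith
        linarith
      calc ‖1 - a‖ * ‖(m.map fun r => 1 - r).prod‖
          ≤ ((1 + 1 / ε) * ‖a‖) * ((1 + 1 / ε) ^ (Multiset.card m) *
            ‖(m.map fun r => - r).prod‖) := by gcongr
        _ = _ := by ring
  have hev : ∀ s, p.eval s = p.leadingCoeff * (p.roots.map fun r => s - r).prod := by
    intro s
    conv_lhs => rw [(IsAlgClosed.splits p).eq_prod_roots]
    simp [eval_multiset_prod]
  rw [hev, hev, norm_mul, norm_mul]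
  have h1 := key p.roots fun r hr => hp r (by simpa [hp0] using hr)
  have h2 : (1 + 1 / ε) ^ (Multiset.card p.roots) ≤ (1 + 1 / ε) ^ N :=
    pow_le_pow_right₀ (by simp [hε.le]) ((card_roots' p).trans hN)
  calc _ ≤ ‖p.leadingCoeff‖ * ((1 + 1 / ε) ^ N * ‖(p.roots.map fun r => 0 - r).prod‖) := by
        gcongr
        exact h1.trans (by gcongr)
    _ = _ := by ring

/-! ### Multi-affine polynomials and limits of stable polynomials -/

namespace StrongRayleigh

section Mev

variable {ι : Type*} [Fintype ι]

theorem prod_ite_const {M : Type*} [CommMonoid M] (c : M) (x : ι → Bool) :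
    (∏ j, if x j then c else 1) = c ^ rank x := by
  simp [rank, Finset.prod_ite]

variable [DecidableEq ι]

/-- The value at `z` of the multi-affine polynomial `∑ x, w x * z ^ x`. -/
noncomputable def mev (w : (ι → Bool) → ℂ) (z : ι → ℂ) : ℂ :=
  ∑ x, w x * ∏ j, if x j then z j else 1

/-- The multi-affine polynomial with coefficients `w` is stable. -/
def Stab (w : (ι → Bool) → ℂ) : Prop :=
  ∀ z : ι → ℂ, (∀ j, 0 < (z j).im) → mev w z ≠ 0

theorem continuous_mev_left (z : ι → ℂ) : Continuous fun w : (ι → Bool) → ℂ => mev w z := by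
  unfold mev
  fun_prop

theorem continuous_mev_right (w : (ι → Bool) → ℂ) : Continuous fun z : ι → ℂ => mev w z := by
  unfold mev
  refine continuous_finsetSum _ fun x _ => continuous_const.mul
    (continuous_finsetProd _ fun j _ => ?_)
  split_ifs <;> fun_prop

theorem mev_add (w w' : (ι → Bool) → ℂ) (z : ι → ℂ) :
    mev (fun x => w x + w' x) z = mev w z + mev w' z := by
  simp [mev, add_mul, Finset.sum_add_distrib]

theorem mev_const_mul (c : ℂ) (w : (ι → Bool) → ℂ) (z : ι → ℂ) :
    mev (fun x => c * w x) z = c * mev w z := by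
  simp [mev, Finset.mul_sum, mul_assoc]

theorem mev_sum {α : Type*} (s : Finset α) (w : α → (ι → Bool) → ℂ) (z : ι → ℂ) :
    mev (fun x => ∑ a ∈ s, w a x) z = ∑ a ∈ s, mev (w a) z := by
  simp only [mev, Finset.sum_mul]
  rw [Finset.sum_comm]

/-- Rescaling of the variables. -/
theorem mev_field (c : ι → ℂ) (w : (ι → Bool) → ℂ) (z : ι → ℂ) :
    mev (fun x => (∏ j, if x j then c j else 1) * w x) z = mev w fun j => c j * z j := by
  unfold mev
  refine Finset.sum_congr rfl fun x _ => ?_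
  beta_reduce
  rw [mul_comm _ (w x), mul_assoc, ← Finset.prod_mul_distrib]
  congr 2
  ext j
  split_ifs <;> simp

theorem mev_rank_pow (c : ℂ) (w : (ι → Bool) → ℂ) (z : ι → ℂ) :
    mev (fun x => c ^ rank x * w x) z = mev w fun j => c * z j := by
  simp_rw [← mev_field (fun _ => c), prod_ite_const]

theorem mev_perm (π : Equiv.Perm ι) (w : (ι → Bool) → ℂ) (z : ι → ℂ) :
    mev (fun x => w fun j => x (π j)) z = mev w fun j => z (π j) := by
  unfold mev
  refine Fintype.sum_equiv (Equiv.arrowCongr π.symm (Equiv.refl Bool)) _ _ fun x => ?_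
  simp only [Equiv.arrowCongr_apply, Equiv.coe_refl, Function.comp_def, Equiv.symm_symm, id]
  congr 1
  exact (Equiv.prod_comp π fun j => if x j then z j else 1).symm

theorem Stab.field {w : (ι → Bool) → ℂ} (hw : Stab w) (c : ι → ℝ) (hc : ∀ j, 0 < c j) :
    Stab fun x => (∏ j, if x j then (c j : ℂ) else 1) * w x := by
  intro z hz
  rw [mev_field]
  exact hw _ fun j => by simpa using mul_pos (hc j) (hz j)

theorem Stab.const_mul {w : (ι → Bool) → ℂ} (hw : Stab w) {c : ℂ} (hc : c ≠ 0) :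
    Stab fun x => c * w x := by
  intro z hz
  rw [mev_const_mul]
  exact mul_ne_zero hc (hw z hz)

-- Restrict to the complex line through `z₀` and `z₁`. The disc around `z₀` on which a stable
-- polynomial has no zero depends only on the two points, and the degree is at most the number of
-- coordinates; hence one constant serves all `w`.
open Polynomial in
theorem exists_harnack (z₀ z₁ : ι → ℂ) (h₀ : ∀ j, 0 < (z₀ j).im) :
    ∃ C : ℝ, ∀ w : (ι → Bool) → ℂ, Stab w → ‖mev w z₁‖ ≤ C * ‖mev w z₀‖ := by
  have h1 : ∀ᶠ s in nhds (0 : ℂ), ∀ j, 0 < (z₀ j + s * (z₁ j - z₀ j)).im := by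
    rw [Filter.eventually_all]
    intro j
    have hc : Continuous fun s : ℂ => (z₀ j + s * (z₁ j - z₀ j)).im := by fun_prop
    exact hc.continuousAt.eventually (lt_mem_nhds (by simpa using h₀ j))
  obtain ⟨ε, hε, h2⟩ := Metric.eventually_nhds_iff.mp h1
  refine ⟨(1 + 1 / ε) ^ Fintype.card ι, fun w hw => ?_⟩
  let p : ℂ[X] := ∑ x, C (w x) * ∏ j, if x j then C (z₀ j) + X * C (z₁ j - z₀ j) else 1
  have hp : ∀ s, p.eval s = mev w fun j => z₀ j + s * (z₁ j - z₀ j) := by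
    intro s
    simp only [p, mev, eval_finsetSum, eval_mul, eval_C, eval_prod]
    refine Finset.sum_congr rfl fun x _ => ?_
    congr 1
    refine Finset.prod_congr rfl fun j _ => ?_
    split_ifs <;> simp
  have hdeg : p.natDegree ≤ Fintype.card ι := by
    refine natDegree_sum_le_of_forall_le _ _ fun x _ => ?_
    refine (natDegree_C_mul_le _ _).trans ((natDegree_prod_le _ _).trans ?_)
    rw [← Finset.card_univ, Finset.card_eq_sum_ones]
    refine Finset.sum_le_sum fun j _ => ?_
    split_ifs
    · compute_degree
    · simp
  have := p.norm_eval_one_le hε (fun s hs => by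
    by_contra hlt
    rw [hp] at hs
    exact hw _ (h2 (by simpa using hlt)) hs) hdeg
  simpa [hp] using this

/-- Limits of stable multi-affine polynomials are stable or zero. -/
theorem isClosed_stab_or_zero :
    IsClosed {w : (ι → Bool) → ℂ | Stab w ∨ ∀ z, mev w z = 0} := by
  choose C hC using fun (z : (ι → ℂ) × (ι → ℂ)) (h : ∀ j, 0 < (z.1 j).im) =>
    exists_harnack z.1 z.2 h
  -- The Harnack inequalities are closed conditions on `w`, and they characterize the set: a `w`
  -- that satisfies all of them and vanishes at one point of the upper half-space vanishes
  -- everywhere.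
  have : {w : (ι → Bool) → ℂ | Stab w ∨ ∀ z, mev w z = 0} =
      ⋂ z : (ι → ℂ) × (ι → ℂ), ⋂ h : ∀ j, 0 < (z.1 j).im,
        {w | ‖mev w z.2‖ ≤ C z h * ‖mev w z.1‖} := by
    ext w
    simp only [Set.mem_ofPred_eq, Set.mem_iInter]
    constructor
    · rintro (h | h) z hz
      · exact hC z hz w h
      · simp [h]
    · intro h
      by_cases hs : Stab w
      · exact Or.inl hs
      · right
        simp only [Stab, not_forall, not_not] at hs
        obtain ⟨z₀, hz₀, h0⟩ := hs
        intro z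
        simpa [h0] using h (z₀, z) hz₀
  rw [this]
  refine isClosed_iInter fun z => isClosed_iInter fun h => isClosed_le ?_ ?_
  · exact (continuous_mev_left _).norm
  · exact continuous_const.mul (continuous_mev_left _).norm

/-- The form in which Hurwitz's theorem is used below: a single point of non-vanishing, anywhere,
excludes the zero limit. -/
theorem Stab.of_tendsto {α : Type*} {l : Filter α} [l.NeBot] {W : α → (ι → Bool) → ℂ}
    {w : (ι → Bool) → ℂ} (hW : ∀ᶠ a in l, Stab (W a))
    (hlim : ∀ x, Filter.Tendsto (fun a => W a x) l (nhds (w x)))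
    {z : ι → ℂ} (hz : mev w z ≠ 0) : Stab w := by
  have := isClosed_stab_or_zero.mem_of_tendsto (tendsto_pi_nhds.mpr hlim)
    (hW.mono fun a ha => Or.inl ha)
  exact this.resolve_right fun h => hz (h z)

end Mev

end StrongRayleigh

/-! ### Swap averages and the Grace–Walsh–Szegő theorem -/

namespace StrongRayleigh

open ComplexConjugate

/-- For `q ≠ 0` the only zero is `v = -p/q`, whose imaginary part is `-Im (p q̄) / |q|²`. -/
theorem im_mul_conj_nonneg {p q : ℂ} (h : ∀ v : ℂ, 0 < v.im → p + q * v ≠ 0) :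
    0 ≤ (p * conj q).im := by
  by_contra! hlt
  have hq : q ≠ 0 := by rintro rfl; simp at hlt
  refine h (-p / q) ?_ (by field_simp; ring)
  have h1 : -p / q = -(p * conj q) / (Complex.normSq q : ℂ) := by
    rw [← Complex.mul_conj]
    have : conj q ≠ 0 := by simpa using hq
    field_simp
  rw [h1, Complex.div_ofReal_im, Complex.neg_im]
  exact div_pos (by linarith) (Complex.normSq_pos.mpr hq)

/-- Averaging a bivariate stable multi-affine polynomial with its mirror image preserves
stability. -/
theorem bivariate_swap_average {a b c d : ℂ}
    (h : ∀ u v : ℂ, 0 < u.im → 0 < v.im → a + b * u + c * v + d * u * v ≠ 0)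
    {θ : ℝ} (h0 : 0 ≤ θ) (h1 : θ ≤ 1) {u v : ℂ} (hu : 0 < u.im) (hv : 0 < v.im) :
    (1 - θ) * (a + b * u + c * v + d * u * v) + θ * (a + b * v + c * u + d * v * u) ≠ 0 := by
  rcases h0.eq_or_lt with rfl | h0
  · simpa using h u v hu hv
  rcases h1.eq_or_lt with rfl | h1
  · simpa using h v u hv hu
  by_cases hbc : b = c
  · subst hbc
    have := h u v hu hv
    intro h2
    apply this
    rw [← h2]; ring
  intro hzero
  have e1 : 0 ≤ ((a + b * u) * conj (c + d * u)).im :=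
    im_mul_conj_nonneg fun v hv h2 => h u v hu hv (by rw [← h2]; ring)
  have e2 : 0 ≤ ((a + c * u) * conj (b + d * u)).im :=
    im_mul_conj_nonneg fun v hv h2 => h v u hv hu (by rw [← h2]; ring)
  -- As a function of `v` the average is affine with slope `q`.
  set q : ℂ := (1 - θ) * c + θ * b + d * u with hq
  have hp : a + ((1 - θ) * b + θ * c) * u = -(q * v) := by
    rw [eq_neg_iff_add_eq_zero, ← hzero, hq]; ring
  -- The left side is quadratic in `θ`. It exceeds the linear interpolation of its end values,
  -- nonnegative by `e1` and `e2`, by the positive term `θ (1 - θ) |b - c|² Im u`; a zero of the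
  -- average makes it nonpositive by `e4`.
  have e3 : ((a + ((1 - θ) * b + θ * c) * u) * conj q).im =
      (1 - θ) * ((a + b * u) * conj (c + d * u)).im + θ * ((a + c * u) * conj (b + d * u)).im +
        θ * (1 - θ) * Complex.normSq (b - c) * u.im := by
    simp only [hq, Complex.mul_im, Complex.add_im, Complex.conj_re, Complex.conj_im,
      Complex.add_re, Complex.mul_re, Complex.sub_re, Complex.sub_im, Complex.ofReal_re,
      Complex.ofReal_im, Complex.one_re, Complex.one_im, Complex.normSq_apply]
    ring
  have e4 : ((a + ((1 - θ) * b + θ * c) * u) * conj q).im = - (Complex.normSq q * v.im) := by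
    rw [hp]
    simp only [Complex.mul_im, Complex.neg_im, Complex.neg_re, Complex.conj_re, Complex.conj_im,
      Complex.mul_re, Complex.normSq_apply]
    ring
  have e5 : 0 < θ * (1 - θ) * Complex.normSq (b - c) * u.im := by
    have : 0 < Complex.normSq (b - c) := Complex.normSq_pos.mpr (sub_ne_zero.mpr hbc)
    have : 0 < 1 - θ := by linarith
    positivity
  have e6 : 0 ≤ Complex.normSq q * v.im := mul_nonneg (Complex.normSq_nonneg _) hv.le
  have e7 : 0 ≤ 1 - θ := by linarith
  have := mul_nonneg e7 e1
  have := mul_nonneg h0.le e2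
  linarith

section

variable {ι : Type*} [Fintype ι] [DecidableEq ι]

/-- `mev w` is affine in each variable. -/
theorem mev_update (w : (ι → Bool) → ℂ) (z : ι → ℂ) (i : ι) (s : ℂ) :
    mev w (Function.update z i s) = mev w (Function.update z i 0) +
      (mev w (Function.update z i 1) - mev w (Function.update z i 0)) * s := by
  have key : ∀ t : ℂ, mev w (Function.update z i t) =
      ∑ x, w x * ((if x i then t else 1) * ∏ j ∈ {i}ᶜ, if x j then z j else 1) := by
    intro t
    refine Finset.sum_congr rfl fun x _ => ?_
    rw [Fintype.prod_eq_mul_prod_compl i]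
    simp only [Function.update_self]
    congr 2
    refine Finset.prod_congr rfl fun j hj => ?_
    rw [Function.update_of_ne (by simpa using hj)]
  rw [key, key, key, ← Finset.sum_sub_distrib, Finset.sum_mul, ← Finset.sum_add_distrib]
  refine Finset.sum_congr rfl fun x _ => ?_
  split_ifs <;> ring

theorem mev_update_update (w : (ι → Bool) → ℂ) (z : ι → ℂ) {i j : ι} (hij : i ≠ j) :
    ∃ a b c d : ℂ, ∀ s t, mev w (Function.update (Function.update z i s) j t) =
      a + b * s + c * t + d * s * t := by
  let F : ℂ → ℂ → ℂ := fun s t => mev w (Function.update (Function.update z i s) j t)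
  refine ⟨F 0 0, F 1 0 - F 0 0, F 0 1 - F 0 0, F 1 1 - F 1 0 - (F 0 1 - F 0 0), fun s t => ?_⟩
  have h1 : ∀ s t, F s t = F s 0 + (F s 1 - F s 0) * t := fun s t => mev_update w _ j t
  have h2 : ∀ s t, F s t = F 0 t + (F 1 t - F 0 t) * s := by
    intro s t
    simp only [F, Function.update_comm hij]
    exact mev_update w _ i s
  change F s t = _
  rw [h1, h2 s 0, h2 s 1]
  ring

/-- With the other variables frozen in the upper half-plane this is the bivariate statement. General
weights `θ`, not only `1/2`, are needed for the exclusion process. -/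
theorem Stab.swap_average {w : (ι → Bool) → ℂ} (hw : Stab w) (i j : ι) {θ : ℝ} (h0 : 0 ≤ θ)
    (h1 : θ ≤ 1) :
    Stab fun x => (1 - θ) * w x + θ * w fun l => x (Equiv.swap i j l) := by
  intro z hz
  rw [mev_add, mev_const_mul, mev_const_mul (θ : ℂ) fun x => w fun l => x (Equiv.swap i j l),
    mev_perm]
  rcases eq_or_ne i j with rfl | hij
  · simp only [Equiv.swap_self, Equiv.refl_apply]
    rw [← add_mul]
    simpa using hw z hz
  obtain ⟨a, b, c, d, hF⟩ := mev_update_update w z hij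
  have e1 : z = Function.update (Function.update z i (z i)) j (z j) := by simp
  have e2 : (fun l => z (Equiv.swap i j l)) =
      Function.update (Function.update z i (z j)) j (z i) := by
    ext l
    rcases eq_or_ne l j with rfl | hj
    · simp
    rcases eq_or_ne l i with rfl | hi
    · simp [hij]
    · simp [hi, hj, Equiv.swap_apply_of_ne_of_ne hi hj]
  rw [e2]
  nth_rw 1 [e1]
  rw [hF, hF]
  refine bivariate_swap_average (fun u v hu hv => ?_) h0 h1 (hz i) (hz j)
  rw [← hF]
  refine hw _ fun l => ?_
  rcases eq_or_ne l j with rfl | hj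
  · simpa
  rcases eq_or_ne l i with rfl | hi
  · simpa [hij]
  · simpa [hi, hj] using hz l

/-- The average of `w` over all permutations of the coordinates. -/
noncomputable def symmetrize (w : (ι → Bool) → ℂ) (x : ι → Bool) : ℂ :=
  (∑ π : Equiv.Perm ι, w fun j => x (π j)) / ((Fintype.card ι).factorial : ℂ)

theorem symmetrize_of_invariant {w : (ι → Bool) → ℂ}
    (h : ∀ (π : Equiv.Perm ι) x, (w fun j => x (π j)) = w x) : symmetrize w = w := by
  ext x
  simp only [symmetrize, h, Finset.sum_const, Finset.card_univ, Fintype.card_perm, nsmul_eq_mul]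
  have : ((Fintype.card ι).factorial : ℂ) ≠ 0 := by exact_mod_cast Nat.factorial_ne_zero _
  field_simp

theorem symmetrize_perm (w : (ι → Bool) → ℂ) (σ : Equiv.Perm ι) :
    (symmetrize fun x => w fun j => x (σ j)) = symmetrize w := by
  ext x
  simp only [symmetrize]
  congr 1
  exact Fintype.sum_equiv (Equiv.mulRight σ) _ _ fun π => rfl

theorem symmetrize_apply_perm (w : (ι → Bool) → ℂ) (σ : Equiv.Perm ι) (x : ι → Bool) :
    (symmetrize w fun j => x (σ j)) = symmetrize w x := by
  simp only [symmetrize]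
  congr 1
  exact Fintype.sum_equiv (Equiv.mulLeft σ) _ _ fun π => rfl

theorem symmetrize_linear (a b : ℂ) (w w' : (ι → Bool) → ℂ) :
    (symmetrize fun x => a * w x + b * w' x) =
      fun x => a * symmetrize w x + b * symmetrize w' x := by
  ext x
  simp only [symmetrize, Finset.sum_add_distrib, ← Finset.mul_sum]
  ring

theorem continuous_symmetrize : Continuous (symmetrize : ((ι → Bool) → ℂ) → (ι → Bool) → ℂ) := by
  unfold symmetrize
  fun_prop

theorem mev_symmetrize (w : (ι → Bool) → ℂ) (z : ι → ℂ) :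
    mev (symmetrize w) z =
      (∑ π : Equiv.Perm ι, mev w fun j => z (π j)) / ((Fintype.card ι).factorial : ℂ) := by
  have : symmetrize w = fun x => ((Fintype.card ι).factorial : ℂ)⁻¹ *
      ∑ π : Equiv.Perm ι, w fun j => x (π j) := by
    ext x; rw [symmetrize, div_eq_inv_mul]
  rw [this, mev_const_mul, mev_sum, div_eq_inv_mul]
  simp_rw [mev_perm]

theorem mev_symmetrize_diag (w : (ι → Bool) → ℂ) (s : ℂ) :
    mev (symmetrize w) (fun _ => s) = mev w fun _ => s := by
  rw [mev_symmetrize]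
  simp only [Finset.sum_const, Finset.card_univ, Fintype.card_perm, nsmul_eq_mul]
  have : ((Fintype.card ι).factorial : ℂ) ≠ 0 := by exact_mod_cast Nat.factorial_ne_zero _
  field_simp

/-- The Grace–Walsh–Szegő theorem for multi-affine polynomials: symmetrization preserves
stability. -/
theorem Stab.symmetrize {w : (ι → Bool) → ℂ} (hw : Stab w) : Stab (symmetrize w) := by
  -- An energy that a swap average strictly lowers unless the weight is already invariant under the
  -- swap. A minimizer is therefore symmetric, so it equals its own symmetrization.
  let E : ((ι → Bool) → ℂ) → ℝ := fun v => ∑ x, Complex.normSq (v x)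
  have hE : Continuous E :=
    continuous_finsetSum _ fun x _ => Complex.continuous_normSq.comp (continuous_apply x)
  have hdiag : ∀ v : (ι → Bool) → ℂ, StrongRayleigh.symmetrize v = StrongRayleigh.symmetrize w →
      mev v (fun _ => Complex.I) ≠ 0 := by
    intro v hv
    rw [← mev_symmetrize_diag, hv, mev_symmetrize_diag]
    exact hw _ (by simp)
  -- The energy bound serves only compactness. Fixing the symmetrization fixes the values on the
  -- diagonal, so by `hdiag` the zero polynomial is not in `K`.
  let K : Set ((ι → Bool) → ℂ) := {v | Stab v ∨ ∀ z, mev v z = 0} ∩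
    {v | StrongRayleigh.symmetrize v = StrongRayleigh.symmetrize w} ∩ {v | E v ≤ E w}
  have hK : IsCompact K := by
    refine Metric.isCompact_of_isClosed_isBounded ?_ ?_
    · exact (isClosed_stab_or_zero.inter (isClosed_eq continuous_symmetrize continuous_const)).inter
        (isClosed_le hE continuous_const)
    · rw [isBounded_iff_forall_norm_le]
      refine ⟨Real.sqrt (E w), fun v hv => ?_⟩
      rw [pi_norm_le_iff_of_nonneg (Real.sqrt_nonneg _)]
      intro x
      refine Real.le_sqrt_of_sq_le ((le_trans ?_ hv.2))
      rw [← Complex.normSq_eq_norm_sq]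
      exact Finset.single_le_sum (f := fun x => Complex.normSq (v x))
        (fun y _ => Complex.normSq_nonneg _) (Finset.mem_univ x)
  obtain ⟨v, hvK, hmin⟩ := hK.exists_isMinOn ⟨w, ⟨Or.inl hw, rfl⟩, le_refl (E w)⟩ hE.continuousOn
  have hvs : Stab v := hvK.1.1.resolve_right fun h => hdiag v hvK.1.2 (h _)
  have hswap : ∀ i j x, (v fun l => x (Equiv.swap i j l)) = v x := by
    intro i j
    let v' : (ι → Bool) → ℂ := fun x => v fun l => x (Equiv.swap i j l)
    let u : (ι → Bool) → ℂ := fun x => (1 - ((1 / 2 : ℝ) : ℂ)) * v x + ((1 / 2 : ℝ) : ℂ) * v' x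
    have hEv' : E v' = E v :=
      Fintype.sum_equiv (Equiv.arrowCongr (Equiv.swap i j).symm (Equiv.refl Bool)) _ _
        fun x => rfl
    -- The parallelogram identity, together with invariance of the energy under permutations.
    have hEu : E u = E v - (∑ x, Complex.normSq (v x - v' x)) / 4 := by
      have : E u = (E v + E v') / 2 - (∑ x, Complex.normSq (v x - v' x)) / 4 := by
        simp only [E, u]
        rw [← Finset.sum_add_distrib, Finset.sum_div, Finset.sum_div, ← Finset.sum_sub_distrib]
        refine Finset.sum_congr rfl fun x _ => ?_
        simp only [Complex.normSq_apply, Complex.add_re, Complex.add_im, Complex.mul_re,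
          Complex.mul_im, Complex.sub_re, Complex.sub_im, Complex.ofReal_re, Complex.ofReal_im,
          Complex.one_re, Complex.one_im]
        ring
      rw [this, hEv']; ring
    have hnn : 0 ≤ ∑ x, Complex.normSq (v x - v' x) :=
      Finset.sum_nonneg fun x _ => Complex.normSq_nonneg _
    have huK : u ∈ K := by
      refine ⟨⟨Or.inl (hvs.swap_average i j (by norm_num) (by norm_num)), ?_⟩, ?_⟩
      · change StrongRayleigh.symmetrize u = _
        rw [symmetrize_linear, symmetrize_perm, ← hvK.1.2]
        ext x; ring
      · have := hvK.2
        simp only [Set.mem_ofPred_eq] at this ⊢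
        linarith
    have hle : E v ≤ E u := hmin huK
    have hz : ∑ x, Complex.normSq (v x - v' x) = 0 := by linarith
    intro x
    have := (Finset.sum_eq_zero_iff_of_nonneg fun x _ => Complex.normSq_nonneg _).mp hz x
      (Finset.mem_univ x)
    exact (sub_eq_zero.mp (Complex.normSq_eq_zero.mp this)).symm
  have hperm : ∀ (π : Equiv.Perm ι) x, (v fun j => x (π j)) = v x := by
    intro π
    induction π using Equiv.Perm.swap_induction_on with
    | one => intro x; rfl
    | swap_mul f i j _ ih =>
      intro x
      exact (ih fun l => x (Equiv.swap i j l)).trans (hswap i j x)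
  rw [← hvK.1.2, symmetrize_of_invariant hperm]
  exact hvs

end

end StrongRayleigh

/-! ### Polarization of univariate polynomials -/

namespace StrongRayleigh

section

variable {ι : Type*} [Fintype ι]

theorem rank_le (x : ι → Bool) : rank x ≤ Fintype.card ι := Finset.card_le_univ _

/-- Vectors with equally many ones differ by a permutation of the coordinates. -/
theorem exists_perm_of_rank_eq {x y : ι → Bool} (h : rank x = rank y) :
    ∃ π : Equiv.Perm ι, y = fun j => x (π j) := by
  classical
  have e : {j // y j = true} ≃ {j // x j = true} := by
    refine Fintype.equivOfCardEq ?_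
    rw [Fintype.card_subtype, Fintype.card_subtype]
    exact h.symm
  refine ⟨e.extendSubtype, funext fun j => ?_⟩
  by_cases hj : y j = true
  · rw [hj]; exact (e.extendSubtype_mem j hj).symm
  · rw [Bool.not_eq_true] at hj
    have := e.extendSubtype_not_mem j (by simp [hj])
    rw [hj]
    simpa using this

theorem exists_map_univ_eq {α : Type*} (m : Multiset α) (h : Multiset.card m = Fintype.card ι) :
    ∃ g : ι → α, (Finset.univ : Finset ι).val.map g = m := by
  induction m using Quotient.inductionOn with
  | h L =>
    have e : ι ≃ Fin L.length := Fintype.equivFinOfCardEq (by simpa using h.symm)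
    refine ⟨fun i => L.get (e i), ?_⟩
    have h1 : (Finset.univ : Finset ι).val.map e = (Finset.univ : Finset (Fin L.length)).val :=
      congrArg Finset.val (Finset.map_univ_equiv e)
    have h2 : (Finset.univ : Finset ι).val.map (fun i => L.get (e i)) =
        ((Finset.univ : Finset ι).val.map e).map L.get := by
      rw [Multiset.map_map]; rfl
    rw [h2, h1, Fin.univ_val_map]
    simp

variable [DecidableEq ι]

/-- The indicator vector of a finite set. -/
def ofFinset (s : Finset ι) : ι → Bool := fun j => decide (j ∈ s)

theorem rank_ofFinset (s : Finset ι) : rank (ofFinset s) = s.card := by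
  simp [rank, ofFinset]

theorem sum_rank {M : Type*} [AddCommMonoid M] (g : ℕ → M) :
    ∑ x : ι → Bool, g (rank x) =
      ∑ k ∈ Finset.range (Fintype.card ι + 1), (Fintype.card ι).choose k • g k := by
  rw [← Finset.card_univ, ← Finset.sum_powerset_apply_card, Finset.powerset_univ]
  refine Fintype.sum_equiv ⟨fun x => Finset.univ.filter fun j => x j = true, ofFinset,
    fun x => ?_, fun s => ?_⟩ _ _ fun x => rfl
  · ext j; simp [ofFinset]
  · ext j; simp [ofFinset]

theorem sum_rank_eq_sum {M : Type*} [AddCommMonoid M] (g : (ι → Bool) → M) :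
    ∑ x : ι → Bool, g x =
      ∑ k ∈ Finset.range (Fintype.card ι + 1), ∑ x with rank x = k, g x :=
  (Finset.sum_fiberwise_of_maps_to (fun x _ => by
    simpa [Nat.lt_succ_iff] using rank_le x) g).symm

theorem mev_prod (α β : ι → ℂ) (z : ι → ℂ) :
    mev (fun x => ∏ j, if x j then α j else β j) z = ∏ j, (α j * z j + β j) := by
  have : ∀ j, α j * z j + β j = ∑ b : Bool, (if b then α j * z j else β j) := by simp
  simp_rw [this, Fintype.prod_sum, mev, ← Finset.prod_mul_distrib]
  refine Finset.sum_congr rfl fun x _ => Finset.prod_congr rfl fun j _ => ?_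
  split_ifs <;> simp

theorem mev_const_eq (w : (ι → Bool) → ℂ) (s : ℂ) :
    mev w (fun _ => s) = ∑ x, w x * s ^ rank x := by
  simp [mev, prod_ite_const]

open Polynomial in
/-- The polarization of a univariate stable polynomial is stable. -/
theorem stab_of_rank (v : ℕ → ℂ)
    (h : ∀ s : ℂ, 0 < s.im → ∑ k ∈ Finset.range (Fintype.card ι + 1),
      ((Fintype.card ι).choose k : ℂ) * v k * s ^ k ≠ 0) :
    Stab fun x : ι → Bool => v (rank x) := by
  let p : ℂ[X] := ∑ k ∈ Finset.range (Fintype.card ι + 1),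
    C (((Fintype.card ι).choose k : ℂ) * v k) * X ^ k
  have hpev : ∀ s, p.eval s = ∑ k ∈ Finset.range (Fintype.card ι + 1),
      ((Fintype.card ι).choose k : ℂ) * v k * s ^ k := by
    intro s; simp [p, eval_finsetSum]
  have hp0 : p ≠ 0 := by
    intro h0
    refine h Complex.I (by simp) ?_
    rw [← hpev, h0, eval_zero]
  have hdeg : p.natDegree ≤ Fintype.card ι := by
    refine natDegree_sum_le_of_forall_le _ _ fun k hk => ?_
    exact (natDegree_C_mul_X_pow_le _ _).trans (by simpa [Nat.lt_succ_iff] using hk)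
  have hcard : Multiset.card p.roots ≤ Fintype.card ι := (card_roots' p).trans hdeg
  -- One affine factor `g.1 * z + g.2` per coordinate: `z - r` for each root `r`, and the constant
  -- `1` as padding when the degree is below the number of coordinates.
  obtain ⟨g, hg⟩ := exists_map_univ_eq (ι := ι) (p.roots.map (fun r => ((1 : ℂ), -r)) +
    Multiset.replicate (Fintype.card ι - Multiset.card p.roots) ((0 : ℂ), (1 : ℂ)))
    (by simp [hcard])
  let G : (ι → Bool) → ℂ := fun x => p.leadingCoeff * ∏ j, if x j then (g j).1 else (g j).2
  have hGev : ∀ z, mev G z = p.leadingCoeff * ∏ j, ((g j).1 * z j + (g j).2) := by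
    intro z; rw [mev_const_mul, mev_prod]
  have hmem : ∀ j, (∃ r ∈ p.roots, g j = (1, -r)) ∨ g j = (0, 1) := by
    intro j
    have : g j ∈ (Finset.univ : Finset ι).val.map g := Multiset.mem_map_of_mem _ (by simp)
    rw [hg, Multiset.mem_add, Multiset.mem_map] at this
    rcases this with ⟨r, hr, h⟩ | h
    · exact Or.inl ⟨r, hr, h.symm⟩
    · exact Or.inr (Multiset.eq_of_mem_replicate h)
  have hG : Stab G := by
    intro z hz
    rw [hGev]
    refine mul_ne_zero (leadingCoeff_ne_zero.mpr hp0) (Finset.prod_ne_zero_iff.mpr fun j _ => ?_)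
    rcases hmem j with ⟨r, hr, h'⟩ | h'
    · rw [h']
      simp only [one_mul]
      intro h0
      have : z j = r := by linear_combination h0
      refine h (z j) (hz j) ?_
      rw [← hpev, this]
      exact isRoot_of_mem_roots hr
    · rw [h']; simp
  have hdiag : ∀ s, mev G (fun _ => s) = p.eval s := by
    intro s
    rw [hGev]
    conv_rhs => rw [(IsAlgClosed.splits p).eq_prod_roots]
    simp only [eval_mul, eval_C, eval_multiset_prod, Multiset.map_map]
    congr 1
    have : ∏ j, ((g j).1 * s + (g j).2) =
        (((Finset.univ : Finset ι).val.map g).map fun q => q.1 * s + q.2).prod := by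
      rw [Multiset.map_map]; rfl
    rw [this, hg]
    simp [sub_eq_add_neg]
  -- The symmetrization depends on the rank only and agrees with `p` on the diagonal; comparing
  -- coefficients there identifies it with `v (rank x)`.
  let T := symmetrize G
  have hTrank : ∀ x y, rank x = rank y → T x = T y := by
    intro x y hxy
    obtain ⟨π, rfl⟩ := exists_perm_of_rank_eq hxy
    exact (symmetrize_apply_perm G π x).symm
  let γ : ℕ → ℂ := fun k => if hk : ∃ x : ι → Bool, rank x = k then T hk.choose else 0
  have hTγ : ∀ x, T x = γ (rank x) := by
    intro x
    have hk : ∃ y : ι → Bool, rank y = rank x := ⟨x, rfl⟩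
    simp only [γ, dif_pos hk]
    exact hTrank _ _ hk.choose_spec.symm
  let q : ℂ[X] := ∑ k ∈ Finset.range (Fintype.card ι + 1),
    C (((Fintype.card ι).choose k : ℂ) * γ k) * X ^ k
  have hqp : q = p := by
    refine Polynomial.funext fun s => ?_
    rw [← hdiag, ← mev_symmetrize_diag, mev_const_eq]
    change _ = ∑ x, T x * s ^ rank x
    simp_rw [hTγ]
    rw [sum_rank (ι := ι) fun k => γ k * s ^ k]
    simp [q, eval_finsetSum, mul_assoc]
  have hTv : T = fun x => v (rank x) := by
    ext x
    rw [hTγ]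
    have hc := congrArg (fun r => r.coeff (rank x)) hqp
    simp only [q, p, finsetSum_coeff, coeff_C_mul, coeff_X_pow] at hc
    have hr : rank x < Fintype.card ι + 1 := Nat.lt_succ_of_le (rank_le x)
    simp only [mul_ite, mul_one, mul_zero, Finset.sum_ite_eq, Finset.mem_range, hr,
      if_true] at hc
    refine mul_left_cancel₀ ?_ hc
    exact_mod_cast (Nat.choose_pos (rank_le x)).ne'
  rw [← hTv]
  exact hG.symmetrize

end

end StrongRayleigh

/-! ### Continuity of zeros and stability of the homogenization -/

open Filter Topology Polynomial in
/-- In a continuous family of polynomials of constant degree without real zeros, if one member has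
no zeros in the lower half-plane then neither does any other. -/
theorem Polynomial.no_lower_zeros_of_homotopy (M : ℕ) (c : ℝ → ℕ → ℂ)
    (hc : ∀ k, Continuous fun r => c r k) (hlead : ∀ r, c r M ≠ 0)
    (hreal : ∀ (r : ℝ) (s : ℂ), s.im = 0 → ∑ k ∈ Finset.range (M + 1), c r k * s ^ k ≠ 0)
    {r₀ : ℝ} (h₀ : ∀ s : ℂ, s.im < 0 → ∑ k ∈ Finset.range (M + 1), c r₀ k * s ^ k ≠ 0)
    (r : ℝ) (s : ℂ) (hs : s.im < 0) : ∑ k ∈ Finset.range (M + 1), c r k * s ^ k ≠ 0 := by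
  let p : ℝ → ℂ[X] := fun r => ∑ k ∈ Finset.range (M + 1), C (c r k) * X ^ k
  have hpev : ∀ r s, (p r).eval s = ∑ k ∈ Finset.range (M + 1), c r k * s ^ k := by
    intro r s; simp [p, eval_finsetSum]
  have hdeg : ∀ r, (p r).natDegree ≤ M := by
    intro r
    refine natDegree_sum_le_of_forall_le _ _ fun k hk => ?_
    exact (natDegree_C_mul_X_pow_le _ _).trans (by simpa [Nat.lt_succ_iff] using hk)
  have hcont : Continuous fun q : ℝ × ℂ => (p q.1).eval q.2 := by
    simp_rw [hpev]
    exact continuous_finsetSum _ fun k _ =>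
      ((hc k).comp continuous_fst).mul (continuous_snd.pow k)
  simp_rw [← hpev] at hreal h₀ ⊢
  let A : Set ℝ := {r | ∀ s : ℂ, s.im < 0 → (p r).eval s ≠ 0}
  -- Again through Harnack inequalities: a member that satisfies them and has a zero in the lower
  -- half-plane would vanish at `0` too, against `hreal`.
  have hclosed : IsClosed A := by
    have hex : ∀ q : ℂ × ℂ, q.1.im < 0 → ∃ ε > 0, ∀ t : ℂ, ‖t‖ < ε →
        (q.1 + t * (q.2 - q.1)).im < 0 := by
      intro q hq
      have hcq : Continuous fun t : ℂ => (q.1 + t * (q.2 - q.1)).im := by fun_prop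
      have : ∀ᶠ t in 𝓝 (0 : ℂ), (q.1 + t * (q.2 - q.1)).im < 0 :=
        hcq.continuousAt.eventually (gt_mem_nhds (by simpa using hq))
      obtain ⟨ε, hε, h⟩ := Metric.eventually_nhds_iff.mp this
      exact ⟨ε, hε, fun t ht => h (by simpa using ht)⟩
    choose ε hε hex using hex
    have : A = ⋂ q : ℂ × ℂ, ⋂ h : q.1.im < 0,
        {r | ‖(p r).eval q.2‖ ≤ (1 + 1 / ε q h) ^ M * ‖(p r).eval q.1‖} := by
      ext r
      simp only [Set.mem_iInter]
      constructor
      · intro hr q hq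
        have := ((p r).comp (C q.1 + X * C (q.2 - q.1))).norm_eval_one_le (hε q hq) (N := M)
          (fun t ht => by
            by_contra! hlt
            refine hr _ (hex q hq t hlt) ?_
            simpa [eval_comp] using ht)
          (by
            refine natDegree_comp_le.trans ?_
            calc (p r).natDegree * _ ≤ M * 1 := Nat.mul_le_mul (hdeg r) (by compute_degree)
              _ = M := mul_one M)
        simpa [eval_comp] using this
      · intro h s hs h0
        have h1 := h (s, 0) hs
        simp only [Set.mem_ofPred_eq, h0, norm_zero, mul_zero, norm_le_zero_iff] at h1
        exact hreal r 0 (by simp) h1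
    rw [this]
    refine isClosed_iInter fun q => isClosed_iInter fun h => isClosed_le ?_ ?_
    · exact (hcont.comp (Continuous.prodMk_left q.2)).norm
    · exact continuous_const.mul (hcont.comp (Continuous.prodMk_left q.1)).norm
  -- Cauchy's bound on the zeros; it is continuous because the leading coefficient never vanishes,
  -- so zeros cannot come in from infinity.
  let β : ℝ → ℝ := fun r => 1 + ∑ k ∈ Finset.range M, ‖c r k‖ / ‖c r M‖
  have hβ : Continuous β := continuous_const.add <| continuous_finsetSum _ fun k _ =>
    (hc k).norm.div (hc M).norm fun r => norm_ne_zero_iff.mpr (hlead r)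
  have hbound : ∀ r s, (p r).eval s = 0 → ‖s‖ ≤ β r := by
    intro r s h
    have hβ1 : 1 ≤ β r := by
      have : 0 ≤ ∑ k ∈ Finset.range M, ‖c r k‖ / ‖c r M‖ :=
        Finset.sum_nonneg fun k _ => by positivity
      simp only [β]; linarith
    by_contra! hlt
    have h1 : 1 < ‖s‖ := lt_of_le_of_lt hβ1 hlt
    rw [hpev, Finset.sum_range_succ] at h
    have hM : 0 < ‖c r M‖ := norm_pos_iff.mpr (hlead r)
    have h2 : ‖c r M‖ * ‖s‖ ^ M ≤ ∑ k ∈ Finset.range M, ‖c r k‖ * ‖s‖ ^ (M - 1) := by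
      have : c r M * s ^ M = -∑ k ∈ Finset.range M, c r k * s ^ k := by linear_combination h
      rw [← norm_pow, ← norm_mul, this, norm_neg]
      refine (norm_sum_le _ _).trans (Finset.sum_le_sum fun k hk => ?_)
      rw [norm_mul, norm_pow]
      have : k ≤ M - 1 := Nat.le_sub_one_of_lt (Finset.mem_range.mp hk)
      gcongr
      exact h1.le
    rcases Nat.eq_zero_or_pos M with rfl | hMpos
    · simp at h2
      exact hlead r h2
    rw [← Finset.sum_mul, ← Nat.sub_add_cancel hMpos, pow_succ, Nat.add_sub_cancel,
      Nat.sub_add_cancel hMpos, ← mul_assoc, mul_right_comm] at h2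
    have h3 : ‖c r M‖ * ‖s‖ ≤ ∑ k ∈ Finset.range M, ‖c r k‖ :=
      le_of_mul_le_mul_right h2 (by positivity)
    have h4 : ‖s‖ ≤ ∑ k ∈ Finset.range M, ‖c r k‖ / ‖c r M‖ := by
      rw [← Finset.sum_div, le_div_iff₀ hM]; linarith
    simp only [β] at hlt
    linarith
  -- Near `r₁` all zeros stay in one fixed disc, and on the compact lower half of that disc, real
  -- line included, non-vanishing is an open condition.
  have hopen : IsOpen A := by
    rw [isOpen_iff_mem_nhds]
    intro r₁ hr₁
    have hK : IsCompact (Metric.closedBall (0 : ℂ) (β r₁ + 1) ∩ {s | s.im ≤ 0}) :=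
      (isCompact_closedBall _ _).inter_right (isClosed_le Complex.continuous_im continuous_const)
    have h1 : ∀ᶠ r in 𝓝 r₁, ∀ s ∈ Metric.closedBall (0 : ℂ) (β r₁ + 1) ∩ {s | s.im ≤ 0},
        (p r).eval s ≠ 0 := by
      refine hK.eventually_forall_of_forall_eventually fun s hs => ?_
      refine (isOpen_ne_fun hcont continuous_const).mem_nhds ?_
      rcases (show s.im ≤ 0 from hs.2).lt_or_eq with h | h
      · exact hr₁ s h
      · exact hreal r₁ s h
    have h2 : ∀ᶠ r in 𝓝 r₁, β r < β r₁ + 1 :=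
      hβ.continuousAt.eventually (gt_mem_nhds (by linarith))
    filter_upwards [h1, h2] with r h1 h2 s hs h0
    refine h1 s ⟨?_, hs.le⟩ h0
    rw [mem_closedBall_zero_iff]
    exact (hbound r s h0).trans h2.le
  have huniv : A = Set.univ := IsClopen.eq_univ ⟨hclosed, hopen⟩ ⟨r₀, h₀⟩
  have : r ∈ A := huniv ▸ Set.mem_univ r
  exact this s hs

namespace StrongRayleigh

section

variable {ι : Type*} [Fintype ι]

/-- The restriction of the weights `w` to the vectors of rank `k`. -/
def level {M : Type*} [Zero M] (w : (ι → Bool) → M) (k : ℕ) (x : ι → Bool) : M :=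
  if rank x = k then w x else 0

theorem level_ofReal (w : (ι → Bool) → ℝ) (k : ℕ) :
    level (fun x => (w x : ℂ)) k = fun x => ((level w k x : ℝ) : ℂ) := by
  ext x
  simp only [level]
  split_ifs <;> simp

variable [DecidableEq ι]

theorem mev_smul_eq_sum_level (w : (ι → Bool) → ℂ) (s : ℂ) (z : ι → ℂ) :
    mev w (fun j => s * z j) =
      ∑ k ∈ Finset.range (Fintype.card ι + 1), mev (level w k) z * s ^ k := by
  rw [← mev_rank_pow]
  have h1 : (fun x => s ^ rank x * w x) = fun x =>
      ∑ k ∈ Finset.range (Fintype.card ι + 1), s ^ k * level w k x := by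
    ext x
    simp only [level, mul_ite, mul_zero, Finset.sum_ite_eq, Finset.mem_range,
      Nat.lt_succ_of_le (rank_le x), if_true]
  rw [h1, mev_sum]
  refine Finset.sum_congr rfl fun k _ => ?_
  rw [mev_const_mul, mul_comm]

theorem tendsto_ofReal_pow_mul (n : ℕ) (a : ℂ) :
    Filter.Tendsto (fun ε : ℝ => (ε : ℂ) ^ n * a) (nhdsWithin 0 (Set.Ioi 0))
      (nhds (if n = 0 then a else 0)) := by
  have hc : Continuous fun ε : ℝ => (ε : ℂ) ^ n * a := by fun_prop
  have := (hc.tendsto 0).mono_left (nhdsWithin_le_nhds (s := Set.Ioi 0))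
  convert this using 2
  split_ifs with h <;> simp [h]

/-- The top part is the limit of `ε^D f(z/ε)` as `ε` decreases to `0`. -/
theorem Stab.top_level {w : (ι → Bool) → ℂ} (hw : Stab w) {D : ℕ}
    (hD : ∀ x, w x ≠ 0 → rank x ≤ D) {z : ι → ℂ} (hz : mev (level w D) z ≠ 0) :
    Stab (level w D) := by
  refine Stab.of_tendsto (l := nhdsWithin (0 : ℝ) (Set.Ioi 0))
    (W := fun ε x => (ε : ℂ) ^ (D - rank x) * w x) ?_ (fun x => ?_) hz
  · filter_upwards [self_mem_nhdsWithin] with ε (hε : 0 < ε)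
    have hε' : (ε : ℂ) ≠ 0 := by exact_mod_cast hε.ne'
    have := (hw.field (fun _ => ε⁻¹) fun _ => inv_pos.mpr hε).const_mul (pow_ne_zero D hε')
    convert this using 2 with x
    rw [prod_ite_const]
    by_cases hx : w x = 0
    · simp [hx]
    · rw [pow_sub₀ _ hε' (hD x hx)]
      push_cast
      rw [inv_pow]; ring
  · have := tendsto_ofReal_pow_mul (D - rank x) (w x)
    convert this using 2
    by_cases hx : w x = 0
    · simp [level, hx]
    · have := hD x hx
      simp only [level]
      congr 1
      rw [eq_iff_iff]
      omega

/-- The bottom part is the limit of `ε^(-D) f(ε z)` as `ε` decreases to `0`. -/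
theorem Stab.bottom_level {w : (ι → Bool) → ℂ} (hw : Stab w) {D : ℕ}
    (hD : ∀ x, w x ≠ 0 → D ≤ rank x) {z : ι → ℂ} (hz : mev (level w D) z ≠ 0) :
    Stab (level w D) := by
  refine Stab.of_tendsto (l := nhdsWithin (0 : ℝ) (Set.Ioi 0))
    (W := fun ε x => (ε : ℂ) ^ (rank x - D) * w x) ?_ (fun x => ?_) hz
  · filter_upwards [self_mem_nhdsWithin] with ε (hε : 0 < ε)
    have hε' : (ε : ℂ) ≠ 0 := by exact_mod_cast hε.ne'
    have := (hw.field (fun _ => ε) fun _ => hε).const_mul (inv_ne_zero (pow_ne_zero D hε'))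
    convert this using 2 with x
    rw [prod_ite_const]
    by_cases hx : w x = 0
    · simp [hx]
    · rw [pow_sub₀ _ hε' (hD x hx)]
      ring
  · have := tendsto_ofReal_pow_mul (rank x - D) (w x)
    convert this using 2
    by_cases hx : w x = 0
    · simp [level, hx]
    · have := hD x hx
      simp only [level]
      congr 1
      rw [eq_iff_iff]
      omega

open ComplexConjugate

theorem mev_conj (w : (ι → Bool) → ℝ) (z : ι → ℂ) :
    mev (fun x => (w x : ℂ)) (fun j => conj (z j)) = conj (mev (fun x => (w x : ℂ)) z) := by
  simp only [mev, map_sum, map_mul, map_prod, Complex.conj_ofReal]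
  refine Finset.sum_congr rfl fun x _ => ?_
  congr 1
  refine Finset.prod_congr rfl fun j _ => ?_
  split_ifs <;> simp

theorem Stab.ne_zero_of_im_neg {w : (ι → Bool) → ℝ} (hw : Stab fun x => (w x : ℂ)) {z : ι → ℂ}
    (hz : ∀ j, (z j).im < 0) : mev (fun x => (w x : ℂ)) z ≠ 0 := by
  have := hw (fun j => conj (z j)) fun j => by simpa using hz j
  rwa [mev_conj, Ne, map_eq_zero] at this

theorem mev_ofReal (w : (ι → Bool) → ℝ) (t : ι → ℝ) :
    mev (fun x => (w x : ℂ)) (fun j => (t j : ℂ)) =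
      ((∑ x, w x * ∏ j, if x j then t j else 1 : ℝ) : ℂ) := by
  simp only [mev]
  push_cast
  refine Finset.sum_congr rfl fun x _ => ?_
  congr 1
  refine Finset.prod_congr rfl fun j _ => ?_
  split_ifs <;> simp

/-- Nonnegative coefficients cannot cancel at positive arguments. This supplies the point of
non-vanishing required by `Stab.of_tendsto`. -/
theorem mev_ne_zero_of_pos {w : (ι → Bool) → ℝ} (hw : ∀ x, 0 ≤ w x) (hw0 : ∃ x, w x ≠ 0)
    {t : ι → ℝ} (ht : ∀ j, 0 < t j) : mev (fun x => (w x : ℂ)) (fun j => (t j : ℂ)) ≠ 0 := by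
  rw [mev_ofReal, Complex.ofReal_ne_zero]
  have hp : ∀ x : ι → Bool, 0 < ∏ j, if x j then t j else 1 := fun x =>
    Finset.prod_pos fun j _ => by split_ifs <;> simp [ht]
  obtain ⟨x, hx⟩ := hw0
  refine (Finset.sum_pos' (fun y _ => mul_nonneg (hw y) (hp y).le)
    ⟨x, Finset.mem_univ x, mul_pos (lt_of_le_of_ne (hw x) hx.symm) (hp x)⟩).ne'

theorem Stab.exists_ne_zero {w : (ι → Bool) → ℂ} (hw : Stab w) : ∃ x, w x ≠ 0 := by
  by_contra! h
  exact hw (fun _ => Complex.I) (by simp) (by simp [mev, h])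

/-- The extreme ranks of the support of a nonnegative weight function. -/
theorem exists_extreme_levels {w : (ι → Bool) → ℝ} (hw0 : ∃ x, w x ≠ 0) :
    ∃ m M : ℕ, (∀ x, w x ≠ 0 → m ≤ rank x ∧ rank x ≤ M) ∧
      (∃ x, rank x = m ∧ w x ≠ 0) ∧ ∃ x, rank x = M ∧ w x ≠ 0 := by
  have hne : (Finset.univ.filter fun x => w x ≠ 0).Nonempty := by simpa [Finset.Nonempty] using hw0
  obtain ⟨a, ha, hamin⟩ := Finset.exists_min_image _ rank hne
  obtain ⟨b, hb, hbmax⟩ := Finset.exists_max_image _ rank hne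
  simp only [Finset.mem_filter, Finset.mem_univ, true_and] at ha hb hamin hbmax
  exact ⟨rank a, rank b, fun x hx => ⟨hamin x hx, hbmax x hx⟩, ⟨a, rfl, ha⟩, ⟨b, rfl, hb⟩⟩

theorem mev_level_one_ne_zero {w : (ι → Bool) → ℝ} (hw : ∀ x, 0 ≤ w x) {k : ℕ}
    (h : ∃ x, rank x = k ∧ w x ≠ 0) :
    mev (level (fun x => (w x : ℂ)) k) (fun _ => ((1 : ℝ) : ℂ)) ≠ 0 := by
  rw [level_ofReal]
  refine mev_ne_zero_of_pos (fun x => ?_) ?_ fun _ => one_pos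
  · simp only [level]; split_ifs <;> simp [hw]
  · obtain ⟨x, hx, hx0⟩ := h
    exact ⟨x, by simpa [level, hx]⟩

theorem mev_level_eq_zero {w : (ι → Bool) → ℂ} {k : ℕ} (h : ∀ x, rank x = k → w x = 0)
    (z : ι → ℂ) : mev (level w k) z = 0 := by
  refine Finset.sum_eq_zero fun x _ => ?_
  simp only [level]
  split_ifs with hx <;> simp [h, hx]

/-- A stable polynomial with nonnegative coefficients does not vanish at `s • z` when all
coordinates of `z` lie in the upper half-plane and `s` lies in the lower half-plane.  This is the
stability of its homogenization. -/
theorem Stab.smul_ne_zero {w : (ι → Bool) → ℝ} (hw : ∀ x, 0 ≤ w x) (hs : Stab fun x => (w x : ℂ))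
    {z : ι → ℂ} (hz : ∀ j, 0 < (z j).im) {s : ℂ} (hsim : s.im < 0) :
    mev (fun x => (w x : ℂ)) (fun j => s * z j) ≠ 0 := by
  have hw0 : ∃ x, w x ≠ 0 := by simpa using hs.exists_ne_zero
  obtain ⟨m, M, hmM, hm, hM⟩ := exists_extreme_levels hw0
  have hbot : Stab (level (fun x => (w x : ℂ)) m) :=
    hs.bottom_level (fun x hx => (hmM x (by exact_mod_cast hx)).1) (mev_level_one_ne_zero hw hm)
  have htop : Stab (level (fun x => (w x : ℂ)) M) :=
    hs.top_level (fun x hx => (hmM x (by exact_mod_cast hx)).2) (mev_level_one_ne_zero hw hM)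
  have hmleM : m ≤ M := by
    obtain ⟨x, hx, hx0⟩ := hm
    exact hx ▸ (hmM x hx0).2
  have hMd : M ≤ Fintype.card ι := by
    obtain ⟨x, hx, -⟩ := hM
    exact hx ▸ rank_le x
  -- With `s ^ m` factored out, the constant and the leading coefficient are the bottom and top
  -- levels, which are stable and so never vanish on the path below.
  have hexp : ∀ (s : ℂ) (z : ι → ℂ), mev (fun x => (w x : ℂ)) (fun j => s * z j) =
      s ^ m * ∑ k ∈ Finset.range (M - m + 1), mev (level (fun x => (w x : ℂ)) (m + k)) z * s ^ k := by
    intro s z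
    rw [mev_smul_eq_sum_level, Finset.mul_sum]
    have h1 : ∀ k, ¬ (m ≤ k ∧ k ≤ M) → mev (level (fun x => (w x : ℂ)) k) z * s ^ k = 0 := by
      intro k hk
      rw [mev_level_eq_zero, zero_mul]
      intro x hx
      by_contra hx0
      exact hk (hx ▸ hmM x (by exact_mod_cast hx0))
    rw [← Finset.sum_subset (s₁ := Finset.Ico m (M + 1))]
    · rw [Finset.sum_Ico_eq_sum_range, Nat.sub_add_comm hmleM]
      refine Finset.sum_congr rfl fun k _ => ?_
      rw [pow_add]; ring
    · intro k hk
      simp only [Finset.mem_Ico, Finset.mem_range] at hk ⊢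
      omega
    · intro k _ hk
      refine h1 k ?_
      simp only [Finset.mem_Ico] at hk
      omega
  -- A path in the upper half-space from the purely imaginary vector `i Im z`, at `r = 0`, to `z`,
  -- at `r = 1`. A real nonzero `s` is never a zero on it, because `s • zr r` lies wholly in the
  -- upper or wholly in the lower half-space.
  let zr : ℝ → ι → ℂ := fun r j => (r * (z j).re : ℝ) + (z j).im * Complex.I
  have hzr_im : ∀ r j, 0 < (zr r j).im := by intro r j; simpa [zr] using hz j
  have hz1 : zr 1 = z := by ext j; simp [zr, Complex.re_add_im]
  have hzr_cont : Continuous zr := by unfold zr; fun_prop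
  have hcase : ∀ r (s : ℂ), s ≠ 0 →
      (∑ k ∈ Finset.range (M - m + 1), mev (level (fun x => (w x : ℂ)) (m + k)) (zr r) * s ^ k = 0 ↔
        mev (fun x => (w x : ℂ)) (fun j => s * zr r j) = 0) := by
    intro r s hs0
    rw [hexp, mul_eq_zero, or_iff_right (pow_ne_zero m hs0)]
  have hs0 : s ≠ 0 := by rintro rfl; simp at hsim
  have := Polynomial.no_lower_zeros_of_homotopy (M - m)
    (fun r k => mev (level (fun x => (w x : ℂ)) (m + k)) (zr r))
    (fun k => (continuous_mev_right _).comp hzr_cont)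
    (fun r => by
      simp only [Nat.add_sub_cancel' hmleM]
      exact htop _ (hzr_im r))
    (fun r s hsre => by
      by_cases hs0 : s = 0
      · subst hs0
        rw [Finset.sum_range_succ']
        simpa using hbot _ (hzr_im r)
      · rw [Ne, hcase r s hs0]
        have hsr : s = (s.re : ℂ) := Complex.ext rfl (by simpa using hsre)
        have hre0 : s.re ≠ 0 := by
          intro h; rw [h] at hsr; exact hs0 (by simpa using hsr)
        rw [hsr]
        rcases hre0.lt_or_gt with h | h
        · refine hs.ne_zero_of_im_neg fun j => ?_
          simpa using mul_neg_of_neg_of_pos h (hzr_im r j)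
        · refine hs _ fun j => ?_
          simpa using mul_pos h (hzr_im r j))
    (r₀ := 0)
    (fun s hsneg => by
      have hs0 : s ≠ 0 := by rintro rfl; simp at hsneg
      rw [Ne, hcase 0 s hs0]
      have hval : ∀ j, s * zr 0 j = (z j).im * (s * Complex.I) := by
        intro j; simp [zr]; ring
      simp_rw [hval]
      -- At `r = 0` the argument is `s i` times a positive vector, and `Im (s i) = Re s`. When `Re s
      -- = 0`, `s i` is a positive real and nonnegativity of `w` decides.
      rcases lt_trichotomy s.re 0 with h | h | h
      · refine hs.ne_zero_of_im_neg fun j => ?_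
        simpa using mul_neg_of_pos_of_neg (hz j) h
      · have h2 : s * Complex.I = ((-s.im : ℝ) : ℂ) := by
          apply Complex.ext <;> simp [h]
        rw [h2]
        have := mev_ne_zero_of_pos hw hw0 (t := fun j => (z j).im * -s.im)
          fun j => mul_pos (hz j) (by linarith)
        simpa using this
      · refine hs _ fun j => ?_
        simpa using mul_pos (hz j) h)
    1 s hsim
  rw [Ne, hcase 1 s hs0, hz1] at this
  exact this

end

end StrongRayleigh

/-! ### Gauss–Lucas, vanishing of coefficients, and rank rescaling -/

namespace Polynomial

/-- If all zeros of `p` lie in a convex set that misses `0`, then no coefficient of `p` up to its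
degree vanishes. -/
theorem coeff_ne_zero_of_roots_mem_convex {S : Set ℂ} (hS : Convex ℝ S) (h0 : (0 : ℂ) ∉ S)
    {p : ℂ[X]} (hp0 : p ≠ 0) (hp : ∀ s, p.eval s = 0 → s ∈ S) {k : ℕ} (hk : k ≤ p.natDegree) :
    p.coeff k ≠ 0 := by
  induction k generalizing p with
  | zero =>
    rw [coeff_zero_eq_eval_zero]
    exact fun h => h0 (hp 0 h)
  | succ k ih =>
    have hdeg : 0 < p.degree := natDegree_pos_iff_degree_pos.mp (by omega)
    have hd : derivative p ≠ 0 := by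
      intro h
      have := derivative_eq_zero.mp h
      omega
    -- By Gauss–Lucas the zeros of the derivative remain in `S`, and its coefficient of index `k` is
    -- `k + 1` times that of `p` at `k + 1`.
    have h1 := ih hd (fun s hs => by
      have := rootSet_derivative_subset_convexHull_rootSet hdeg
        (show s ∈ p.derivative.rootSet ℂ by simpa [mem_rootSet, hd] using hs)
      refine convexHull_min (fun r hr => ?_) hS this
      rw [mem_rootSet] at hr
      exact hp r (by simpa using hr.2)) (by rw [natDegree_derivative]; omega)
    rw [coeff_derivative] at h1
    exact left_ne_zero_of_mul h1

/-- Dividing by the largest power of `X` removes the zero at the origin, which radial polynomials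
may have. -/
theorem coeff_ne_zero_of_nonzero_roots_mem_convex {S : Set ℂ} (hS : Convex ℝ S)
    (h0 : (0 : ℂ) ∉ S) {p : ℂ[X]} (hp0 : p ≠ 0) (hp : ∀ s, s ≠ 0 → p.eval s = 0 → s ∈ S) {k : ℕ}
    (hk₁ : p.natTrailingDegree ≤ k) (hk₂ : k ≤ p.natDegree) : p.coeff k ≠ 0 := by
  obtain ⟨g, hg⟩ : X ^ p.natTrailingDegree ∣ p :=
    X_pow_dvd_iff.mpr fun d hd => coeff_eq_zero_of_lt_natTrailingDegree hd
  set t := p.natTrailingDegree with ht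
  have hcoeff : ∀ i, p.coeff (i + t) = g.coeff i := by
    intro i
    rw [hg, coeff_X_pow_mul]
  have hg0 : g ≠ 0 := by
    rintro rfl
    rw [mul_zero] at hg
    exact hp0 hg
  have hgz : g.eval 0 ≠ 0 := by
    rw [← coeff_zero_eq_eval_zero, ← hcoeff, zero_add, ht]
    exact coeff_natTrailingDegree_ne_zero.mpr hp0
  have hdeg : p.natDegree = t + g.natDegree := by
    conv_lhs => rw [hg]
    rw [natDegree_mul (pow_ne_zero _ X_ne_zero) hg0, natDegree_X_pow]
  rw [← Nat.sub_add_cancel hk₁, hcoeff]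
  refine coeff_ne_zero_of_roots_mem_convex hS h0 hg0 (fun s hs => ?_) (by omega)
  refine hp s (fun h => hgz (h ▸ hs)) ?_
  rw [hg, eval_mul, hs, mul_zero]

end Polynomial

namespace StrongRayleigh

/-- The convex set consisting of the open upper half-plane and the negative reals. -/
theorem convex_upper_union_neg : Convex ℝ {s : ℂ | 0 < s.im ∨ (s.im = 0 ∧ s.re < 0)} := by
  intro x hx y hy a b ha hb hab
  simp only [Set.mem_ofPred_eq] at hx hy ⊢
  simp only [Complex.add_im, Complex.smul_im, Complex.add_re, Complex.smul_re, smul_eq_mul]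
  have hxi : 0 ≤ x.im := by rcases hx with h | h <;> linarith
  have hyi : 0 ≤ y.im := by rcases hy with h | h <;> linarith
  rcases ha.eq_or_lt with rfl | ha'
  · have : b = 1 := by linarith
    subst this; simpa using hy
  rcases hb.eq_or_lt with rfl | hb'
  · have : a = 1 := by linarith
    subst this; simpa using hx
  rcases hx with hx | ⟨hx, hx'⟩
  · left; have := mul_pos ha' hx; have := mul_nonneg hb hyi; linarith
  rcases hy with hy | ⟨hy, hy'⟩
  · left; have := mul_pos hb' hy; have := mul_nonneg ha hxi; linarith
  · right
    constructor
    · rw [hx, hy]; simp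
    · have := mul_neg_of_pos_of_neg ha' hx'
      have := mul_neg_of_pos_of_neg hb' hy'
      linarith

section

variable {ι : Type*} [Fintype ι] [DecidableEq ι]

open Polynomial in
/-- The polynomial `s ↦ f(s • z)`. -/
noncomputable def radialPoly (w : (ι → Bool) → ℂ) (z : ι → ℂ) : ℂ[X] :=
  ∑ k ∈ Finset.range (Fintype.card ι + 1), C (mev (level w k) z) * X ^ k

theorem eval_radialPoly (w : (ι → Bool) → ℂ) (z : ι → ℂ) (s : ℂ) :
    (radialPoly w z).eval s = mev w fun j => s * z j := by
  rw [mev_smul_eq_sum_level]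
  simp [radialPoly, Polynomial.eval_finsetSum]

theorem coeff_radialPoly (w : (ι → Bool) → ℂ) (z : ι → ℂ) (k : ℕ) :
    (radialPoly w z).coeff k = mev (level w k) z := by
  simp only [radialPoly, Polynomial.finsetSum_coeff, Polynomial.coeff_C_mul,
    Polynomial.coeff_X_pow, mul_ite, mul_one, mul_zero, Finset.sum_ite_eq, Finset.mem_range]
  split_ifs with h
  · rfl
  · rw [mev_level_eq_zero]
    intro x hx
    have := rank_le x
    omega

/-- The lower half-plane is excluded by `Stab.smul_ne_zero`. A nonzero real `s` sends `z` into the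
upper or the lower half-space, where `f` has no zeros. -/
theorem radialPoly_root_mem {w : (ι → Bool) → ℝ} (hw : ∀ x, 0 ≤ w x)
    (hs : Stab fun x => (w x : ℂ)) {z : ι → ℂ} (hz : ∀ j, 0 < (z j).im) {s : ℂ} (hs0 : s ≠ 0)
    (h : (radialPoly (fun x => (w x : ℂ)) z).eval s = 0) : 0 < s.im := by
  rw [eval_radialPoly] at h
  by_contra! hle
  rcases hle.lt_or_eq with hlt | heq
  · exact hs.smul_ne_zero hw hz hlt h
  · rcases lt_trichotomy s.re 0 with hr | hr | hr
    · refine hs.ne_zero_of_im_neg (fun j => ?_) h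
      simpa [heq] using mul_neg_of_neg_of_pos hr (hz j)
    · exact hs0 (Complex.ext hr heq)
    · refine hs _ (fun j => ?_) h
      simpa [heq] using mul_pos hr (hz j)

/-- The rank sequence of a nonnegative stable weight function has no internal zeros. -/
theorem Stab.level_ne_zero {w : (ι → Bool) → ℝ} (hw : ∀ x, 0 ≤ w x)
    (hs : Stab fun x => (w x : ℂ)) {z : ι → ℂ} (hz : ∀ j, 0 < (z j).im) {i j k : ℕ}
    (hi : ∃ x, rank x = i ∧ w x ≠ 0) (hk : ∃ x, rank x = k ∧ w x ≠ 0) (hij : i ≤ j)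
    (hjk : j ≤ k) : mev (level (fun x => (w x : ℂ)) j) z ≠ 0 := by
  have hw0 : ∃ x, w x ≠ 0 := by simpa using hs.exists_ne_zero
  obtain ⟨m, M, hmM, hm, hM⟩ := exists_extreme_levels hw0
  have hbot := hs.bottom_level (fun x hx => (hmM x (by exact_mod_cast hx)).1)
    (mev_level_one_ne_zero hw hm) z hz
  have htop := hs.top_level (fun x hx => (hmM x (by exact_mod_cast hx)).2)
    (mev_level_one_ne_zero hw hM) z hz
  rw [← coeff_radialPoly] at hbot htop ⊢
  have hmi : m ≤ i := by obtain ⟨x, rfl, hx⟩ := hi; exact (hmM x hx).1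
  have hkM : k ≤ M := by obtain ⟨x, rfl, hx⟩ := hk; exact (hmM x hx).2
  refine Polynomial.coeff_ne_zero_of_nonzero_roots_mem_convex convex_upper_union_neg (by simp)
    (fun h => hbot (by rw [h, Polynomial.coeff_zero]))
    (fun s hs0 h => Or.inl (radialPoly_root_mem hw hs hz hs0 h)) ?_ ?_
  · exact (Polynomial.natTrailingDegree_le_of_ne_zero hbot).trans (hmi.trans hij)
  · exact (hjk.trans hkM).trans (Polynomial.le_natDegree_of_ne_zero htop)

open Polynomial ComplexConjugate in
/-- Rank rescaling by the coefficients of a univariate stable polynomial preserves stability. -/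
theorem Stab.rank_rescale {w : (ι → Bool) → ℝ} (hw : ∀ x, 0 ≤ w x)
    (hs : Stab fun x => (w x : ℂ)) {b : ℕ → ℝ} (hb : ∀ i ≤ Fintype.card ι, 0 ≤ b i)
    (hB : ∀ s : ℂ, 0 < s.im → ∑ i ∈ Finset.range (Fintype.card ι + 1), (b i : ℂ) * s ^ i ≠ 0)
    (hne : ∃ x, b (rank x) * w x ≠ 0) : Stab fun x => ((b (rank x) * w x : ℝ) : ℂ) := by
  intro z hz
  set d := Fintype.card ι with hd
  obtain ⟨x₀, hx₀⟩ := hne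
  have hj := rank_le x₀
  have hbj : b (rank x₀) ≠ 0 := left_ne_zero_of_mul hx₀
  have hwj : w x₀ ≠ 0 := right_ne_zero_of_mul hx₀
  let P := radialPoly (fun x => (w x : ℂ)) z
  -- The reversal `s^d B(1/s)` of the polynomial with coefficients `b`. Reversing makes `∑ b_k
  -- f_k(z)`, with `f_k` the degree `k` part, the coefficient of index `d` in `P * R`.
  let R : ℂ[X] := ∑ k ∈ Finset.range (d + 1), C (b (d - k) : ℂ) * X ^ k
  have hRc : ∀ k ≤ d, R.coeff k = b (d - k) := by
    intro k hk
    simp only [R, finsetSum_coeff, coeff_C_mul, coeff_X_pow, mul_ite, mul_one, mul_zero,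
      Finset.sum_ite_eq, Finset.mem_range, Nat.lt_succ_of_le hk, if_true]
  have hval : mev (fun x => ((b (rank x) * w x : ℝ) : ℂ)) z = (P * R).coeff d := by
    have h1 : (fun x => ((b (rank x) * w x : ℝ) : ℂ)) = fun x =>
        ∑ k ∈ Finset.range (d + 1), (b k : ℂ) * level (fun x => (w x : ℂ)) k x := by
      ext x
      simp only [level, mul_ite, mul_zero, Finset.sum_ite_eq, Finset.mem_range,
        Nat.lt_succ_of_le (rank_le x), hd, if_true, Complex.ofReal_mul]
    rw [h1, mev_sum, coeff_mul, Finset.Nat.sum_antidiagonal_eq_sum_range_succ_mk]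
    refine Finset.sum_congr rfl fun k hk => ?_
    have hk' : k ≤ d := Nat.lt_succ_iff.mp (Finset.mem_range.mp hk)
    rw [mev_const_mul, coeff_radialPoly, hRc _ (Nat.sub_le _ _), Nat.sub_sub_self hk', mul_comm]
  have hPj : P.coeff (rank x₀) ≠ 0 := by
    rw [coeff_radialPoly]
    exact hs.level_ne_zero hw hz ⟨x₀, rfl, hwj⟩ ⟨x₀, rfl, hwj⟩ le_rfl le_rfl
  have hRj : R.coeff (d - rank x₀) ≠ 0 := by
    rw [hRc _ (Nat.sub_le _ _), Nat.sub_sub_self hj]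
    exact_mod_cast hbj
  have hP0 : P ≠ 0 := fun h => hPj (by rw [h, coeff_zero])
  have hR0 : R ≠ 0 := fun h => hRj (by rw [h, coeff_zero])
  -- Real coefficients and stability force real zeros; nonnegative coefficients exclude positive
  -- ones.
  have hRroot : ∀ s, s ≠ 0 → R.eval s = 0 → s.im = 0 ∧ s.re < 0 := by
    intro s hs0 h
    have hBz : ∑ i ∈ Finset.range (d + 1), (b i : ℂ) * (s⁻¹) ^ i = 0 := by
      have h1 : R.eval s = s ^ d * ∑ i ∈ Finset.range (d + 1), (b i : ℂ) * (s⁻¹) ^ i := by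
        rw [← Finset.sum_range_reflect, Finset.mul_sum]
        simp only [R, eval_finsetSum, eval_mul, eval_C, eval_pow, eval_X]
        refine Finset.sum_congr rfl fun k hk => ?_
        have hk' : k ≤ d := Nat.lt_succ_iff.mp (Finset.mem_range.mp hk)
        have h2 : d + 1 - 1 - k = d - k := by omega
        rw [h2, inv_pow, pow_sub₀ _ hs0 hk']
        field_simp
      rw [h1] at h
      exact (mul_eq_zero.mp h).resolve_left (pow_ne_zero _ hs0)
    have him : s.im = 0 := by
      rcases lt_trichotomy s.im 0 with h1 | h1 | h1
      · refine absurd hBz (hB s⁻¹ ?_)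
        rw [Complex.inv_im]
        exact div_pos (by linarith) (Complex.normSq_pos.mpr hs0)
      · exact h1
      · refine absurd (congrArg conj hBz) ?_
        have := hB (conj s⁻¹) (by
          rw [Complex.conj_im, Complex.inv_im, neg_div, neg_neg]
          exact div_pos h1 (Complex.normSq_pos.mpr hs0))
        simpa using this
    refine ⟨him, ?_⟩
    by_contra! hre
    have hsr : s = (s.re : ℂ) := Complex.ext rfl (by simpa using him)
    have hre' : 0 < s.re := by
      refine lt_of_le_of_ne hre fun h0 => hs0 ?_
      rw [hsr, ← h0, Complex.ofReal_zero]
    rw [hsr] at hBz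
    have h3 : ∑ i ∈ Finset.range (d + 1), b i * (s.re⁻¹) ^ i = 0 := by exact_mod_cast hBz
    have h4 := (Finset.sum_eq_zero_iff_of_nonneg fun i hi =>
      mul_nonneg (hb i (Nat.lt_succ_iff.mp (Finset.mem_range.mp hi))) (by positivity)).mp h3
      (rank x₀) (Finset.mem_range.mpr (Nat.lt_succ_of_le hj))
    exact (mul_ne_zero hbj (by positivity)) h4
  -- The nonzero zeros of `P` lie in the open upper half-plane and those of `R` on the negative
  -- axis. Both sets sit in one convex set that misses `0`, so the Gauss–Lucas criterion applies to
  -- the product.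
  rw [hval]
  refine coeff_ne_zero_of_nonzero_roots_mem_convex convex_upper_union_neg (by simp)
    (mul_ne_zero hP0 hR0) (fun s hs0 h => ?_) ?_ ?_
  · rw [eval_mul, mul_eq_zero] at h
    rcases h with h | h
    · exact Or.inl (radialPoly_root_mem hw hs hz hs0 h)
    · exact Or.inr (hRroot s hs0 h)
  · rw [natTrailingDegree_mul hP0 hR0]
    have := natTrailingDegree_le_of_ne_zero hPj
    have := natTrailingDegree_le_of_ne_zero hRj
    omega
  · rw [natDegree_mul hP0 hR0]
    have := le_natDegree_of_ne_zero hPj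
    have := le_natDegree_of_ne_zero hRj
    omega

end

end StrongRayleigh

/-! ### Conditioning, the Rayleigh inequality and the Feder–Mihail theorem -/

namespace StrongRayleigh

section Restrict

variable {ι : Type*} [Fintype ι] [DecidableEq ι]

/-- The restriction of the weights `w` to the vectors whose `j`-th coordinate is `b`. -/
def restr {M : Type*} [Zero M] (j : ι) (b : Bool) (w : (ι → Bool) → M) (x : ι → Bool) : M :=
  if x j = b then w x else 0

omit [Fintype ι] [DecidableEq ι] in
theorem restr_comm {M : Type*} [Zero M] (i j : ι) (a b : Bool) (w : (ι → Bool) → M) :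
    restr i a (restr j b w) = restr j b (restr i a w) := by
  ext x
  simp only [restr]
  split_ifs <;> rfl

/-- Conditioning is the limit of an external field at `j` alone: `z_j` is replaced by `ε z_j` for
the value `0`, and by `z_j / ε`, with an overall factor `ε`, for the value `1`. -/
theorem Stab.restr {w : (ι → Bool) → ℂ} (hw : Stab w) (j : ι) (b : Bool) {z : ι → ℂ}
    (hz : mev (restr j b w) z ≠ 0) : Stab (restr j b w) := by
  cases b
  · refine Stab.of_tendsto (l := nhdsWithin (0 : ℝ) (Set.Ioi 0))
      (W := fun ε x => (ε : ℂ) ^ (if x j then 1 else 0) * w x) ?_ (fun x => ?_) hz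
    · filter_upwards [self_mem_nhdsWithin] with ε (hε : 0 < ε)
      have := hw.field (fun i => if i = j then ε else 1) fun i => by split_ifs <;> simp [hε]
      convert this using 2 with x
      congr 1
      rw [Finset.prod_eq_single j]
      · cases x j <;> simp
      · intro i _ hij; simp [hij]
      · simp
    · convert tendsto_ofReal_pow_mul (if x j then 1 else 0) (w x) using 2
      simp only [StrongRayleigh.restr]
      cases x j <;> simp
  · refine Stab.of_tendsto (l := nhdsWithin (0 : ℝ) (Set.Ioi 0))
      (W := fun ε x => (ε : ℂ) ^ (if x j then 0 else 1) * w x) ?_ (fun x => ?_) hz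
    · filter_upwards [self_mem_nhdsWithin] with ε (hε : 0 < ε)
      have hε' : (ε : ℂ) ≠ 0 := by exact_mod_cast hε.ne'
      have := (hw.field (fun i => if i = j then ε⁻¹ else 1) fun i => by
        split_ifs <;> simp [hε]).const_mul hε'
      convert this using 2 with x
      rw [← mul_assoc]
      congr 1
      rw [Finset.prod_eq_single j]
      · cases x j <;> simp [hε']
      · intro i _ hij; simp [hij]
      · simp
    · convert tendsto_ofReal_pow_mul (if x j then 0 else 1) (w x) using 2
      simp only [StrongRayleigh.restr]
      cases x j <;> simp

/-- Nonnegative weights whose generating polynomial is stable or zero. -/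
structure SRWeight (w : (ι → Bool) → ℝ) : Prop where
  nonneg : ∀ x, 0 ≤ w x
  stab : (∃ x, w x ≠ 0) → Stab fun x => (w x : ℂ)

theorem SRWeight.restr {w : (ι → Bool) → ℝ} (hw : SRWeight w) (j : ι) (b : Bool) :
    SRWeight (restr j b w) where
  nonneg x := by
    simp only [StrongRayleigh.restr]
    split_ifs
    · exact hw.nonneg x
    · exact le_rfl
  stab := by
    intro hne
    have hw0 : ∃ x, w x ≠ 0 := by
      obtain ⟨x, hx⟩ := hne
      refine ⟨x, fun h => hx ?_⟩
      simp [StrongRayleigh.restr, h]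
    have heq : (fun x => ((StrongRayleigh.restr j b w x : ℝ) : ℂ)) =
        StrongRayleigh.restr j b fun x => (w x : ℂ) := by
      ext x
      simp only [StrongRayleigh.restr]
      split_ifs <;> simp
    have h1 := mev_ne_zero_of_pos (w := StrongRayleigh.restr j b w) (t := fun _ => 1) (fun x => by
      simp only [StrongRayleigh.restr]
      split_ifs
      · exact hw.nonneg x
      · exact le_rfl) hne fun _ => one_pos
    rw [heq] at h1 ⊢
    exact (hw.stab hw0).restr j b h1

/-- The weighted sum of the function `f`. -/
def wsum (w f : (ι → Bool) → ℝ) : ℝ := ∑ x, w x * f x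

theorem wsum_restr_add (j : ι) (w f : (ι → Bool) → ℝ) :
    wsum (restr j true w) f + wsum (restr j false w) f = wsum w f := by
  simp only [wsum, restr, ← Finset.sum_add_distrib]
  refine Finset.sum_congr rfl fun x _ => ?_
  cases x j <;> simp

/-- Pairwise negative correlation: the Rayleigh inequality. -/
theorem SRWeight.rayleigh {w : (ι → Bool) → ℝ} (hw : SRWeight w) {i j : ι} (hij : i ≠ j) :
    wsum w 1 * wsum (StrongRayleigh.restr i true (StrongRayleigh.restr j true w)) 1 ≤
      wsum (StrongRayleigh.restr i true w) 1 * wsum (StrongRayleigh.restr j true w) 1 := by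
  by_cases hne : ∃ x, w x ≠ 0
  swap
  · push Not at hne
    simp [wsum, hne, StrongRayleigh.restr]
  have hs := hw.stab hne
  -- The `i`-th variable is `I`, the `j`-th is free, and the others approach `1` from inside the
  -- upper half-plane. In the limit `Im (p q̄) ≥ 0` says that the mass with `(x_i, x_j) = (0,0)`
  -- times that with `(1,1)` is at most the mass with `(1,0)` times that with `(0,1)`.
  let Z : ℝ → ℂ → ι → ℂ := fun ε t =>
    Function.update (Function.update (fun _ => 1 + (ε : ℂ) * Complex.I) i Complex.I) j t
  let F : ℝ → ℂ → ℂ := fun ε t => mev (fun x => (w x : ℂ)) (Z ε t)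
  have hFc : ∀ t, Continuous fun ε => F ε t := by
    intro t
    refine (continuous_mev_right _).comp ?_
    refine Continuous.update (Continuous.update ?_ i continuous_const) j continuous_const
    fun_prop
  have hpos : ∀ ε : ℝ, 0 < ε → 0 ≤ (F ε 0 * (starRingEnd ℂ) (F ε 1 - F ε 0)).im := by
    intro ε hε
    refine im_mul_conj_nonneg fun t ht => ?_
    have h1 := mev_update (fun x => (w x : ℂ))
      (Function.update (fun _ => 1 + (ε : ℂ) * Complex.I) i Complex.I) j t
    simp only [F, Z]
    rw [← h1]
    refine hs _ fun l => ?_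
    rcases eq_or_ne l j with rfl | hj
    · simpa
    rcases eq_or_ne l i with rfl | hi
    · simp [hij]
    · simpa [hi, hj] using hε
  have hlim : 0 ≤ (F 0 0 * (starRingEnd ℂ) (F 0 1 - F 0 0)).im := by
    have hc : Continuous fun ε => (F ε 0 * (starRingEnd ℂ) (F ε 1 - F ε 0)).im :=
      Complex.continuous_im.comp
        ((hFc 0).mul (Complex.continuous_conj.comp ((hFc 1).sub (hFc 0))))
    refine ge_of_tendsto ((hc.tendsto 0).mono_left (nhdsWithin_le_nhds (s := Set.Ioi 0))) ?_
    filter_upwards [self_mem_nhdsWithin] with ε hε using hpos ε hε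
  have hF : ∀ t : ℂ, F 0 t = ∑ x, (w x : ℂ) *
      ((if x i then Complex.I else 1) * (if x j then t else 1)) := by
    intro t
    refine Finset.sum_congr rfl fun x _ => ?_
    congr 1
    rw [Finset.prod_eq_mul i j hij]
    · simp [Z, hij]
    · intro l _ hl; simp [Z, hl.1, hl.2]
    · simp
    · simp
  have hF0 : F 0 0 = ∑ x, (w x : ℂ) * ((if x i then Complex.I else 1) * (if x j then 0 else 1)) :=
    hF 0
  have hF1 : F 0 1 - F 0 0 =
      ∑ x, (w x : ℂ) * ((if x i then Complex.I else 1) * (if x j then 1 else 0)) := by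
    rw [hF, hF, ← Finset.sum_sub_distrib]
    refine Finset.sum_congr rfl fun x _ => ?_
    split_ifs <;> ring
  have ere : ∀ g : (ι → Bool) → ℂ, (∑ x, (w x : ℂ) * g x).re = ∑ x, w x * (g x).re := by
    intro g; rw [Complex.re_sum]; simp
  have eim : ∀ g : (ι → Bool) → ℂ, (∑ x, (w x : ℂ) * g x).im = ∑ x, w x * (g x).im := by
    intro g; rw [Complex.im_sum]; simp
  rw [Complex.mul_im, Complex.conj_re, Complex.conj_im, hF1, hF0, ere, eim, ere, eim] at hlim
  have s1 : ∑ x, w x * ((if x i then Complex.I else 1) * (if x j then 0 else 1) : ℂ).re =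
      wsum w 1 - wsum (StrongRayleigh.restr i true w) 1 - wsum (StrongRayleigh.restr j true w) 1 +
        wsum (StrongRayleigh.restr i true (StrongRayleigh.restr j true w)) 1 := by
    simp only [wsum, StrongRayleigh.restr, ← Finset.sum_sub_distrib, ← Finset.sum_add_distrib]
    refine Finset.sum_congr rfl fun x _ => ?_
    cases x i <;> cases x j <;> simp
  have s2 : ∑ x, w x * ((if x i then Complex.I else 1) * (if x j then 0 else 1) : ℂ).im =
      wsum (StrongRayleigh.restr i true w) 1 -
        wsum (StrongRayleigh.restr i true (StrongRayleigh.restr j true w)) 1 := by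
    simp only [wsum, StrongRayleigh.restr, ← Finset.sum_sub_distrib]
    refine Finset.sum_congr rfl fun x _ => ?_
    cases x i <;> cases x j <;> simp
  have s3 : ∑ x, w x * ((if x i then Complex.I else 1) * (if x j then 1 else 0) : ℂ).re =
      wsum (StrongRayleigh.restr j true w) 1 -
        wsum (StrongRayleigh.restr i true (StrongRayleigh.restr j true w)) 1 := by
    simp only [wsum, StrongRayleigh.restr, ← Finset.sum_sub_distrib]
    refine Finset.sum_congr rfl fun x _ => ?_
    cases x i <;> cases x j <;> simp
  have s4 : ∑ x, w x * ((if x i then Complex.I else 1) * (if x j then 1 else 0) : ℂ).im =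
      wsum (StrongRayleigh.restr i true (StrongRayleigh.restr j true w)) 1 := by
    simp only [wsum, StrongRayleigh.restr]
    refine Finset.sum_congr rfl fun x _ => ?_
    cases x i <;> cases x j <;> simp
  rw [s1, s2, s3, s4] at hlim
  linarith

/-! ### Negative association of homogeneous weights -/

/-- The coordinates that are not constant on the support of `w`. -/
noncomputable def freeCoords (w : (ι → Bool) → ℝ) : Finset ι :=
  open Classical in
  Finset.univ.filter fun j => (∃ x, x j = true ∧ w x ≠ 0) ∧ ∃ x, x j = false ∧ w x ≠ 0

theorem mem_freeCoords {w : (ι → Bool) → ℝ} {j : ι} :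
    j ∈ freeCoords w ↔ (∃ x, x j = true ∧ w x ≠ 0) ∧ ∃ x, x j = false ∧ w x ≠ 0 := by
  simp [freeCoords]

omit [Fintype ι] [DecidableEq ι] in
theorem restr_ne_zero {w : (ι → Bool) → ℝ} {j : ι} {b : Bool} {x : ι → Bool} :
    restr j b w x ≠ 0 ↔ x j = b ∧ w x ≠ 0 := by
  simp [restr]

theorem freeCoords_restr_ssubset {w : (ι → Bool) → ℝ} {j : ι} (hj : j ∈ freeCoords w) (b : Bool) :
    freeCoords (restr j b w) ⊂ freeCoords w := by
  refine (Finset.ssubset_iff_of_subset fun i hi => ?_).mpr ⟨j, hj, fun h => ?_⟩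
  · rw [mem_freeCoords] at hi ⊢
    obtain ⟨⟨x, hx, hx'⟩, y, hy, hy'⟩ := hi
    exact ⟨⟨x, hx, (restr_ne_zero.mp hx').2⟩, y, hy, (restr_ne_zero.mp hy').2⟩
  · rw [mem_freeCoords] at h
    obtain ⟨⟨x, hx, hx'⟩, y, hy, hy'⟩ := h
    have h1 := (restr_ne_zero.mp hx').1
    have h2 := (restr_ne_zero.mp hy').1
    rw [hx] at h1; rw [hy] at h2
    rw [← h1] at h2; cases h2

theorem wsum_one_pos {w : (ι → Bool) → ℝ} (hw : ∀ x, 0 ≤ w x) (h : ∃ x, w x ≠ 0) :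
    0 < wsum w 1 := by
  obtain ⟨x, hx⟩ := h
  simp only [wsum, Pi.one_apply, mul_one]
  exact Finset.sum_pos' (fun y _ => hw y) ⟨x, Finset.mem_univ x, lt_of_le_of_ne (hw x) hx.symm⟩

theorem wsum_one_nonneg {w : (ι → Bool) → ℝ} (hw : ∀ x, 0 ≤ w x) : 0 ≤ wsum w 1 :=
  Finset.sum_nonneg fun x _ => by simpa using hw x

theorem wsum_eq_const_mul {w f : (ι → Bool) → ℝ} {c : ℝ} (h : ∀ x, w x ≠ 0 → f x = c) :
    wsum w f = c * wsum w 1 := by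
  simp only [wsum, Finset.mul_sum, Pi.one_apply, mul_one]
  refine Finset.sum_congr rfl fun x _ => ?_
  by_cases hx : w x = 0
  · simp [hx]
  · rw [h x hx, mul_comm]

/-- The unnormalized covariance of `f` and `X_j`. -/
def cov (w f : (ι → Bool) → ℝ) (j : ι) : ℝ :=
  wsum w 1 * wsum (restr j true w) f - wsum w f * wsum (restr j true w) 1

/-- On a homogeneous weight `∑ X_j` is the constant `r`, and a constant has no covariance with `f`.
-/
theorem sum_cov {w : (ι → Bool) → ℝ} {r : ℕ} (hr : ∀ x, w x ≠ 0 → rank x = r)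
    (f : (ι → Bool) → ℝ) : ∑ j, cov w f j = 0 := by
  have key : ∀ g : (ι → Bool) → ℝ, ∑ j, wsum (restr j true w) g = r * wsum w g := by
    intro g
    simp only [wsum, restr]
    rw [Finset.sum_comm, Finset.mul_sum]
    refine Finset.sum_congr rfl fun x _ => ?_
    by_cases hx : w x = 0
    · simp [hx]
    · rw [← hr x hx, rank, ← Finset.sum_mul, ← Finset.sum_filter, Finset.sum_const, nsmul_eq_mul]
      ring
  simp only [cov, Finset.sum_sub_distrib, ← Finset.mul_sum, key]
  ring

theorem cov_eq_zero_of_notMem_freeCoords {w : (ι → Bool) → ℝ} (f : (ι → Bool) → ℝ) {j : ι}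
    (hj : j ∉ freeCoords w) : cov w f j = 0 := by
  rw [mem_freeCoords, not_and_or] at hj
  push Not at hj
  have h1 : restr j true w = 0 ∨ restr j true w = w := by
    rcases hj with h | h
    · left; ext x
      by_contra hx
      obtain ⟨h1, h2⟩ := restr_ne_zero.mp hx
      exact h2 (h x h1)
    · right; ext x
      simp only [restr]
      split_ifs with hx
      · rfl
      · exact (h x (by simpa using hx)).symm
  rcases h1 with h1 | h1
  · simp [cov, h1, wsum]
  · rw [cov, h1]; ring

/-- In a homogeneous weight, an increasing function is negatively correlated with any coordinate
it does not depend on. -/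
theorem SRWeight.cov_nonpos {w : (ι → Bool) → ℝ} (hw : SRWeight w) {r : ℕ}
    (hr : ∀ x, w x ≠ 0 → rank x = r) {f : (ι → Bool) → ℝ} (hf : Monotone f) (e : ι)
    (hfe : ∀ x b, f (Function.update x e b) = f x) : cov w f e ≤ 0 := by
  induction hn : (freeCoords w).card using Nat.strong_induction_on generalizing w with
  | _ n ih =>
  by_cases h1 : ∃ x, StrongRayleigh.restr e true w x ≠ 0
  swap
  · push Not at h1
    simp [cov, wsum, h1]
  have hw1 := hw.restr e true
  have hr1 : ∀ x, StrongRayleigh.restr e true w x ≠ 0 → rank x = r :=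
    fun x hx => hr x (restr_ne_zero.mp hx).2
  have hray : ∀ j, j ≠ e →
      wsum (StrongRayleigh.restr j false w) 1 *
        wsum (StrongRayleigh.restr e true (StrongRayleigh.restr j true w)) 1 ≤
      wsum (StrongRayleigh.restr j true w) 1 *
        wsum (StrongRayleigh.restr e true (StrongRayleigh.restr j false w)) 1 := by
    intro j hj
    have := hw.rayleigh hj
    rw [← wsum_restr_add j w, restr_comm] at this
    rw [← wsum_restr_add j (StrongRayleigh.restr e true w), restr_comm j e, restr_comm j e] at this
    linarith
  by_cases hfree : (freeCoords (StrongRayleigh.restr e true w)).Nonempty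
  -- Given `X_e = 1` the covariances of `f` with the coordinates add up to zero, so some free
  -- coordinate has a nonnegative one.
  · obtain ⟨j, hj, hcov⟩ : ∃ j ∈ freeCoords (StrongRayleigh.restr e true w),
        0 ≤ cov (StrongRayleigh.restr e true w) f j := by
      by_contra! hall
      have hlt := Finset.sum_lt_sum_of_nonempty hfree hall
      rw [Finset.sum_const_zero, Finset.sum_subset (Finset.subset_univ _)
        fun j _ hj => cov_eq_zero_of_notMem_freeCoords f hj, sum_cov hr1] at hlt
      exact lt_irrefl _ hlt
    have hj' := mem_freeCoords.mp hj
    have hje : j ≠ e := by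
      rintro rfl
      obtain ⟨-, x, hx, hx'⟩ := hj'
      have := (restr_ne_zero.mp hx').1
      rw [hx] at this; cases this
    have hjw : j ∈ freeCoords w := by
      rw [mem_freeCoords]
      obtain ⟨⟨x, hx, hx'⟩, y, hy, hy'⟩ := hj'
      exact ⟨⟨x, hx, (restr_ne_zero.mp hx').2⟩, y, hy, (restr_ne_zero.mp hy').2⟩
    have ih' : ∀ b, cov (StrongRayleigh.restr j b w) f e ≤ 0 := fun b =>
      ih _ (hn ▸ Finset.card_lt_card (freeCoords_restr_ssubset hjw b)) (hw.restr j b)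
        (fun x hx => hr x (restr_ne_zero.mp hx).2) rfl
    have i1 := ih' true
    have i0 := ih' false
    have hray' := hray j hje
    have ha1 : 0 < wsum (StrongRayleigh.restr e true (StrongRayleigh.restr j true w)) 1 := by
      obtain ⟨⟨x, hx, hx'⟩, -⟩ := hj'
      refine wsum_one_pos ((hw.restr j true).restr e true).nonneg ⟨x, ?_⟩
      rw [restr_comm, restr_ne_zero]
      exact ⟨hx, hx'⟩
    have ha0 : 0 < wsum (StrongRayleigh.restr e true (StrongRayleigh.restr j false w)) 1 := by
      obtain ⟨-, x, hx, hx'⟩ := hj'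
      refine wsum_one_pos ((hw.restr j false).restr e true).nonneg ⟨x, ?_⟩
      rw [restr_comm, restr_ne_zero]
      exact ⟨hx, hx'⟩
    simp only [cov] at i1 i0 hcov ⊢
    rw [← wsum_restr_add j w, ← wsum_restr_add j w f,
      ← wsum_restr_add j (StrongRayleigh.restr e true w) 1,
      ← wsum_restr_add j (StrongRayleigh.restr e true w) f]
    rw [← wsum_restr_add j (StrongRayleigh.restr e true w) 1,
      ← wsum_restr_add j (StrongRayleigh.restr e true w) f] at hcov
    rw [restr_comm j e true true, restr_comm j e false true] at hcov ⊢
    set A1 := wsum (StrongRayleigh.restr j true w) 1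
    set A0 := wsum (StrongRayleigh.restr j false w) 1
    set F1 := wsum (StrongRayleigh.restr j true w) f
    set F0 := wsum (StrongRayleigh.restr j false w) f
    set a1 := wsum (StrongRayleigh.restr e true (StrongRayleigh.restr j true w)) 1
    set a0 := wsum (StrongRayleigh.restr e true (StrongRayleigh.restr j false w)) 1
    set f1 := wsum (StrongRayleigh.restr e true (StrongRayleigh.restr j true w)) f
    set f0 := wsum (StrongRayleigh.restr e true (StrongRayleigh.restr j false w)) f
    -- Inductively, for either value of `X_j`, conditioning further on `X_e = 1` lowers the mean of
    -- `f`. By the Rayleigh inequality it also shifts weight towards `X_j = 0`, where by the choice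
    -- of `j` the mean given `X_e = 1` is the smaller one.
    have k1 : A1 * f1 / a1 ≤ F1 := by rw [div_le_iff₀ ha1]; linarith
    have k0 : A0 * f0 / a0 ≤ F0 := by rw [div_le_iff₀ ha0]; linarith
    have k2 : (A1 + A0) * (f1 + f0) ≤ (A1 * f1 / a1 + A0 * f0 / a0) * (a1 + a0) := by
      have : (A1 * f1 / a1 + A0 * f0 / a0) * (a1 + a0) - (A1 + A0) * (f1 + f0) =
          (A1 * a0 - A0 * a1) * (a0 * f1 - f0 * a1) / (a1 * a0) := by
        field_simp; ring
      have h3 : 0 ≤ (A1 * a0 - A0 * a1) * (a0 * f1 - f0 * a1) / (a1 * a0) :=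
        div_nonneg (mul_nonneg (by linarith) (by linarith)) (mul_pos ha1 ha0).le
      linarith
    have k3 : (A1 * f1 / a1 + A0 * f0 / a0) * (a1 + a0) ≤ (F1 + F0) * (a1 + a0) :=
      mul_le_mul_of_nonneg_right (by linarith) (by linarith)
    linarith
  · rw [Finset.not_nonempty_iff_eq_empty] at hfree
    obtain ⟨x, hx⟩ := h1
    have hsupp : ∀ y, StrongRayleigh.restr e true w y ≠ 0 → y = x := by
      intro y hy
      ext j
      by_contra hne
      have : j ∈ freeCoords (StrongRayleigh.restr e true w) := by
        rw [mem_freeCoords]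
        cases hxj : x j <;> cases hyj : y j <;> simp [hxj, hyj] at hne
        · exact ⟨⟨y, hyj, hy⟩, x, hxj, hx⟩
        · exact ⟨⟨x, hxj, hx⟩, y, hyj, hy⟩
      simp [hfree] at this
    -- Here the weight given `X_e = 1` is a point mass at `x`. A coordinate `j ≠ e` with `x_j = 1`
    -- and `y_j = 0` would violate the Rayleigh inequality, so raising the `e`-th coordinate of `y`
    -- to `1` gives a vector above `x`; `f` ignores that change.
    have hle : ∀ y, w y ≠ 0 → f x ≤ f y := by
      intro y hy
      rw [← hfe y true]
      refine hf fun j => ?_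
      rcases eq_or_ne j e with rfl | hje
      · simp [(restr_ne_zero.mp hx).1]
      rw [Function.update_of_ne hje]
      by_contra hlt
      have hxj : x j = true := by
        cases h : x j
        · simp [h] at hlt
        · rfl
      have hyj : y j = false := by
        cases h : y j
        · rfl
        · simp [h] at hlt
      have h2 := hray j hje
      have h3 : wsum (StrongRayleigh.restr e true (StrongRayleigh.restr j false w)) 1 = 0 := by
        refine Finset.sum_eq_zero fun v _ => ?_
        by_contra hv
        have hv' := left_ne_zero_of_mul hv
        rw [restr_comm, restr_ne_zero] at hv'
        have := hsupp v hv'.2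
        rw [this, hxj] at hv'
        exact absurd hv'.1 (by simp)
      have h4 : 0 < wsum (StrongRayleigh.restr e true (StrongRayleigh.restr j true w)) 1 := by
        refine wsum_one_pos ((hw.restr j true).restr e true).nonneg ⟨x, ?_⟩
        rw [restr_comm, restr_ne_zero]
        exact ⟨hxj, hx⟩
      have h5 : 0 < wsum (StrongRayleigh.restr j false w) 1 :=
        wsum_one_pos (hw.restr j false).nonneg ⟨y, restr_ne_zero.mpr ⟨hyj, hy⟩⟩
      rw [h3, mul_zero] at h2
      exact absurd h2 (not_le.mpr (mul_pos h5 h4))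
    have e1 : wsum (StrongRayleigh.restr e true w) f =
        f x * wsum (StrongRayleigh.restr e true w) 1 :=
      wsum_eq_const_mul fun y hy => by rw [hsupp y hy]
    have e2 : f x * wsum w 1 ≤ wsum w f := by
      simp only [wsum, Finset.mul_sum, Pi.one_apply, mul_one]
      refine Finset.sum_le_sum fun y _ => ?_
      by_cases hy : w y = 0
      · simp [hy]
      · rw [mul_comm]
        exact mul_le_mul_of_nonneg_left (hle y hy) (hw.nonneg y)
    have e3 := mul_le_mul_of_nonneg_right e2 (wsum_one_nonneg hw1.nonneg)
    rw [cov, e1]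
    linarith

/-- The Feder–Mihail theorem: homogeneous weights are negatively associated. -/
theorem SRWeight.negativelyAssociated {w : (ι → Bool) → ℝ} (hw : SRWeight w) {r : ℕ}
    (hr : ∀ x, w x ≠ 0 → rank x = r) {f g : (ι → Bool) → ℝ} (hf : Monotone f) (hg : Monotone g)
    {S : Set ι} (hfS : DependsOn f S) (hgS : DependsOn g Sᶜ) :
    wsum w 1 * wsum w (f * g) ≤ wsum w f * wsum w g := by
  have hfj : ∀ j ∉ S, ∀ x b, f (Function.update x j b) = f x := fun j hj x b =>
    hfS fun i hi => Function.update_of_ne (by rintro rfl; exact hj hi) _ _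
  have hgj : ∀ j ∈ S, ∀ x b, g (Function.update x j b) = g x := fun j hj x b =>
    hgS fun i hi => Function.update_of_ne (by rintro rfl; exact hi hj) _ _
  induction hn : (freeCoords w).card using Nat.strong_induction_on generalizing w with
  | _ n ih =>
  by_cases hfree : ∃ j ∈ freeCoords w, j ∈ S
  -- The covariances of `f` add up to zero and those outside `S` are nonpositive by
  -- `SRWeight.cov_nonpos`, so they cannot be negative at every free coordinate in `S`.
  · obtain ⟨j, hj, hjS, hcov⟩ : ∃ j ∈ freeCoords w, j ∈ S ∧ 0 ≤ cov w f j := by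
      by_contra! hall
      obtain ⟨j₀, hj₀, hj₀S⟩ := hfree
      have hle : ∀ j ∈ Finset.univ, cov w f j ≤ 0 := by
        intro j _
        by_cases hjS : j ∈ S
        · by_cases hjf : j ∈ freeCoords w
          · exact (hall j hjf hjS).le
          · exact (cov_eq_zero_of_notMem_freeCoords f hjf).le
        · exact hw.cov_nonpos hr hf j (hfj j hjS)
      have hlt := Finset.sum_lt_sum hle ⟨j₀, Finset.mem_univ _, hall j₀ hj₀ hj₀S⟩
      rw [Finset.sum_const_zero, sum_cov hr] at hlt
      exact lt_irrefl _ hlt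
    have hj' := mem_freeCoords.mp hj
    have hcovg := hw.cov_nonpos hr hg j (hgj j hjS)
    have ih' : ∀ b, wsum (StrongRayleigh.restr j b w) 1 * wsum (StrongRayleigh.restr j b w) (f * g) ≤
        wsum (StrongRayleigh.restr j b w) f * wsum (StrongRayleigh.restr j b w) g := fun b =>
      ih _ (hn ▸ Finset.card_lt_card (freeCoords_restr_ssubset hj b)) (hw.restr j b)
        (fun x hx => hr x (restr_ne_zero.mp hx).2) rfl
    have i1 := ih' true
    have i0 := ih' false
    have hA1 : 0 < wsum (StrongRayleigh.restr j true w) 1 := by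
      obtain ⟨⟨x, hx, hx'⟩, -⟩ := hj'
      exact wsum_one_pos (hw.restr j true).nonneg ⟨x, restr_ne_zero.mpr ⟨hx, hx'⟩⟩
    have hA0 : 0 < wsum (StrongRayleigh.restr j false w) 1 := by
      obtain ⟨-, x, hx, hx'⟩ := hj'
      exact wsum_one_pos (hw.restr j false).nonneg ⟨x, restr_ne_zero.mpr ⟨hx, hx'⟩⟩
    simp only [cov] at hcov hcovg
    rw [← wsum_restr_add j w, ← wsum_restr_add j w f] at hcov ⊢
    rw [← wsum_restr_add j w, ← wsum_restr_add j w g] at hcovg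
    rw [← wsum_restr_add j w g, ← wsum_restr_add j w (f * g)]
    set A1 := wsum (StrongRayleigh.restr j true w) 1
    set A0 := wsum (StrongRayleigh.restr j false w) 1
    set F1 := wsum (StrongRayleigh.restr j true w) f
    set F0 := wsum (StrongRayleigh.restr j false w) f
    set G1 := wsum (StrongRayleigh.restr j true w) g
    set G0 := wsum (StrongRayleigh.restr j false w) g
    set H1 := wsum (StrongRayleigh.restr j true w) (f * g)
    set H0 := wsum (StrongRayleigh.restr j false w) (f * g)
    -- Induction bounds the product for each value of `X_j`. The mean of `f` rises with `X_j` and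
    -- that of `g` falls, so Chebyshev's inequality on two points combines the halves.
    have k1 : H1 ≤ F1 * G1 / A1 := by rw [le_div_iff₀ hA1]; linarith
    have k0 : H0 ≤ F0 * G0 / A0 := by rw [le_div_iff₀ hA0]; linarith
    have k2 : (A1 + A0) * (F1 * G1 / A1 + F0 * G0 / A0) ≤ (F1 + F0) * (G1 + G0) := by
      have : (F1 + F0) * (G1 + G0) - (A1 + A0) * (F1 * G1 / A1 + F0 * G0 / A0) =
          (A0 * F1 - F0 * A1) * (A1 * G0 - A0 * G1) / (A1 * A0) := by
        field_simp; ring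
      have h3 : 0 ≤ (A0 * F1 - F0 * A1) * (A1 * G0 - A0 * G1) / (A1 * A0) :=
        div_nonneg (mul_nonneg (by linarith) (by linarith)) (mul_pos hA1 hA0).le
      linarith
    have k3 : (A1 + A0) * (H1 + H0) ≤ (A1 + A0) * (F1 * G1 / A1 + F0 * G0 / A0) :=
      mul_le_mul_of_nonneg_left (by linarith) (by linarith)
    linarith
  · push Not at hfree
    by_cases hw0 : ∃ x, w x ≠ 0
    swap
    · push Not at hw0
      simp [wsum, hw0]
    obtain ⟨x, hx⟩ := hw0
    -- With no free coordinate in `S`, the function `f` is constant on the support.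
    have hconst : ∀ y, w y ≠ 0 → f y = f x := by
      intro y hy
      refine hfS fun j hjS => ?_
      by_contra hne
      refine hfree j ?_ hjS
      rw [mem_freeCoords]
      cases hxj : x j <;> cases hyj : y j <;> simp [hxj, hyj] at hne
      · exact ⟨⟨y, hyj, hy⟩, x, hxj, hx⟩
      · exact ⟨⟨x, hxj, hx⟩, y, hyj, hy⟩
    have e1 : wsum w (f * g) = f x * wsum w g := by
      simp only [wsum, Finset.mul_sum, Pi.mul_apply]
      refine Finset.sum_congr rfl fun y _ => ?_
      by_cases hy : w y = 0
      · simp [hy]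
      · rw [hconst y hy]; ring
    rw [e1, wsum_eq_const_mul hconst]
    exact le_of_eq (by ring)

end Restrict

end StrongRayleigh

/-! ### Monotone couplings on finite posets -/

/-- Strassen's theorem on a finite poset: stochastic domination is realized by a monotone
coupling. -/
theorem exists_monotone_coupling {α : Type*} [Fintype α] [PartialOrder α] {m n : α → ℝ}
    (hm : ∀ x, 0 ≤ m x) (hm1 : ∑ x, m x = 1) (hn : ∀ x, 0 ≤ n x)
    (h : ∀ f : α → ℝ, Monotone f → ∑ x, n x * f x ≤ ∑ x, m x * f x) :
    ∃ q : α × α → ℝ, (∀ p, 0 ≤ q p) ∧ (∀ x, ∑ y, q (x, y) = m x) ∧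
      (∀ y, ∑ x, q (x, y) = n y) ∧ ∀ p, q p ≠ 0 → p.2 ≤ p.1 := by
  classical
  -- The probability weights on ordered pairs. Their pairs of marginals form a compact convex set,
  -- and a pair `(m, n)` outside it is separated from it by a functional `(φ, ψ)`.
  let K : Set (α × α → ℝ) := stdSimplex ℝ (α × α) ∩ {q | ∀ p, ¬ p.2 ≤ p.1 → q p = 0}
  let A : (α × α → ℝ) →ₗ[ℝ] (α → ℝ) × (α → ℝ) :=
    { toFun := fun q => (fun x => ∑ y, q (x, y), fun y => ∑ x, q (x, y))
      map_add' := fun q q' => by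
        ext <;> simp [Finset.sum_add_distrib]
      map_smul' := fun c q => by
        ext <;> simp [Finset.mul_sum] }
  have hKcl : IsClosed {q : α × α → ℝ | ∀ p, ¬ p.2 ≤ p.1 → q p = 0} := by
    simp only [Set.ofPred_forall]
    exact isClosed_iInter fun p => isClosed_iInter fun _ =>
      isClosed_eq (continuous_apply p) continuous_const
  have hK : IsCompact K := (isCompact_stdSimplex ℝ (α × α)).inter_right hKcl
  have hKconv : Convex ℝ K := by
    refine (convex_stdSimplex ℝ (α × α)).inter ?_
    intro q hq q' hq' a b _ _ _ p hp
    simp [hq p hp, hq' p hp]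
  have hAK : IsClosed (A '' K) := (hK.image A.continuous_of_finiteDimensional).isClosed
  by_cases hmem : (m, n) ∈ A '' K
  · obtain ⟨q, ⟨hq, hq0⟩, hA⟩ := hmem
    refine ⟨q, hq.1, fun x => ?_, fun y => ?_, fun p hp => ?_⟩
    · exact congrFun (congrArg Prod.fst hA) x
    · exact congrFun (congrArg Prod.snd hA) y
    · by_contra hlt
      exact hp (hq0 p hlt)
  exfalso
  obtain ⟨F, u, hF, hu⟩ := geometric_hahn_banach_closed_point (hKconv.linear_image A) hAK hmem
  let φ : α → ℝ := fun x => F (Pi.single x 1, 0)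
  let ψ : α → ℝ := fun y => F (0, Pi.single y 1)
  have hFval : ∀ a b : α → ℝ, F (a, b) = ∑ x, a x * φ x + ∑ y, b y * ψ y := by
    intro a b
    have h1 : (a, b) = ∑ x, a x • ((Pi.single x 1 : α → ℝ), (0 : α → ℝ)) +
        ∑ y, b y • ((0 : α → ℝ), (Pi.single y 1 : α → ℝ)) := by
      ext x <;> simp [Prod.fst_sum, Prod.snd_sum, Finset.sum_apply, Pi.single_apply]
    rw [h1]
    simp only [map_add, map_sum, map_smul, smul_eq_mul, φ, ψ]
  have hφψ : ∀ x y, y ≤ x → φ x + ψ y < u := by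
    intro x y hxy
    have hq : (Pi.single (x, y) 1 : α × α → ℝ) ∈ K := by
      refine ⟨⟨fun p => ?_, ?_⟩, fun p hp => ?_⟩
      · rw [Pi.single_apply]; split_ifs <;> norm_num
      · simp
      · rw [Pi.single_apply, if_neg]
        rintro rfl
        exact hp hxy
    have h2 := hF _ ⟨_, hq, rfl⟩
    have h3 : A (Pi.single (x, y) 1) = (Pi.single x 1, Pi.single y 1) := by
      ext z
      · simp only [A, LinearMap.coe_mk, AddHom.coe_mk, Pi.single_apply, Prod.mk.injEq]
        by_cases hz : z = x <;> simp [hz]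
      · simp only [A, LinearMap.coe_mk, AddHom.coe_mk, Pi.single_apply, Prod.mk.injEq]
        by_cases hz : z = y <;> simp [hz]
    rw [h3, hFval] at h2
    simpa [Pi.single_apply] using h2
  have hne : ∀ y : α, (Finset.univ.filter fun x => y ≤ x).Nonempty := fun y => ⟨y, by simp⟩
  -- The least `u - φ x` over `x` above `y` is increasing in `y`. It lies above `ψ` because `φ x + ψ
  -- y < u` on ordered pairs, so domination tested on `g` contradicts the separation.
  let g : α → ℝ := fun y => (Finset.univ.filter fun x => y ≤ x).inf' (hne y) fun x => u - φ x
  have hg : Monotone g := by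
    intro y y' hyy'
    exact Finset.inf'_mono _ (fun x hx => by
      simp only [Finset.mem_filter, Finset.mem_univ, true_and] at hx ⊢
      exact hyy'.trans hx) (hne y')
  have hψg : ∀ y, ψ y ≤ g y := by
    intro y
    refine Finset.le_inf' _ _ fun x hx => ?_
    have := hφψ x y (by simpa using hx)
    linarith
  have hφg : ∀ x, φ x ≤ u - g x := by
    intro x
    have : g x ≤ u - φ x := Finset.inf'_le (fun x => u - φ x) (by simp)
    linarith
  have h4 : ∑ x, m x * φ x ≤ ∑ x, m x * (u - g x) :=
    Finset.sum_le_sum fun x _ => mul_le_mul_of_nonneg_left (hφg x) (hm x)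
  have h5 : ∑ x, n x * ψ x ≤ ∑ x, n x * g x :=
    Finset.sum_le_sum fun x _ => mul_le_mul_of_nonneg_left (hψg x) (hn x)
  have h6 := h g hg
  simp only [mul_sub, Finset.sum_sub_distrib, ← Finset.sum_mul, hm1, one_mul] at h4
  rw [hFval] at hu
  linarith

/-! ### Symmetric homogenization -/

namespace StrongRayleigh

section Homogenization

variable {ι κ : Type*} [Fintype ι] [Fintype κ]

theorem rank_sumElim (x : ι → Bool) (u : κ → Bool) : rank (Sum.elim x u) = rank x + rank u := by
  simp only [rank, Finset.card_filter, Fintype.sum_sum_type, Sum.elim_inl, Sum.elim_inr]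
  rfl

variable [DecidableEq ι] [DecidableEq κ]

theorem sum_sumElim {M : Type*} [AddCommMonoid M] (G : (ι ⊕ κ → Bool) → M) :
    ∑ y, G y = ∑ u : κ → Bool, ∑ x : ι → Bool, G (Sum.elim x u) := by
  rw [← Fintype.sum_prod_type_right' (f := fun x u => G (Sum.elim x u))]
  refine Fintype.sum_equiv (Equiv.sumArrowEquivProdArrow ι κ Bool) _ _ fun y => ?_
  congr 1
  ext j
  cases j <;> rfl

theorem mev_sumElim (W : (ι ⊕ κ → Bool) → ℂ) (z : ι ⊕ κ → ℂ) :
    mev W z = mev (fun u => mev (fun x => W (Sum.elim x u)) fun j => z (Sum.inl j))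
      fun j => z (Sum.inr j) := by
  simp only [mev, sum_sumElim, Finset.sum_mul, Fintype.prod_sum_type, Sum.elim_inl, Sum.elim_inr]
  refine Finset.sum_congr rfl fun u _ => Finset.sum_congr rfl fun x _ => (mul_assoc _ _ _).symm

/-- The symmetric homogenization of `w`. -/
noncomputable def homogenize (w : (ι → Bool) → ℝ) (y : ι ⊕ ι → Bool) : ℝ :=
  if rank y = Fintype.card ι then
    w (fun j => y (Sum.inl j)) / (Fintype.card ι).choose (rank fun j => y (Sum.inl j)) else 0

omit [DecidableEq ι] in
theorem homogenize_sumElim (w : (ι → Bool) → ℝ) (x u : ι → Bool) :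
    homogenize w (Sum.elim x u) = if rank x + rank u = Fintype.card ι then
      w x / (Fintype.card ι).choose (rank x) else 0 := by
  simp only [homogenize, rank_sumElim, Sum.elim_inl]

/-- The binomial coefficient counts the completions of `x` to total rank `d`; dividing by it makes
`w` the first marginal. -/
theorem wsum_homogenize (w f : (ι → Bool) → ℝ) :
    wsum (homogenize w) (fun y => f fun j => y (Sum.inl j)) = wsum w f := by
  simp only [wsum, sum_sumElim, homogenize_sumElim, Sum.elim_inl]
  rw [Finset.sum_comm]
  refine Finset.sum_congr rfl fun x _ => ?_
  have hx := rank_le x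
  have := sum_rank (ι := ι) fun k => (if rank x + k = Fintype.card ι then
      w x / (Fintype.card ι).choose (rank x) else 0) * f x
  rw [this, Finset.sum_eq_single (Fintype.card ι - rank x)]
  · rw [if_pos (by omega), Nat.choose_symm hx, nsmul_eq_mul]
    have : ((Fintype.card ι).choose (rank x) : ℝ) ≠ 0 := by
      exact_mod_cast (Nat.choose_pos hx).ne'
    field_simp
  · intro k _ hk
    rw [if_neg (by omega)]; simp
  · intro hk
    simp only [Finset.mem_range] at hk
    omega

/-- For fixed first variables `z₁`, this is the polarization in the second block of `s ↦ s^d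
f(z₁/s)`. For `Im s > 0` the factor `1/s` lies in the lower half-plane, so `Stab.smul_ne_zero`
applies. -/
theorem SRWeight.homogenize {w : (ι → Bool) → ℝ} (hw : SRWeight w) :
    SRWeight (homogenize w) where
  nonneg y := by
    simp only [StrongRayleigh.homogenize]
    split_ifs
    · exact div_nonneg (hw.nonneg _) (by positivity)
    · exact le_rfl
  stab := by
    rintro ⟨y, hy⟩
    have hs := hw.stab ⟨fun j => y (Sum.inl j), fun h => hy (by simp [StrongRayleigh.homogenize, h])⟩
    intro z hz
    rw [mev_sumElim]
    set d := Fintype.card ι with hd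
    set z₁ : ι → ℂ := fun j => z (Sum.inl j)
    have h1 : (fun u : ι → Bool =>
        mev (fun x => ((StrongRayleigh.homogenize w (Sum.elim x u) : ℝ) : ℂ)) z₁) =
        fun u => mev (level (fun x => (w x : ℂ)) (d - rank u)) z₁ / (d.choose (rank u) : ℂ) := by
      ext u
      have hu := rank_le u
      rw [div_eq_inv_mul, ← mev_const_mul]
      congr 1
      ext x
      have hx := rank_le x
      rw [homogenize_sumElim, level]
      by_cases h : rank x = d - rank u
      · rw [if_pos (by omega), if_pos h, h, Nat.choose_symm hu]
        push_cast
        rw [div_eq_inv_mul]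
      · rw [if_neg (by omega), if_neg h]
        simp
    rw [h1]
    refine stab_of_rank (fun k => mev (level (fun x => (w x : ℂ)) (d - k)) z₁ / (d.choose k : ℂ))
      (fun s hs' => ?_) _ fun j => hz _
    have hs0 : s ≠ 0 := by rintro rfl; simp at hs'
    have h2 : ∑ k ∈ Finset.range (d + 1), (d.choose k : ℂ) *
        (mev (level (fun x => (w x : ℂ)) (d - k)) z₁ / (d.choose k : ℂ)) * s ^ k =
        s ^ d * mev (fun x => (w x : ℂ)) fun j => s⁻¹ * z₁ j := by
      rw [mev_smul_eq_sum_level, ← hd, ← Finset.sum_range_reflect, Finset.mul_sum]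
      refine Finset.sum_congr rfl fun k hk => ?_
      have hk' : k ≤ d := Nat.lt_succ_iff.mp (Finset.mem_range.mp hk)
      have hc : (d.choose k : ℂ) ≠ 0 := by exact_mod_cast (Nat.choose_pos hk').ne'
      have h3 : d + 1 - 1 - k = d - k := by omega
      rw [h3, inv_pow, pow_sub₀ _ hs0 hk', Nat.sub_sub_self hk', Nat.choose_symm hk']
      field_simp
    rw [h2]
    refine mul_ne_zero (pow_ne_zero _ hs0) (hs.smul_ne_zero hw.nonneg (fun j => hz _) ?_)
    rw [Complex.inv_im]
    exact div_neg_of_neg_of_pos (by linarith) (Complex.normSq_pos.mpr hs0)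

omit [DecidableEq ι] in
theorem rank_of_homogenize_ne_zero {w : (ι → Bool) → ℝ} {y : ι ⊕ ι → Bool}
    (hy : homogenize w y ≠ 0) : rank y = Fintype.card ι := by
  by_contra h
  exact hy (by simp [homogenize, h])

end Homogenization

end StrongRayleigh

/-! ### Measures on finite sets, and first closure properties -/

namespace StrongRayleigh

section Finite

variable {α β : Type*} [Fintype α] [MeasurableSpace α] [MeasurableSingletonClass α]

theorem measureReal_eq_sum (μ : Measure α) [IsFiniteMeasure μ] (p : α → Prop) [DecidablePred p] :
    μ.real {x | p x} = ∑ x, if p x then μ.real {x} else 0 := by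
  rw [← Finset.sum_filter, sum_measureReal_singleton]
  simp

theorem sum_measureReal_univ (μ : Measure α) [IsProbabilityMeasure μ] : ∑ x, μ.real {x} = 1 := by
  rw [sum_measureReal_singleton]
  simp

theorem ofMass_apply (w : α → ℝ) (s : Set α) [DecidablePred (· ∈ s)] :
    ofMass w s = ∑ x, if x ∈ s then ENNReal.ofReal (w x) else 0 := by
  simp only [ofMass, Measure.coe_finsetSum, Finset.sum_apply, Measure.smul_apply, smul_eq_mul]
  refine Finset.sum_congr rfl fun x _ => ?_
  rw [Measure.dirac_apply' _ (Set.toFinite s).measurableSet]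
  by_cases h : x ∈ s <;> simp [h]

instance (w : α → ℝ) : IsFiniteMeasure (ofMass w) where
  measure_univ_lt_top := by
    classical
    rw [ofMass_apply]
    exact ENNReal.sum_lt_top.mpr fun x _ => by simp

theorem ofMass_real_singleton {w : α → ℝ} (hw : ∀ x, 0 ≤ w x) (x : α) :
    (ofMass w).real {x} = w x := by
  classical
  rw [measureReal_def, ofMass_apply]
  simp [hw x]

theorem isProbabilityMeasure_ofMass {w : α → ℝ} (hw : ∀ x, 0 ≤ w x) (h1 : ∑ x, w x = 1) :
    IsProbabilityMeasure (ofMass w) where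
  measure_univ := by
    classical
    rw [ofMass_apply]
    simp only [Set.mem_univ, if_true]
    rw [← ENNReal.ofReal_sum_of_nonneg fun x _ => hw x, h1, ENNReal.ofReal_one]

theorem ofMass_measureReal (μ : Measure α) [IsFiniteMeasure μ] :
    ofMass (fun x => μ.real {x}) = μ :=
  Measure.ext_of_measureReal_singleton fun x => ofMass_real_singleton (fun _ => measureReal_nonneg) x

theorem ofMass_map_real_singleton {w : α → ℝ} (hw : ∀ x, 0 ≤ w x) [MeasurableSpace β]
    [MeasurableSingletonClass β] [DecidableEq β] {f : α → β} (b : β) :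
    ((ofMass w).map f).real {b} = ∑ x, if f x = b then w x else 0 := by
  have hf : Measurable f := fun s _ => (Set.toFinite _).measurableSet
  rw [map_measureReal_apply hf (measurableSet_singleton b)]
  have : f ⁻¹' {b} = {x | f x = b} := rfl
  rw [this, measureReal_eq_sum]
  simp only [ofMass_real_singleton hw]

theorem cond_real_singleton (μ : Measure α) (p : α → Prop) [DecidablePred p] (x : α) :
    (ProbabilityTheory.cond μ {x | p x}).real {x} =
      if p x then μ.real {x} / μ.real {x | p x} else 0 := by
  rw [measureReal_def, ProbabilityTheory.cond_apply (Set.toFinite _).measurableSet]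
  split_ifs with h
  · have : {x | p x} ∩ {x} = {x} := by simpa using h
    rw [this, ENNReal.toReal_mul, ENNReal.toReal_inv, div_eq_inv_mul]
    rfl
  · have : {x | p x} ∩ {x} = ∅ := by
      rw [Set.inter_singleton_eq_empty]; exact h
    simp [this]

theorem cond_eq_ofMass (μ : Measure α) [IsFiniteMeasure μ] (p : α → Prop) [DecidablePred p] :
    ProbabilityTheory.cond μ {x | p x} =
      ofMass fun x => if p x then μ.real {x} / μ.real {x | p x} else 0 := by
  refine Measure.ext_of_measureReal_singleton fun x => ?_
  rw [cond_real_singleton, ofMass_real_singleton]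
  intro x
  split_ifs <;> positivity

end Finite

section Interface

variable {ι : Type*} [Fintype ι] [DecidableEq ι]

theorem eval_genPoly (μ : Measure (ι → Bool)) (z : ι → ℂ) :
    MvPolynomial.eval z (genPoly μ) = mev (fun x => ((μ.real {x} : ℝ) : ℂ)) z := by
  simp only [genPoly, mev, map_sum, map_mul, map_prod, MvPolynomial.eval_C, MvPolynomial.eval_X]
  simp only [Finset.prod_filter]

theorem coeff_genPoly_im (μ : Measure (ι → Bool)) (m : ι →₀ ℕ) :
    (MvPolynomial.coeff m (genPoly μ)).im = 0 := by
  have : genPoly μ = MvPolynomial.map (algebraMap ℝ ℂ) (∑ x : ι → Bool,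
      MvPolynomial.C (μ.real {x}) *
        ∏ j ∈ Finset.univ.filter (fun j => x j = true), MvPolynomial.X j) := by
    simp [genPoly, MvPolynomial.map_C, MvPolynomial.map_X]
  rw [this, MvPolynomial.coeff_map]
  simp

theorem isStrongRayleigh_iff {μ : Measure (ι → Bool)} :
    IsStrongRayleigh μ ↔ IsProbabilityMeasure μ ∧ Stab fun x => ((μ.real {x} : ℝ) : ℂ) := by
  constructor
  · intro h
    exact ⟨h.isProbabilityMeasure, fun z hz => by
      rw [← eval_genPoly]; exact h.realStable.2 z hz⟩
  · rintro ⟨h1, h2⟩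
    exact ⟨h1, coeff_genPoly_im μ, fun z hz => by rw [eval_genPoly]; exact h2 z hz⟩

theorem isStrongRayleigh_ofMass {w : (ι → Bool) → ℝ} (hw : ∀ x, 0 ≤ w x) (h1 : ∑ x, w x = 1)
    (hs : Stab fun x => (w x : ℂ)) : IsStrongRayleigh (ofMass w) := by
  rw [isStrongRayleigh_iff]
  refine ⟨isProbabilityMeasure_ofMass hw h1, ?_⟩
  simpa only [ofMass_real_singleton hw] using hs

theorem IsStrongRayleigh.stab {μ : Measure (ι → Bool)} (hμ : IsStrongRayleigh μ) :
    Stab fun x => ((μ.real {x} : ℝ) : ℂ) :=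
  (isStrongRayleigh_iff.mp hμ).2

theorem IsStrongRayleigh.srWeight {μ : Measure (ι → Bool)} (hμ : IsStrongRayleigh μ) :
    SRWeight fun x => μ.real {x} :=
  ⟨fun _ => measureReal_nonneg, fun _ => hμ.stab⟩

theorem integral_eq_wsum (μ : Measure (ι → Bool)) [IsFiniteMeasure μ] (f : (ι → Bool) → ℝ) :
    ∫ x, f x ∂μ = wsum (fun x => μ.real {x}) f := by
  rw [integral_fintype .of_finite]
  rfl

/-- Functions of the original coordinates keep their integrals and monotonicity on the
homogenization, where the Feder–Mihail theorem holds. -/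
theorem IsStrongRayleigh.negativelyAssociated {μ : Measure (ι → Bool)}
    (hμ : IsStrongRayleigh μ) : NegativelyAssociated μ := by
  have := hμ.isProbabilityMeasure
  intro S f g hf hg hfS hgS
  rw [integral_eq_wsum, integral_eq_wsum, integral_eq_wsum]
  have h := hμ.srWeight.homogenize.negativelyAssociated
    (fun y hy => rank_of_homogenize_ne_zero hy)
    (f := fun y => f fun j => y (Sum.inl j)) (g := fun y => g fun j => y (Sum.inl j))
    (S := Sum.inl '' S) (fun y y' h => hf fun j => h _) (fun y y' h => hg fun j => h _)
    (fun y y' h => hfS fun j hj => h _ ⟨j, hj, rfl⟩)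
    (fun y y' h => hgS fun j hj => h _ (by
      rintro ⟨i, hi, hij⟩
      exact hj (Sum.inl_injective hij ▸ hi)))
  have e1 : wsum (homogenize fun x => μ.real {x}) 1 = 1 := by
    have := wsum_homogenize (fun x => μ.real {x}) 1
    simp only [Pi.one_apply] at this
    rw [show (1 : (ι ⊕ ι → Bool) → ℝ) = fun _ => 1 from rfl, this]
    simp [wsum]
  rw [e1, one_mul, wsum_homogenize, wsum_homogenize] at h
  rw [← wsum_homogenize]
  exact h

theorem IsStrongRayleigh.rankRescale {μ : Measure (ι → Bool)} (hμ : IsStrongRayleigh μ)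
    {b : ℕ → ℝ} (hb : ∀ i ≤ Fintype.card ι, 0 ≤ b i)
    (hB : ∀ s : ℂ, 0 < s.im → ∑ i ∈ Finset.range (Fintype.card ι + 1), (b i : ℂ) * s ^ i ≠ 0)
    (hZ : 0 < ∑ i ∈ Finset.range (Fintype.card ι + 1), b i * rankSeq μ i) :
    IsStrongRayleigh (rankRescale b μ) := by
  have := hμ.isProbabilityMeasure
  set Z := ∑ i ∈ Finset.range (Fintype.card ι + 1), b i * rankSeq μ i with hZdef
  have hsum : ∑ x : ι → Bool, b (rank x) * μ.real {x} = Z := by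
    rw [sum_rank_eq_sum]
    refine Finset.sum_congr rfl fun k _ => ?_
    rw [rankSeq, measureReal_eq_sum, ← Finset.sum_filter, Finset.mul_sum]
    refine Finset.sum_congr rfl fun x hx => ?_
    rw [(Finset.mem_filter.mp hx).2]
  have hne : ∃ x : ι → Bool, b (rank x) * μ.real {x} ≠ 0 := by
    by_contra! h
    rw [Finset.sum_eq_zero fun x _ => h x] at hsum
    exact hZ.ne hsum
  have hs := (hμ.stab.rank_rescale (fun _ => measureReal_nonneg) hb hB hne).const_mul
    (c := ((Z⁻¹ : ℝ) : ℂ)) (by exact_mod_cast (inv_pos.mpr hZ).ne')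
  refine isStrongRayleigh_ofMass (fun x => ?_) ?_ ?_
  · exact div_nonneg (mul_nonneg (hb _ (rank_le x)) measureReal_nonneg) hZ.le
  · rw [← Finset.sum_div, hsum, div_self hZ.ne']
  · convert hs using 2 with x
    rw [← Complex.ofReal_mul, div_eq_inv_mul]

/-- The polynomial is `s^k` or `s^k (1 + s)`. Three consecutive ranks would give `1 + s + s²`, which
is not stable. -/
theorem window_sum_ne_zero {d k l : ℕ} (hkl : k ≤ l) (hl : l ≤ k + 1) (hk : k ≤ d) {s : ℂ}
    (hs : 0 < s.im) : ∑ i ∈ Finset.range (d + 1),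
      (((if k ≤ i ∧ i ≤ l then 1 else 0 : ℝ)) : ℂ) * s ^ i ≠ 0 := by
  have hs0 : s ≠ 0 := by rintro rfl; simp at hs
  have h1 : ∀ i, (((if k ≤ i ∧ i ≤ l then 1 else 0 : ℝ)) : ℂ) * s ^ i =
      if i ∈ Finset.Icc k l then s ^ i else 0 := by
    intro i
    simp only [Finset.mem_Icc]
    split_ifs <;> simp
  simp_rw [h1]
  rw [← Finset.sum_filter]
  -- The upper end of the window may be `d + 1`, hence the minimum.
  have h2 : (Finset.range (d + 1)).filter (fun i => i ∈ Finset.Icc k l) =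
      Finset.Icc k (min l d) := by
    ext i; simp only [Finset.mem_filter, Finset.mem_range, Finset.mem_Icc, le_min_iff]; omega
  rw [h2]
  have h3 : min l d = k ∨ min l d = k + 1 := by omega
  rcases h3 with h3 | h3
  · rw [h3]; simp [hs0]
  · rw [h3, Finset.sum_Icc_succ_top (by omega)]
    simp only [Finset.Icc_self, Finset.sum_singleton, pow_succ]
    rw [show s ^ k + s ^ k * s = s ^ k * (1 + s) by ring]
    refine mul_ne_zero (pow_ne_zero _ hs0) fun h => ?_
    have := congrArg Complex.im h
    simp only [Complex.add_im, Complex.one_im, Complex.zero_im, zero_add] at this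
    exact hs.ne' this

/-- Truncation to one or two consecutive ranks. -/
theorem IsStrongRayleigh.cond_window {μ : Measure (ι → Bool)} (hμ : IsStrongRayleigh μ)
    {k l : ℕ} (hkl : k ≤ l) (hl : l ≤ k + 1)
    (hne : μ {x | k ≤ rank x ∧ rank x ≤ l} ≠ 0) :
    IsStrongRayleigh (ProbabilityTheory.cond μ {x | k ≤ rank x ∧ rank x ≤ l}) := by
  have := hμ.isProbabilityMeasure
  have hpos : 0 < μ.real {x | k ≤ rank x ∧ rank x ≤ l} :=
    lt_of_le_of_ne measureReal_nonneg fun h => hne (by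
      rwa [eq_comm, measureReal_eq_zero_iff] at h)
  have hk : k ≤ Fintype.card ι := by
    by_contra! h
    refine hne ?_
    convert measure_empty (μ := μ)
    ext x
    have := rank_le x
    simp only [Set.mem_ofPred_eq, Set.mem_empty_iff_false, iff_false]
    omega
  let b : ℕ → ℝ := fun i => if k ≤ i ∧ i ≤ l then 1 else 0
  have hZ : ∑ i ∈ Finset.range (Fintype.card ι + 1), b i * rankSeq μ i =
      μ.real {x | k ≤ rank x ∧ rank x ≤ l} := by
    rw [measureReal_eq_sum, sum_rank_eq_sum]
    refine Finset.sum_congr rfl fun i _ => ?_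
    rw [rankSeq, measureReal_eq_sum, ← Finset.sum_filter, Finset.mul_sum]
    refine Finset.sum_congr rfl fun x hx => ?_
    rw [(Finset.mem_filter.mp hx).2]
    simp [b]
  have h := hμ.rankRescale (b := b) (fun i _ => by simp only [b]; split_ifs <;> norm_num)
    (fun s hs => window_sum_ne_zero hkl hl hk hs) (hZ ▸ hpos)
  convert h using 1
  rw [cond_eq_ofMass, StrongRayleigh.rankRescale, hZ]
  congr 1
  ext x
  simp only [b]
  split_ifs <;> simp

theorem IsStrongRayleigh.prodMeasure {κ : Type*} [Fintype κ] [DecidableEq κ]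
    {μ : Measure (ι → Bool)} {ν : Measure (κ → Bool)} (hμ : IsStrongRayleigh μ)
    (hν : IsStrongRayleigh ν) : IsStrongRayleigh (prodMeasure μ ν) := by
  have := hμ.isProbabilityMeasure
  have := hν.isProbabilityMeasure
  have hmeas : Measurable fun p : (ι → Bool) × (κ → Bool) => (Sum.elim p.1 p.2 : ι ⊕ κ → Bool) :=
    fun s _ => (Set.toFinite _).measurableSet
  rw [isStrongRayleigh_iff]
  refine ⟨Measure.isProbabilityMeasure_map hmeas.aemeasurable, ?_⟩
  have hmass : ∀ (x : ι → Bool) (u : κ → Bool),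
      (StrongRayleigh.prodMeasure μ ν).real {Sum.elim x u} = μ.real {x} * ν.real {u} := by
    intro x u
    rw [StrongRayleigh.prodMeasure, map_measureReal_apply hmeas (measurableSet_singleton _)]
    have : (fun p : (ι → Bool) × (κ → Bool) => (Sum.elim p.1 p.2 : ι ⊕ κ → Bool)) ⁻¹'
        {Sum.elim x u} = {x} ×ˢ {u} := by
      ext p
      simp only [Set.mem_preimage, Set.mem_singleton_iff, Set.mem_prod]
      constructor
      · intro h
        exact ⟨funext fun j => congrFun h (Sum.inl j), funext fun j => congrFun h (Sum.inr j)⟩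
      · rintro ⟨h1, h2⟩
        rw [h1, h2]
    rw [this, measureReal_prod_prod]
  intro z hz
  rw [mev_sumElim]
  simp_rw [hmass, Complex.ofReal_mul, mul_comm _ ((ν.real _ : ℝ) : ℂ), mev_const_mul,
    mul_comm ((ν.real _ : ℝ) : ℂ), mev_const_mul]
  exact mul_ne_zero (hμ.stab _ fun j => hz _) (hν.stab _ fun j => hz _)

theorem IsStrongRayleigh.externalField {μ : Measure (ι → Bool)} (hμ : IsStrongRayleigh μ)
    {lam : ι → ℝ} (hlam : ∀ j, 0 < lam j) : IsStrongRayleigh (externalField lam μ) := by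
  have := hμ.isProbabilityMeasure
  have hp : ∀ x : ι → Bool, 0 < ∏ j ∈ Finset.univ.filter (fun j => x j = true), lam j :=
    fun x => Finset.prod_pos fun j _ => hlam j
  have hZ : 0 < ∑ y : ι → Bool,
      (∏ j ∈ Finset.univ.filter (fun j => y j = true), lam j) * μ.real {y} := by
    obtain ⟨x, hx⟩ := hμ.stab.exists_ne_zero
    refine Finset.sum_pos' (fun y _ => mul_nonneg (hp y).le measureReal_nonneg)
      ⟨x, Finset.mem_univ x, mul_pos (hp x) (lt_of_le_of_ne measureReal_nonneg (Ne.symm ?_))⟩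
    exact_mod_cast hx
  set Z := ∑ y : ι → Bool,
      (∏ j ∈ Finset.univ.filter (fun j => y j = true), lam j) * μ.real {y} with hZdef
  refine isStrongRayleigh_ofMass (fun x => ?_) ?_ ?_
  · exact div_nonneg (mul_nonneg (hp x).le measureReal_nonneg) hZ.le
  · rw [← Finset.sum_div, ← hZdef, div_self hZ.ne']
  · have hs := (hμ.stab.field lam hlam).const_mul
      (c := ((Z⁻¹ : ℝ) : ℂ)) (by exact_mod_cast (inv_pos.mpr hZ).ne')
    convert hs using 2 with x
    rw [← hZdef, div_eq_inv_mul, Finset.prod_filter]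
    push_cast
    congr 2
    refine Finset.prod_congr rfl fun j _ => ?_
    split_ifs <;> simp

theorem IsStrongRayleigh.totalSymm {μ : Measure (ι → Bool)} (hμ : IsStrongRayleigh μ) :
    IsStrongRayleigh (totalSymm μ) := by
  have := hμ.isProbabilityMeasure
  have hf : ((Fintype.card ι).factorial : ℝ) ≠ 0 := by exact_mod_cast Nat.factorial_ne_zero _
  refine isStrongRayleigh_ofMass (fun x => ?_) ?_ ?_
  · exact div_nonneg (Finset.sum_nonneg fun _ _ => measureReal_nonneg) (by positivity)
  · rw [← Finset.sum_div, Finset.sum_comm]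
    have : ∀ π : Equiv.Perm ι, ∑ x : ι → Bool, μ.real {fun j => x (π j)} = 1 := by
      intro π
      rw [← sum_measureReal_univ μ]
      exact Fintype.sum_equiv (Equiv.arrowCongr π.symm (Equiv.refl Bool)) _ _ fun x => rfl
    simp only [this, Finset.sum_const, Finset.card_univ, Fintype.card_perm, nsmul_eq_mul, mul_one]
    exact div_self hf
  · convert hμ.stab.symmetrize using 2 with x
    simp [symmetrize]

end Interface

end StrongRayleigh

/-! ### Projections, ultra log-concavity, levels and covering -/

namespace StrongRayleigh

section Consequences

variable {ι : Type*} [Fintype ι] [DecidableEq ι]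

/-! ### Projections -/

/-- Summing out the coordinates outside `S` with weights `c_j` is the substitution `z_j = c_j`. -/
theorem mev_partialSum (S : Finset ι) (w : (ι → Bool) → ℂ) (c : ι → ℂ) (z : S → ℂ) :
    mev (fun y : S → Bool => ∑ x : ι → Bool, if (fun i : S => x i.1) = y then
      w x * ∏ j ∈ Sᶜ, (if x j then c j else 1) else 0) z =
    mev w fun j => if h : j ∈ S then z ⟨j, h⟩ else c j := by
  simp only [mev, Finset.sum_mul, ite_mul, zero_mul]
  rw [Finset.sum_comm]
  refine Finset.sum_congr rfl fun x _ => ?_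
  rw [Finset.sum_ite_eq, if_pos (Finset.mem_univ _), mul_assoc, ← Finset.prod_mul_prod_compl S,
    mul_comm (∏ j ∈ Sᶜ, _)]
  congr 2
  · rw [← Finset.prod_coe_sort S fun j =>
      if x j then (if h : j ∈ S then z ⟨j, h⟩ else c j) else 1]
    refine Finset.prod_congr rfl fun j _ => ?_
    simp
  · refine Finset.prod_congr rfl fun j hj => ?_
    rw [dif_neg (Finset.mem_compl.mp hj)]

/-- The projection puts `1` into the discarded variables. Since `1` lies on the boundary of the
half-plane, `1 + iε` is used and `ε` tends to `0`. -/
theorem IsStrongRayleigh.proj {μ : Measure (ι → Bool)} (hμ : IsStrongRayleigh μ) (S : Finset ι) :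
    IsStrongRayleigh (proj S μ) := by
  have := hμ.isProbabilityMeasure
  have hmeas : Measurable fun (x : ι → Bool) (i : S) => x i.1 :=
    fun s _ => (Set.toFinite _).measurableSet
  have hprob : IsProbabilityMeasure (StrongRayleigh.proj S μ) :=
    Measure.isProbabilityMeasure_map hmeas.aemeasurable
  rw [isStrongRayleigh_iff]
  refine ⟨hprob, ?_⟩
  have hmass : ∀ y, (StrongRayleigh.proj S μ).real {y} =
      ∑ x : ι → Bool, if (fun i : S => x i.1) = y then μ.real {x} else 0 := by
    intro y
    rw [StrongRayleigh.proj, ← ofMass_measureReal μ,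
      ofMass_map_real_singleton (fun _ => measureReal_nonneg), ofMass_measureReal]
  let W : ℝ → (S → Bool) → ℂ := fun ε y => ∑ x : ι → Bool, if (fun i : S => x i.1) = y then
      ((μ.real {x} : ℝ) : ℂ) * ∏ j ∈ Sᶜ, (if x j then 1 + (ε : ℂ) * Complex.I else 1) else 0
  have hWc : ∀ y, Continuous fun ε => W ε y := by
    intro y
    refine continuous_finsetSum _ fun x _ => ?_
    split_ifs
    · refine continuous_const.mul (continuous_finsetProd _ fun j _ => ?_)
      split_ifs <;> fun_prop
    · fun_prop
  have hW0 : W 0 = fun y => (((StrongRayleigh.proj S μ).real {y} : ℝ) : ℂ) := by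
    ext y
    rw [hmass]
    push_cast
    refine Finset.sum_congr rfl fun x _ => ?_
    split_ifs <;> simp
  rw [← hW0]
  refine Stab.of_tendsto (l := nhdsWithin (0 : ℝ) (Set.Ioi 0)) (W := W) (z := fun _ => ((1 : ℝ) : ℂ))
    ?_ (fun y => ((hWc y).tendsto 0).mono_left nhdsWithin_le_nhds) ?_
  · filter_upwards [self_mem_nhdsWithin] with ε (hε : 0 < ε)
    intro z hz
    have := mev_partialSum S (fun x => ((μ.real {x} : ℝ) : ℂ)) (fun _ => 1 + (ε : ℂ) * Complex.I) z
    rw [this]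
    refine hμ.stab _ fun j => ?_
    split_ifs with h
    · exact hz _
    · simpa using hε
  · rw [hW0]
    refine mev_ne_zero_of_pos (fun _ => measureReal_nonneg) ?_ fun _ => one_pos
    by_contra! h
    have h1 := sum_measureReal_univ (StrongRayleigh.proj S μ)
    simp only [h, Finset.sum_const_zero] at h1
    exact zero_ne_one h1

/-! ### Ultra log-concavity -/

theorem SRWeight.restrOn {w : (ι → Bool) → ℝ} (hw : SRWeight w) (T : Finset ι) (x₀ : ι → Bool) :
    SRWeight fun x => if ∀ l ∈ T, x l = x₀ l then w x else 0 := by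
  induction T using Finset.induction_on with
  | empty => simpa using hw
  | insert a T _ ih =>
    convert ih.restr a (x₀ a) using 1
    ext x
    simp only [StrongRayleigh.restr, Finset.forall_mem_insert]
    by_cases h : x a = x₀ a <;> simp [h]

/-- Fixing all coordinates other than `i` and `j` leaves four points, on which the Rayleigh
inequality is this one. -/
theorem SRWeight.rayleigh_corner {w : (ι → Bool) → ℝ} (hw : SRWeight w) {i j : ι} (hij : i ≠ j)
    (x₀ : ι → Bool) :
    w (Function.update (Function.update x₀ i false) j false) *
        w (Function.update (Function.update x₀ i true) j true) ≤
      w (Function.update (Function.update x₀ i true) j false) *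
        w (Function.update (Function.update x₀ i false) j true) := by
  let W : (ι → Bool) → ℝ := fun x => if ∀ l ∈ ({i, j} : Finset ι)ᶜ, x l = x₀ l then w x else 0
  have key : ∀ a b, wsum (StrongRayleigh.restr i a (StrongRayleigh.restr j b W)) 1 =
      w (Function.update (Function.update x₀ i a) j b) := by
    intro a b
    simp only [wsum, StrongRayleigh.restr, W, Pi.one_apply, mul_one]
    rw [Finset.sum_eq_single (Function.update (Function.update x₀ i a) j b)]
    · simp only [Function.update_self, Function.update_of_ne hij, if_true]
      rw [if_pos]
      intro l hl
      simp only [Finset.mem_compl, Finset.mem_insert, Finset.mem_singleton, not_or] at hl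
      rw [Function.update_of_ne hl.2, Function.update_of_ne hl.1]
    · intro x _ hx
      split_ifs with h1 h2 h3
      · refine absurd (funext fun l => ?_) hx
        rcases eq_or_ne l j with rfl | hlj
        · simp [h2]
        rcases eq_or_ne l i with rfl | hli
        · simp [hij, h1]
        · rw [Function.update_of_ne hlj, Function.update_of_ne hli]
          exact h3 l (by simp [hlj, hli])
      all_goals rfl
    · simp
  have h := (hw.restrOn ({i, j} : Finset ι)ᶜ x₀).rayleigh hij
  change wsum W 1 * wsum (StrongRayleigh.restr i true (StrongRayleigh.restr j true W)) 1 ≤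
    wsum (StrongRayleigh.restr i true W) 1 * wsum (StrongRayleigh.restr j true W) 1 at h
  rw [← wsum_restr_add i W, ← wsum_restr_add j (StrongRayleigh.restr i true W),
    ← wsum_restr_add j (StrongRayleigh.restr i false W),
    ← wsum_restr_add i (StrongRayleigh.restr j true W)] at h
  simp only [restr_comm j i, key] at h
  linarith

omit [Fintype ι] in
theorem update_ofFinset (K : Finset ι) (i : ι) :
    Function.update (ofFinset K) i true = ofFinset (insert i K) := by
  ext l
  rcases eq_or_ne l i with rfl | h
  · simp [ofFinset]
  · simp [ofFinset, h]

omit [Fintype ι] in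
theorem update_ofFinset_of_notMem {K : Finset ι} {i : ι} (hi : i ∉ K) :
    Function.update (ofFinset K) i false = ofFinset K := by
  ext l
  rcases eq_or_ne l i with rfl | h
  · simp [ofFinset, hi]
  · simp [h]

theorem rankSeq_eq_sum_filter (μ : Measure (ι → Bool)) [IsFiniteMeasure μ] (k : ℕ) :
    rankSeq μ k = ∑ x with rank x = k, μ.real {x} := by
  rw [rankSeq, measureReal_eq_sum, Finset.sum_filter]

theorem rankSeq_ne_zero_iff {μ : Measure (ι → Bool)} [IsFiniteMeasure μ] {k : ℕ} :
    rankSeq μ k ≠ 0 ↔ ∃ x : ι → Bool, rank x = k ∧ μ.real {x} ≠ 0 := by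
  rw [rankSeq_eq_sum_filter, Ne, Finset.sum_eq_zero_iff_of_nonneg fun _ _ => measureReal_nonneg]
  simp

/-- On the diagonal `f(s, …, s) = ∑ (d choose k) c_k s^k` with `c_k = a_k / (d choose k)`, so `x ↦ c
(rank x)` is a stable weight by polarization. Newton's inequality is its corner inequality above a
set of `k - 1` ones. -/
theorem IsStrongRayleigh.ultraLogConcave {μ : Measure (ι → Bool)} (hμ : IsStrongRayleigh μ) :
    UltraLogConcave (Fintype.card ι) (rankSeq μ) := by
  have := hμ.isProbabilityMeasure
  constructor
  · intro i j k hij hjk _ hi hk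
    rw [rankSeq_ne_zero_iff] at hi hk ⊢
    have h := hμ.stab.level_ne_zero (fun _ => measureReal_nonneg) (z := fun _ => Complex.I)
      (by simp) hi hk hij.le hjk.le
    by_contra! hj
    exact h (mev_level_eq_zero (fun x hx => by exact_mod_cast hj x hx) _)
  · intro k hk1 hkd
    set d := Fintype.card ι with hd
    let c : ℕ → ℝ := fun k => rankSeq μ k / (d.choose k : ℝ)
    have hc0 : ∀ k, 0 ≤ c k := fun k => div_nonneg measureReal_nonneg (by positivity)
    have hstab : Stab fun x : ι → Bool => ((c (rank x) : ℝ) : ℂ) := by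
      refine stab_of_rank (fun k => (c k : ℂ)) fun s hs => ?_
      have h1 := hμ.stab (fun _ => s) fun _ => hs
      rw [mev_const_eq, sum_rank_eq_sum] at h1
      convert h1 using 1
      refine Finset.sum_congr rfl fun i hi => ?_
      have hi' : i ≤ d := Nat.lt_succ_iff.mp (Finset.mem_range.mp hi)
      have hch : (d.choose i : ℂ) ≠ 0 := by exact_mod_cast (Nat.choose_pos hi').ne'
      simp only [c]
      rw [rankSeq_eq_sum_filter]
      push_cast
      rw [mul_div_cancel₀ _ hch, Finset.sum_mul]
      refine Finset.sum_congr rfl fun x hx => ?_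
      rw [(Finset.mem_filter.mp hx).2]
    have hsr : SRWeight fun x : ι → Bool => c (rank x) := ⟨fun x => hc0 _, fun _ => hstab⟩
    obtain ⟨T, -, hT⟩ := Finset.exists_subset_card_eq (s := (Finset.univ : Finset ι)) (n := k + 1)
      (by rw [Finset.card_univ]; omega)
    obtain ⟨i, hi, j, hj, hij⟩ := Finset.one_lt_card.mp (by omega : 1 < T.card)
    set K := (T.erase i).erase j with hK
    have hKc : K.card = k - 1 := by
      rw [hK, Finset.card_erase_of_mem (Finset.mem_erase.mpr ⟨hij.symm, hj⟩),
        Finset.card_erase_of_mem hi, hT]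
      rfl
    have hiK : i ∉ K := by simp [hK]
    have hjK : j ∉ K := by simp [hK]
    have h := hsr.rayleigh_corner hij (ofFinset K)
    rw [update_ofFinset_of_notMem hiK, update_ofFinset_of_notMem hjK, update_ofFinset,
      update_ofFinset, update_ofFinset,
      update_ofFinset_of_notMem (by simp [hjK, hij.symm] : j ∉ insert i K),
      rank_ofFinset, rank_ofFinset, rank_ofFinset, rank_ofFinset,
      Finset.card_insert_of_notMem (by simp [hjK, hij.symm] : j ∉ insert i K),
      Finset.card_insert_of_notMem hiK, Finset.card_insert_of_notMem hjK, hKc,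
      Nat.sub_add_cancel hk1] at h
    rw [pow_two]
    exact h

/-! ### Stochastically increasing levels -/

omit [DecidableEq ι] in
theorem rank_unit (u : Unit → Bool) : rank u = if u () then 1 else 0 := by
  simp [rank, Finset.filter_singleton, apply_ite Finset.card]

theorem sum_unit_bool {M : Type*} [AddCommMonoid M] (G : (Unit → Bool) → M) :
    ∑ u, G u = G (fun _ => true) + G fun _ => false := by
  rw [← Fintype.sum_bool fun b => G fun _ => b]
  exact Fintype.sum_equiv (Equiv.funUnique Unit Bool) _ _ fun u => rfl

/-- The homogenization, with one additional coordinate, of the levels `k` and `k + 1` of `w`. -/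
def homogenizePair (w : (ι → Bool) → ℝ) (k : ℕ) (y : ι ⊕ Unit → Bool) : ℝ :=
  if rank y = k + 1 then w fun j => y (Sum.inl j) else 0

omit [DecidableEq ι] in
theorem homogenizePair_true (w : (ι → Bool) → ℝ) (k : ℕ) (x : ι → Bool) :
    homogenizePair w k (Sum.elim x fun _ => true) = level w k x := by
  simp [homogenizePair, rank_sumElim, rank_unit, level]

omit [DecidableEq ι] in
theorem homogenizePair_false (w : (ι → Bool) → ℝ) (k : ℕ) (x : ι → Bool) :
    homogenizePair w k (Sum.elim x fun _ => false) = level w (k + 1) x := by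
  simp [homogenizePair, rank_sumElim, rank_unit, level]

/-- Rank rescaling first isolates the levels `k` and `k + 1`. With `g` the resulting polynomial and
`t` the extra variable, the homogenization is `t^(k+1) g(z/t)`, and `1/t` lies in the lower
half-plane. -/
theorem SRWeight.homogenizePair {w : (ι → Bool) → ℝ} (hw : SRWeight w) (k : ℕ) :
    SRWeight (homogenizePair w k) where
  nonneg y := by
    simp only [StrongRayleigh.homogenizePair]
    split_ifs
    · exact hw.nonneg _
    · exact le_rfl
  stab := by
    rintro ⟨y, hy⟩
    have hyk : rank y = k + 1 := by
      by_contra h; exact hy (by simp [StrongRayleigh.homogenizePair, h])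
    have hwy : w (fun j => y (Sum.inl j)) ≠ 0 := fun h =>
      hy (by simp [StrongRayleigh.homogenizePair, h])
    have hs := hw.stab ⟨_, hwy⟩
    have hrank : rank y = rank (fun j => y (Sum.inl j)) + rank fun j => y (Sum.inr j) := by
      rw [← rank_sumElim]
      congr 1
      ext j; cases j <;> rfl
    set x : ι → Bool := fun j => y (Sum.inl j) with hx
    have hxk : k ≤ rank x ∧ rank x ≤ k + 1 := by
      rw [rank_unit] at hrank
      split_ifs at hrank <;> omega
    let b : ℕ → ℝ := fun i => if k ≤ i ∧ i ≤ k + 1 then 1 else 0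
    have hs' := hs.rank_rescale hw.nonneg (b := b)
      (fun i _ => by simp only [b]; split_ifs <;> norm_num)
      (fun s hs => window_sum_ne_zero (Nat.le_succ k) le_rfl (hxk.1.trans (rank_le x)) hs)
      ⟨x, by simpa [b, hxk] using hwy⟩
    intro z hz
    set t := z (Sum.inr ()) with ht
    have ht0 : t ≠ 0 := by
      intro h; have := hz (Sum.inr ()); rw [← ht, h] at this; simp at this
    have h1 := hs'.smul_ne_zero (fun x => mul_nonneg
      (by simp only [b]; split_ifs <;> norm_num) (hw.nonneg x)) (z := fun j => z (Sum.inl j))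
      (fun j => hz _) (s := t⁻¹) (by
        rw [Complex.inv_im]
        exact div_neg_of_neg_of_pos (by linarith [hz (Sum.inr ())]) (Complex.normSq_pos.mpr ht0))
    have h2 : mev (fun y => ((StrongRayleigh.homogenizePair w k y : ℝ) : ℂ)) z =
        t ^ (k + 1) * mev (fun x => ((b (rank x) * w x : ℝ) : ℂ)) fun j => t⁻¹ * z (Sum.inl j) := by
      rw [mev_sumElim, ← mev_rank_pow, ← mev_const_mul]
      simp only [mev, sum_unit_bool, homogenizePair_true, homogenizePair_false, if_true,
        Bool.false_eq_true, if_false, Finset.univ_unique, Finset.prod_singleton, mul_one,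
        Finset.sum_mul]
      rw [← Finset.sum_add_distrib]
      refine Finset.sum_congr rfl fun x _ => ?_
      simp only [level, b]
      by_cases h1 : rank x = k
      · simp [h1, pow_succ]
        field_simp
        ring
      by_cases h2 : rank x = k + 1
      · simp [h2]
        field_simp
        simp
      · have : ¬ (k ≤ rank x ∧ rank x ≤ k + 1) := by omega
        simp [h1, h2, this]
    rw [h2]
    exact mul_ne_zero (pow_ne_zero _ ht0) h1

/-- The extra coordinate is `1` exactly on level `k`, and `f` does not depend on it, so
`SRWeight.cov_nonpos` compares the two levels. -/
theorem SRWeight.level_mono {w : (ι → Bool) → ℝ} (hw : SRWeight w) (k : ℕ)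
    {f : (ι → Bool) → ℝ} (hf : Monotone f) :
    wsum (level w (k + 1)) 1 * wsum (level w k) f ≤
      wsum (level w (k + 1)) f * wsum (level w k) 1 := by
  have h := (hw.homogenizePair k).cov_nonpos (r := k + 1) (fun y hy => by
      by_contra h; exact hy (by simp [StrongRayleigh.homogenizePair, h]))
    (f := fun y => f fun j => y (Sum.inl j)) (fun y y' h => hf fun j => h _) (Sum.inr ())
    (fun y b => by
      congr 1)
  have e1 : ∀ g : (ι → Bool) → ℝ, wsum (StrongRayleigh.homogenizePair w k)
      (fun y => g fun j => y (Sum.inl j)) = wsum (level w k) g + wsum (level w (k + 1)) g := by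
    intro g
    simp only [wsum, sum_sumElim, sum_unit_bool, homogenizePair_true, homogenizePair_false,
      Sum.elim_inl]
  have e2 : ∀ g : (ι → Bool) → ℝ, wsum (StrongRayleigh.restr (Sum.inr ()) true
      (StrongRayleigh.homogenizePair w k)) (fun y => g fun j => y (Sum.inl j)) =
      wsum (level w k) g := by
    intro g
    simp [wsum, sum_sumElim, sum_unit_bool, StrongRayleigh.restr, homogenizePair_true]
  have e1' := e1 1
  have e2' := e2 1
  simp only [Pi.one_apply] at e1' e2'
  rw [cov, e1, e2, show (1 : (ι ⊕ Unit → Bool) → ℝ) = fun _ => 1 from rfl, e1', e2'] at h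
  linarith

theorem cond_level_real (μ : Measure (ι → Bool)) [IsFiniteMeasure μ] (k : ℕ)
    (A : Set (ι → Bool)) [DecidablePred (· ∈ A)] :
    (ProbabilityTheory.cond μ {x | rank x = k}).real A =
      wsum (level (fun x => μ.real {x}) k) (fun x => if x ∈ A then 1 else 0) /
        wsum (level (fun x => μ.real {x}) k) 1 := by
  have h1 : wsum (level (fun x => μ.real {x}) k) 1 = μ.real {x | rank x = k} := by
    rw [measureReal_eq_sum]
    simp [wsum, level]
  have h2 : (ProbabilityTheory.cond μ {x | rank x = k}).real A =
      ∑ x, if x ∈ A then (ProbabilityTheory.cond μ {x | rank x = k}).real {x} else 0 :=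
    measureReal_eq_sum _ (· ∈ A)
  rw [h2, h1, wsum, Finset.sum_div]
  refine Finset.sum_congr rfl fun x _ => ?_
  rw [cond_real_singleton, level]
  split_ifs <;> simp

theorem IsStrongRayleigh.hasStochIncreasingLevels {μ : Measure (ι → Bool)}
    (hμ : IsStrongRayleigh μ) : HasStochIncreasingLevels μ := by
  classical
  have := hμ.isProbabilityMeasure
  intro k hk hk1 A hA
  have hpos : ∀ k, μ {x | rank x = k} ≠ 0 → 0 < wsum (level (fun x => μ.real {x}) k) 1 := by
    intro k hk
    have h1 : wsum (level (fun x => μ.real {x}) k) 1 = μ.real {x | rank x = k} := by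
      rw [measureReal_eq_sum]
      simp [wsum, level]
    rw [h1]
    exact lt_of_le_of_ne measureReal_nonneg fun h => hk (by
      rwa [eq_comm, measureReal_eq_zero_iff] at h)
  rw [← ENNReal.toReal_le_toReal (measure_ne_top _ _) (measure_ne_top _ _)]
  change (ProbabilityTheory.cond μ {x | rank x = k}).real A ≤
    (ProbabilityTheory.cond μ {x | rank x = k + 1}).real A
  rw [cond_level_real, cond_level_real, div_le_div_iff₀ (hpos k hk) (hpos (k + 1) hk1), mul_comm]
  refine hμ.srWeight.level_mono k fun x y hxy => ?_
  by_cases hx : x ∈ A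
  · simp [hx, hA hxy hx]
  · simp only [hx, if_false]
    split_ifs <;> norm_num

/-! ### The stochastic covering property -/

omit [DecidableEq ι] in
theorem restr_homogenize (w : (ι → Bool) → ℝ) (j : ι) (b : Bool) :
    restr (Sum.inl j) b (homogenize w) = homogenize (restr j b w) := by
  ext y
  simp only [restr, homogenize]
  split_ifs <;> simp

omit [DecidableEq ι] in
/-- If `y ≤ x` and `x` has exactly one more coordinate equal to one, then along any choice of
coordinates `x` and `y` agree or `x` covers `y`. -/
theorem eq_or_covBy_of_rank {κ : Type*} {x y : ι → Bool} (hle : y ≤ x) (hr : rank x = rank y + 1)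
    (p : κ → ι) (hp : Function.Injective p) :
    (fun i => x (p i)) = (fun i => y (p i)) ∨ (fun i => y (p i)) ⋖ fun i => x (p i) := by
  -- The rank condition leaves exactly one coordinate at which `x` and `y` differ.
  have huniq : ∀ i j, x i = true → y i = false → x j = true → y j = false → i = j := by
    classical
    intro i j hxi hyi hxj hyj
    by_contra hij
    have hsub : insert i (insert j (Finset.univ.filter fun l => y l = true)) ⊆
        Finset.univ.filter fun l => x l = true := by
      intro l hl
      simp only [Finset.mem_insert, Finset.mem_filter, Finset.mem_univ, true_and] at hl ⊢
      rcases hl with rfl | rfl | hl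
      · exact hxi
      · exact hxj
      · have := hle l
        rw [hl] at this
        exact Bool.eq_true_of_true_le this
    have hc := Finset.card_le_card hsub
    rw [Finset.card_insert_of_notMem (by simp [hij, hyi]),
      Finset.card_insert_of_notMem (by simp [hyj])] at hc
    simp only [rank] at hr
    omega
  by_cases heq : (fun i => x (p i)) = fun i => y (p i)
  · exact Or.inl heq
  right
  refine ⟨lt_of_le_of_ne (fun i => hle (p i)) fun h => heq h.symm, fun v hyv hvx => ?_⟩
  obtain ⟨i, hi⟩ : ∃ i, ¬ v i ≤ y (p i) := by
    by_contra! h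
    exact hyv.not_ge h
  obtain ⟨j, hj⟩ : ∃ j, ¬ x (p j) ≤ v j := by
    by_contra! h
    exact hvx.not_ge h
  have hvi := hvx.le i
  have hvj := hyv.le j
  simp only at hvi hvj
  cases h1 : v i <;> cases h2 : y (p i) <;> simp [h1, h2] at hi
  cases h3 : v j <;> cases h4 : x (p j) <;> simp [h3, h4] at hj
  have h5 : x (p i) = true := by
    rw [h1] at hvi; exact Bool.eq_true_of_true_le hvi
  have h6 : y (p j) = false := by
    rw [h3] at hvj; exact Bool.eq_false_of_le_false hvj
  have := hp (huniq _ _ h5 h2 h4 h6)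
  rw [this, h3] at h1
  cases h1

omit [Fintype ι] [DecidableEq ι] in
instance (j : ι) (μ : Measure (ι → Bool)) [IsFiniteMeasure μ] :
    IsFiniteMeasure (dropCoord j μ) := by
  unfold dropCoord
  infer_instance

/-- On the homogenization every state has rank `d`. Resetting the `j`-th coordinate to `0` in the
law given `X_j = 1` lowers the rank to `d - 1`, so an ordered coupling with the law given `X_j = 0`
changes a single coordinate. Forgetting coordinates leaves equality or a covering. -/
theorem IsStrongRayleigh.hasStochCoveringProperty {μ : Measure (ι → Bool)}
    (hμ : IsStrongRayleigh μ) : HasStochCoveringProperty μ := by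
  have := hμ.isProbabilityMeasure
  intro j hj0 hj1
  set w : (ι → Bool) → ℝ := fun x => μ.real {x} with hwdef
  have hw : SRWeight w := hμ.srWeight
  have hmassb : ∀ b, wsum (restr j b w) 1 = μ.real {x | x j = b} := by
    intro b
    rw [measureReal_eq_sum]
    simp [wsum, restr, w]
  have hposb : ∀ b, μ {x | x j = b} ≠ 0 → 0 < μ.real {x | x j = b} := fun b hb =>
    lt_of_le_of_ne measureReal_nonneg fun h => hb (by rwa [eq_comm, measureReal_eq_zero_iff] at h)
  set A0 := μ.real {x | x j = false} with hA0
  set A1 := μ.real {x | x j = true} with hA1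
  have hA0pos : 0 < A0 := hposb false hj0
  have hA1pos : 0 < A1 := hposb true hj1
  let e : ι ⊕ ι := Sum.inl j
  have hres : ∀ b (f : (ι → Bool) → ℝ), wsum (restr e b (homogenize w))
      (fun y => f fun i => y (Sum.inl i)) = wsum (restr j b w) f := by
    intro b f
    rw [restr_homogenize, wsum_homogenize]
  have hres1 : ∀ b, wsum (restr e b (homogenize w)) 1 = μ.real {x | x j = b} := by
    intro b
    rw [← hmassb]
    exact hres b 1
  let m : (ι ⊕ ι → Bool) → ℝ := fun y => restr e false (homogenize w) y / A0
  let n : (ι ⊕ ι → Bool) → ℝ := fun y =>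
    ∑ y', if Function.update y' e false = y then restr e true (homogenize w) y' / A1 else 0
  have hWnn : ∀ b y, 0 ≤ restr e b (homogenize w) y := fun b => (hw.homogenize.restr e b).nonneg
  have hm : ∀ y, 0 ≤ m y := fun y => div_nonneg (hWnn _ _) hA0pos.le
  have hn : ∀ y, 0 ≤ n y := fun y => Finset.sum_nonneg fun y' _ => by
    split_ifs
    · exact div_nonneg (hWnn _ _) hA1pos.le
    · exact le_rfl
  have hmF : ∀ F : (ι ⊕ ι → Bool) → ℝ, ∑ y, m y * F y =
      wsum (restr e false (homogenize w)) F / A0 := by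
    intro F
    rw [wsum, Finset.sum_div]
    exact Finset.sum_congr rfl fun y _ => by simp only [m]; ring
  have hnF : ∀ F : (ι ⊕ ι → Bool) → ℝ, ∑ y, n y * F y =
      wsum (restr e true (homogenize w)) (fun y => F (Function.update y e false)) / A1 := by
    intro F
    simp only [n, Finset.sum_mul, ite_mul, zero_mul]
    rw [Finset.sum_comm, wsum, Finset.sum_div]
    refine Finset.sum_congr rfl fun y _ => ?_
    rw [Finset.sum_ite_eq, if_pos (Finset.mem_univ _)]
    ring
  have hm1 : ∑ y, m y = 1 := by
    have := hmF 1
    simp only [Pi.one_apply, mul_one] at this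
    rw [this, hres1, div_self hA0pos.ne']
  -- Composing `F` with the reset makes it independent of the coordinate `e` and changes nothing
  -- where that coordinate is `0`; domination is then `SRWeight.cov_nonpos`.
  obtain ⟨q, hq, hq1, hq2, hqle⟩ := exists_monotone_coupling hm hm1 hn (fun F hF => by
    rw [hmF, hnF]
    let F' : (ι ⊕ ι → Bool) → ℝ := fun y => F (Function.update y e false)
    have h1 : wsum (restr e false (homogenize w)) F = wsum (restr e false (homogenize w)) F' := by
      refine Finset.sum_congr rfl fun y _ => ?_
      by_cases hy : y e = false
      · have : Function.update y e false = y := by rw [← hy]; exact Function.update_eq_self _ _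
        simp only [F', this]
      · simp [restr, hy]
    have h2 := hw.homogenize.cov_nonpos (fun y hy => rank_of_homogenize_ne_zero hy) (f := F')
      (fun y y' h => hF (update_le_update_iff.mpr ⟨le_rfl, fun i _ => h i⟩)) e
      (fun y b => by simp only [F', Function.update_idem])
    rw [cov, ← wsum_restr_add e (homogenize w) 1, ← wsum_restr_add e (homogenize w) F', hres1,
      hres1] at h2
    rw [h1, div_le_div_iff₀ hA1pos hA0pos]
    linarith)
  let p : (ι ⊕ ι → Bool) → {i : ι // i ≠ j} → Bool := fun y i => y (Sum.inl i.1)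
  have hpm : Measurable fun s : (ι ⊕ ι → Bool) × (ι ⊕ ι → Bool) => (p s.1, p s.2) :=
    fun s _ => (Set.toFinite _).measurableSet
  have hdrop : Measurable fun (x : ι → Bool) (i : {i : ι // i ≠ j}) => x i.1 :=
    fun s _ => (Set.toFinite _).measurableSet
  have hcondmass : ∀ b (v : {i : ι // i ≠ j} → Bool),
      (dropCoord j (ProbabilityTheory.cond μ {x | x j = b})).real {v} =
        wsum (restr j b w) (fun x => if (fun i : {i : ι // i ≠ j} => x i.1) = v then 1 else 0) /
          μ.real {x | x j = b} := by
    intro b v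
    rw [dropCoord, cond_eq_ofMass, ofMass_map_real_singleton, wsum, Finset.sum_div]
    · refine Finset.sum_congr rfl fun x _ => ?_
      simp only [restr]
      split_ifs <;> simp [w]
    · intro x
      split_ifs <;> positivity
  refine ⟨(ofMass q).map fun s => (p s.1, p s.2), ?_, ?_, ?_⟩
  · rw [Measure.map_map measurable_fst hpm]
    refine Measure.ext_of_measureReal_singleton fun v => ?_
    rw [ofMass_map_real_singleton hq, hcondmass, ← hres, ← hmF, Fintype.sum_prod_type]
    refine Finset.sum_congr rfl fun y _ => ?_
    simp only [Function.comp_apply]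
    rw [← hq1 y, Finset.sum_mul]
    refine Finset.sum_congr rfl fun y' _ => ?_
    simp only [p]
    split_ifs <;> simp
  · rw [Measure.map_map measurable_snd hpm]
    refine Measure.ext_of_measureReal_singleton fun v => ?_
    rw [ofMass_map_real_singleton hq, hcondmass, ← hres]
    have := hnF fun y => if p y = v then 1 else 0
    have hupd : ∀ y, p (Function.update y e false) = p y := by
      intro y
      ext i
      simp only [p]
      rw [Function.update_of_ne]
      intro h
      exact i.2 (Sum.inl_injective h)
    simp only [hupd] at this
    rw [show (fun y : ι ⊕ ι → Bool => if (fun i : {i : ι // i ≠ j} => y (Sum.inl i.1)) = v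
      then (1 : ℝ) else 0) = fun y => if p y = v then 1 else 0 from rfl, ← this,
      Fintype.sum_prod_type_right]
    refine Finset.sum_congr rfl fun y _ => ?_
    simp only [Function.comp_apply]
    rw [← hq2 y, Finset.sum_mul]
    refine Finset.sum_congr rfl fun y' _ => ?_
    split_ifs <;> simp
  · classical
    rw [Measure.map_apply hpm (Set.toFinite _).measurableSet, ofMass_apply]
    refine Finset.sum_eq_zero fun s _ => ?_
    split_ifs with hs
    · rw [ENNReal.ofReal_eq_zero]
      by_contra! hqs
      refine hs ?_
      -- A pair charged by the coupling has both entries charged by the marginals, which determines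
      -- their ranks.
      have hms : m s.1 ≠ 0 := by
        rw [← hq1]
        exact (lt_of_lt_of_le hqs (Finset.single_le_sum (f := fun y => q (s.1, y))
          (fun y _ => hq _) (Finset.mem_univ s.2))).ne'
      have hns : n s.2 ≠ 0 := by
        rw [← hq2]
        exact (lt_of_lt_of_le hqs (Finset.single_le_sum (f := fun x => q (x, s.2))
          (fun y _ => hq _) (Finset.mem_univ s.1))).ne'
      have hr1 : rank s.1 = Fintype.card ι := by
        refine rank_of_homogenize_ne_zero (w := w) (restr_ne_zero (j := e) (b := false).mp ?_).2
        intro h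
        exact hms (by simp [m, h])
      obtain ⟨y', -, hy'⟩ := Finset.exists_ne_zero_of_sum_ne_zero hns
      rw [ne_eq, ite_eq_right_iff, Classical.not_imp] at hy'
      obtain ⟨hy1, hy2⟩ := hy'
      have hy3 := restr_ne_zero.mp (left_ne_zero_of_mul (div_eq_mul_inv _ A1 ▸ hy2))
      have hr2 : rank y' = Fintype.card ι := rank_of_homogenize_ne_zero hy3.2
      have hr3 : rank y' = rank s.2 + 1 := by
        rw [← hy1, rank, rank, ← Finset.card_erase_add_one (a := e) (by simp [hy3.1])]
        congr 2
        ext l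
        rcases eq_or_ne l e with rfl | hl
        · simp
        · simp [hl]
      exact eq_or_covBy_of_rank (hqle s hqs.ne') (by omega) (fun i : {i : ι // i ≠ j} => Sum.inl i.1)
        fun a b hab => Subtype.ext (Sum.inl_injective hab)
    · rfl

end Consequences

end StrongRayleigh

/-! ### Chernoff's product formula -/

section Chernoff

open Filter Topology

theorem norm_pow_sub_pow_le {𝔸 : Type*} [NormedRing 𝔸] [NormOneClass 𝔸] {a b : 𝔸} {K : ℝ}
    (hK : 1 ≤ K) (ha : ‖a‖ ≤ K) (hb : ‖b‖ ≤ K) (n : ℕ) :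
    ‖a ^ n - b ^ n‖ ≤ n * K ^ n * ‖a - b‖ := by
  have hK0 : 0 ≤ K := by linarith
  induction n with
  | zero => simp
  | succ n ih =>
    have h1 : a ^ (n + 1) - b ^ (n + 1) = (a ^ n - b ^ n) * a + b ^ n * (a - b) := by
      rw [pow_succ, pow_succ]; noncomm_ring
    have hbn : ‖b ^ n‖ ≤ K ^ n := (norm_pow_le b n).trans (pow_le_pow_left₀ (norm_nonneg _) hb n)
    have h2 : K ^ n ≤ K ^ (n + 1) := pow_le_pow_right₀ hK (Nat.le_succ n)
    calc ‖a ^ (n + 1) - b ^ (n + 1)‖ ≤ ‖a ^ n - b ^ n‖ * ‖a‖ + ‖b ^ n‖ * ‖a - b‖ := by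
          rw [h1]
          exact (norm_add_le _ _).trans (add_le_add (norm_mul_le _ _) (norm_mul_le _ _))
      _ ≤ (n * K ^ n * ‖a - b‖) * K + K ^ (n + 1) * ‖a - b‖ := by
          gcongr
          exact hbn.trans h2
      _ = _ := by push_cast; ring

/-- Chernoff's product formula for a differentiable curve through the identity. -/
theorem tendsto_pow_exp_of_hasDerivAt {𝔸 : Type*} [NormedRing 𝔸] [NormOneClass 𝔸]
    [NormedAlgebra ℝ 𝔸] [CompleteSpace 𝔸] {A : ℝ → 𝔸} {X : 𝔸} (hA0 : A 0 = 1)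
    (hA : HasDerivAt A X 0) :
    Tendsto (fun n : ℕ => A ((n : ℝ)⁻¹) ^ n) atTop (𝓝 (NormedSpace.exp X)) := by
  let : NormedAlgebra ℚ 𝔸 := NormedAlgebra.restrictScalars ℚ ℝ 𝔸
  let B : ℝ → 𝔸 := fun s => NormedSpace.exp (s • X)
  have hB0 : B 0 = 1 := by simp [B]
  have hB : HasDerivAt B X 0 := by
    have := hasDerivAt_exp_smul_const (𝕂 := ℝ) X 0
    simpa using this
  have hBn : ∀ n : ℕ, n ≠ 0 → B ((n : ℝ)⁻¹) ^ n = NormedSpace.exp X := by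
    intro n hn
    have hn' : (n : ℝ) ≠ 0 := by exact_mod_cast hn
    simp only [B]
    rw [← NormedSpace.exp_nsmul, ← Nat.cast_smul_eq_nsmul ℝ, smul_smul, mul_inv_cancel₀ hn',
      one_smul]
  have hinv : Tendsto (fun n : ℕ => ((n : ℝ))⁻¹) atTop (𝓝 0) :=
    tendsto_inv_atTop_nhds_zero_nat
  have hbound : ∀ F : ℝ → 𝔸, F 0 = 1 → HasDerivAt F X 0 →
      ∀ᶠ s in 𝓝 (0 : ℝ), ‖F s‖ ≤ 1 + (‖X‖ + 1) * |s| := by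
    intro F hF0 hF
    have h1 := hF.isLittleO.bound one_pos
    filter_upwards [h1] with s hs
    simp only [sub_zero, one_mul, hF0, Real.norm_eq_abs] at hs
    have h2 : F s = (F s - 1 - s • X) + s • X + 1 := by abel
    calc ‖F s‖ ≤ ‖F s - 1 - s • X‖ + ‖s • X‖ + ‖(1 : 𝔸)‖ := by
          conv_lhs => rw [h2]
          exact norm_add₃_le
      _ ≤ |s| + |s| * ‖X‖ + 1 := by
          rw [norm_one, norm_smul, Real.norm_eq_abs]; gcongr
      _ = _ := by ring
  -- Both curves have derivative `X` at `0`. Their difference is `o(1/n)` at `s = 1/n`, and taking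
  -- `n`-th powers costs only a factor of order `n`.
  have hsub : (fun s => A s - B s) =o[𝓝 0] fun s : ℝ => s := by
    have h1 := hA.isLittleO.sub hB.isLittleO
    simp only [hA0, hB0, sub_zero] at h1
    refine h1.congr_left fun s => ?_
    abel
  rw [tendsto_iff_norm_sub_tendsto_zero, Metric.tendsto_atTop]
  intro ε hε
  set C := ‖X‖ + 1 with hC
  have hC0 : 0 < C := by positivity
  have hδ : 0 < ε / (2 * Real.exp C) := by positivity
  have hev := hinv.eventually ((hbound A hA0 hA).and ((hbound B hB0 hB).and (hsub.bound hδ)))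
  obtain ⟨N, hN⟩ := eventually_atTop.mp hev
  refine ⟨max N 1, fun n hn => ?_⟩
  have hn1 : n ≠ 0 := by have := le_of_max_le_right hn; omega
  have hn0 : (0 : ℝ) < n := by exact_mod_cast Nat.pos_of_ne_zero hn1
  obtain ⟨h1, h2, h3⟩ := hN n (le_of_max_le_left hn)
  rw [abs_of_pos (inv_pos.mpr hn0)] at h1 h2
  -- The bound `1 + C/n` on both norms is chosen because its `n`-th power stays below `e^C`.
  have h4 := norm_pow_sub_pow_le (K := 1 + C * (n : ℝ)⁻¹)
    (by have := mul_pos hC0 (inv_pos.mpr hn0); linarith) h1 h2 n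
  have h5 : (1 + C * (n : ℝ)⁻¹) ^ n ≤ Real.exp C := by
    calc (1 + C * (n : ℝ)⁻¹) ^ n ≤ Real.exp (C * (n : ℝ)⁻¹) ^ n := by
          gcongr
          rw [add_comm]; exact Real.add_one_le_exp _
      _ = Real.exp C := by
          rw [← Real.exp_nat_mul]; congr 1; field_simp
  rw [hBn n hn1] at h4
  rw [Real.norm_eq_abs, abs_of_pos (inv_pos.mpr hn0)] at h3
  rw [Real.dist_eq, sub_zero, abs_of_nonneg (norm_nonneg _)]
  calc _ ≤ n * (1 + C * (n : ℝ)⁻¹) ^ n * ‖A (n : ℝ)⁻¹ - B (n : ℝ)⁻¹‖ := h4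
    _ ≤ n * Real.exp C * (ε / (2 * Real.exp C) * (n : ℝ)⁻¹) := by gcongr
    _ = ε / 2 := by field_simp
    _ < ε := by linarith

end Chernoff

/-! ### The symmetric exclusion process -/

namespace StrongRayleigh

section Exclusion

open Filter Topology

/-- The operator `w ↦ w ᵥ* M`. -/
noncomputable def vecMulCLM {n : Type*} [Fintype n] (M : Matrix n n ℝ) :
    (n → ℝ) →L[ℝ] (n → ℝ) :=
  LinearMap.toContinuousLinearMap M.vecMulLinear

theorem vecMulCLM_apply {n : Type*} [Fintype n] (M : Matrix n n ℝ) (w : n → ℝ) :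
    vecMulCLM M w = Matrix.vecMul w M := rfl

theorem vecMulCLM_pow {n : Type*} [Fintype n] [DecidableEq n] (M : Matrix n n ℝ) (k : ℕ) :
    vecMulCLM (M ^ k) = vecMulCLM M ^ k := by
  induction k with
  | zero => ext1 w; simp [vecMulCLM_apply]
  | succ k ih =>
    ext1 w
    rw [pow_succ', pow_succ, mul_apply_eq_comp, ← ih, vecMulCLM_apply, vecMulCLM_apply,
      vecMulCLM_apply, Matrix.vecMul_vecMul]

/-- Moves the matrix exponential into a Banach algebra of operators, termwise in the power series.
Acting on row vectors reverses products, which is harmless for powers of one matrix. -/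
theorem vecMul_exp {n : Type*} [Fintype n] [DecidableEq n] (M : Matrix n n ℝ) (w : n → ℝ) :
    Matrix.vecMul w (NormedSpace.exp M) = NormedSpace.exp (vecMulCLM M) w := by
  let f : ((n → ℝ) →L[ℝ] (n → ℝ)) →+ Matrix n n ℝ :=
    { toFun := fun T x y => T (Pi.single x 1) y
      map_zero' := rfl
      map_add' := fun _ _ => rfl }
  have hf : Continuous f := by
    refine continuous_matrix fun x y => ?_
    exact (continuous_apply y).comp
      (ContinuousLinearMap.apply ℝ (n → ℝ) (Pi.single x (1 : ℝ) : n → ℝ)).continuous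
  have hfM : ∀ N : Matrix n n ℝ, f (vecMulCLM N) = N := by
    intro N
    ext x y
    change vecMulCLM N (Pi.single x 1) y = N x y
    simp [vecMulCLM_apply]
  have hfsmul : ∀ (c : ℝ) T, f (c • T) = c • f T := fun _ _ => rfl
  have hsum := NormedSpace.expSeries_hasSum_exp (𝕂 := ℝ) (vecMulCLM M)
  simp only [NormedSpace.expSeries_apply_eq] at hsum
  have hsum' := hsum.map f hf
  have hexp : NormedSpace.exp M = f (NormedSpace.exp (vecMulCLM M)) := by
    rw [NormedSpace.exp_eq_tsum ℝ, ← hsum'.tsum_eq]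
    refine tsum_congr fun k => ?_
    simp only [Function.comp_apply]
    rw [hfsmul, ← vecMulCLM_pow, hfM]
  rw [hexp]
  set T := NormedSpace.exp (vecMulCLM M)
  ext y
  have hw : w = ∑ x, w x • (Pi.single x 1 : n → ℝ) := by
    ext z; simp [Finset.sum_apply, Pi.single_apply]
  conv_rhs => rw [hw]
  rw [map_sum, Finset.sum_apply]
  simp only [Matrix.vecMul, dotProduct, map_smul, Pi.smul_apply, smul_eq_mul]
  rfl

variable {ι : Type*} [Fintype ι] [DecidableEq ι]

/-- The mass functions of strong Rayleigh probability measures. -/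
def stableMass (ι : Type*) [Fintype ι] [DecidableEq ι] : Set ((ι → Bool) → ℝ) :=
  {w | (∀ x, 0 ≤ w x) ∧ ∑ x, w x = 1 ∧ Stab fun x => (w x : ℂ)}

/-- Total mass `1` rules out the zero polynomial in the limit. -/
theorem isClosed_stableMass : IsClosed (stableMass ι) := by
  have : stableMass ι = ({w | ∀ x, 0 ≤ w x} ∩ {w | ∑ x, w x = 1}) ∩
      (fun (w : (ι → Bool) → ℝ) (x : ι → Bool) => (w x : ℂ)) ⁻¹'
        {w | Stab w ∨ ∀ z, mev w z = 0} := by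
    ext w
    constructor
    · rintro ⟨h1, h2, h3⟩
      exact ⟨⟨h1, h2⟩, Or.inl h3⟩
    · rintro ⟨⟨h1, h2⟩, h3⟩
      refine ⟨h1, h2, h3.resolve_right fun h => ?_⟩
      refine mev_ne_zero_of_pos h1 ?_ (t := fun _ => 1) (fun _ => one_pos) (h _)
      by_contra! h0
      change ∑ x, w x = 1 at h2
      rw [Finset.sum_eq_zero fun x _ => h0 x] at h2
      exact zero_ne_one h2
  rw [this]
  refine (IsClosed.inter ?_ ?_).inter (isClosed_stab_or_zero.preimage ?_)
  · simp only [Set.ofPred_forall]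
    exact isClosed_iInter fun x => isClosed_le continuous_const (continuous_apply x)
  · exact isClosed_eq (by fun_prop) continuous_const
  · fun_prop

/-- The generators `X` that are tangent at the identity to a curve of operators preserving the
strong Rayleigh property. -/
def IsTangent (X : ((ι → Bool) → ℝ) →L[ℝ] ((ι → Bool) → ℝ)) : Prop :=
  ∃ A : ℝ → ((ι → Bool) → ℝ) →L[ℝ] ((ι → Bool) → ℝ), A 0 = 1 ∧ HasDerivAt A X 0 ∧
    ∀ᶠ s in 𝓝[>] (0 : ℝ), ∀ w ∈ stableMass ι, A s w ∈ stableMass ι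

theorem isTangent_zero : IsTangent (0 : ((ι → Bool) → ℝ) →L[ℝ] ((ι → Bool) → ℝ)) :=
  ⟨fun _ => 1, rfl, hasDerivAt_const _ _, Eventually.of_forall fun _ _ hw => hw⟩

/-- By the product rule at the identity the derivatives of the two curves add; the generators need
not commute. -/
theorem IsTangent.add {X Y : ((ι → Bool) → ℝ) →L[ℝ] ((ι → Bool) → ℝ)} (hX : IsTangent X)
    (hY : IsTangent Y) : IsTangent (X + Y) := by
  obtain ⟨A, hA0, hA, hAK⟩ := hX
  obtain ⟨B, hB0, hB, hBK⟩ := hY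
  refine ⟨fun s => A s * B s, by simp [hA0, hB0], ?_, ?_⟩
  · have := hA.mul hB
    rwa [hA0, hB0, one_mul, mul_one] at this
  · filter_upwards [hAK, hBK] with s h1 h2 w hw
    exact h1 _ (h2 w hw)

theorem IsTangent.sum {α : Type*} (s : Finset α)
    {X : α → ((ι → Bool) → ℝ) →L[ℝ] ((ι → Bool) → ℝ)} (hX : ∀ a ∈ s, IsTangent (X a)) :
    IsTangent (∑ a ∈ s, X a) :=
  Finset.sum_induction X IsTangent (fun _ _ => IsTangent.add) isTangent_zero hX

/-- The exponential is the limit of `A(1/n)^n`, each of which eventually preserves the closed set.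
-/
theorem IsTangent.exp_mem {X : ((ι → Bool) → ℝ) →L[ℝ] ((ι → Bool) → ℝ)} (hX : IsTangent X)
    {w : (ι → Bool) → ℝ} (hw : w ∈ stableMass ι) : NormedSpace.exp X w ∈ stableMass ι := by
  obtain ⟨A, hA0, hA, hAK⟩ := hX
  have h1 := tendsto_pow_exp_of_hasDerivAt hA0 hA
  have h2 : Tendsto (fun n : ℕ => (A ((n : ℝ)⁻¹) ^ n) w) atTop (𝓝 (NormedSpace.exp X w)) :=
    ((ContinuousLinearMap.apply ℝ ((ι → Bool) → ℝ) w).continuous.tendsto _).comp h1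
  refine isClosed_stableMass.mem_of_tendsto h2 ?_
  have h3 : Tendsto (fun n : ℕ => ((n : ℝ))⁻¹) atTop (𝓝[>] 0) := by
    refine tendsto_nhdsWithin_iff.mpr ⟨tendsto_inv_atTop_nhds_zero_nat, ?_⟩
    filter_upwards [eventually_gt_atTop 0] with n hn
    have hn' : (0 : ℝ) < n := by exact_mod_cast hn
    exact inv_pos.mpr hn'
  filter_upwards [h3.eventually hAK] with n hn
  have h4 : ∀ k : ℕ, (A ((n : ℝ)⁻¹) ^ k) w ∈ stableMass ι := by
    intro k
    induction k with
    | zero => simpa using hw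
    | succ k ih => rw [pow_succ']; exact hn _ ih
  exact h4 n

/-- The operator that permutes the coordinates of the states by `π`. -/
noncomputable def permCLM (π : Equiv.Perm ι) : ((ι → Bool) → ℝ) →L[ℝ] ((ι → Bool) → ℝ) :=
  LinearMap.toContinuousLinearMap (LinearMap.funLeft ℝ ℝ fun (x : ι → Bool) j => x (π j))

/-- The linear curve at parameter `s` is a swap average with weight `θ = s c`, which lies in `[0,
1]` for small `s ≥ 0`. -/
theorem isTangent_swap (i j : ι) {c : ℝ} (hc : 0 ≤ c) :
    IsTangent (c • (permCLM (Equiv.swap i j) - 1)) := by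
  refine ⟨fun s => 1 + s • (c • (permCLM (Equiv.swap i j) - 1)), by simp, ?_, ?_⟩
  · simpa using ((hasDerivAt_id (0 : ℝ)).smul_const
      (c • (permCLM (Equiv.swap i j) - 1))).const_add 1
  · have h1 : ∀ᶠ s in 𝓝[>] (0 : ℝ), s * c < 1 := by
      have hcont : Continuous fun s : ℝ => s * c := by fun_prop
      exact (hcont.continuousAt.eventually (gt_mem_nhds (by simp))).filter_mono nhdsWithin_le_nhds
    filter_upwards [h1, self_mem_nhdsWithin] with s hs (hs0 : 0 < s) w hw
    have hsc : 0 ≤ s * c := mul_nonneg hs0.le hc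
    obtain ⟨h1, h2, h3⟩ := hw
    have hval : ∀ x, (1 + s • (c • (permCLM (Equiv.swap i j) - 1)) :
        ((ι → Bool) → ℝ) →L[ℝ] ((ι → Bool) → ℝ)) w x =
        (1 - s * c) * w x + s * c * w fun l => x (Equiv.swap i j l) := by
      intro x
      have : permCLM (Equiv.swap i j) w x = w fun l => x (Equiv.swap i j l) := rfl
      simp only [add_apply, one_apply_eq_self,
        smul_apply, sub_apply, Pi.add_apply,
        Pi.smul_apply, Pi.sub_apply, smul_eq_mul, this]
      ring
    refine ⟨fun x => ?_, ?_, ?_⟩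
    · rw [hval]
      exact add_nonneg (mul_nonneg (by linarith) (h1 _)) (mul_nonneg hsc (h1 _))
    · simp only [hval]
      rw [Finset.sum_add_distrib, ← Finset.mul_sum, ← Finset.mul_sum, h2]
      have : ∑ x : ι → Bool, (w fun l => x (Equiv.swap i j l)) = 1 := by
        rw [← h2]
        exact Fintype.sum_equiv (Equiv.arrowCongr (Equiv.swap i j).symm (Equiv.refl Bool)) _ _
          fun x => rfl
      rw [this]; ring
    · have := h3.swap_average i j hsc hs.le
      convert this using 2 with x
      rw [hval]
      push_cast
      ring

omit [Fintype ι] in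
theorem exists_pairSwap_eq (e : Sym2 ι) : ∃ i j, pairSwap e = Equiv.swap i j := by
  induction e using Sym2.ind with
  | _ i j => exact ⟨i, j, rfl⟩

theorem vecMulCLM_exclusionGenerator (lam : Sym2 ι → ℝ) (t : ℝ) :
    vecMulCLM (t • exclusionGenerator lam) =
      ∑ e, (t * lam e) • (permCLM (pairSwap e) - 1) := by
  ext w y
  rw [vecMulCLM_apply, sum_apply, Finset.sum_apply]
  simp only [Matrix.vecMul, dotProduct, Matrix.smul_apply, exclusionGenerator, smul_eq_mul,
    Finset.mul_sum]
  rw [Finset.sum_comm]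
  refine Finset.sum_congr rfl fun e _ => ?_
  obtain ⟨i, j, hij⟩ := exists_pairSwap_eq e
  -- A swap is an involution, so the states that jump into `y` are found by swapping `y` itself.
  have hiff : ∀ x : ι → Bool, (y = fun l => x (pairSwap e l)) ↔
      x = fun l => y (pairSwap e l) := by
    intro x
    rw [hij]
    constructor
    · rintro rfl; simp
    · rintro rfl; simp
  have hval : permCLM (pairSwap e) w y = w fun l => y (pairSwap e l) := rfl
  simp only [smul_apply, sub_apply,
    one_apply_eq_self, Pi.smul_apply, Pi.sub_apply, smul_eq_mul, hval, hiff]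
  have h1 : ∀ x : ι → Bool, w x * (t * (lam e *
      ((if x = fun l => y (pairSwap e l) then 1 else 0) - if y = x then 1 else 0))) =
      (if x = fun l => y (pairSwap e l) then t * lam e * w x else 0) -
        if y = x then t * lam e * w x else 0 := by
    intro x
    split_ifs <;> ring
  simp only [h1, Finset.sum_sub_distrib, Finset.sum_ite_eq, Finset.sum_ite_eq', Finset.mem_univ,
    if_true]
  ring

theorem IsStrongRayleigh.exclusionLaw {μ : Measure (ι → Bool)} (hμ : IsStrongRayleigh μ)
    {lam : Sym2 ι → ℝ} (hlam : ∀ e, 0 ≤ lam e) {t : ℝ} (ht : 0 ≤ t) :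
    IsStrongRayleigh (exclusionLaw lam t μ) := by
  have := hμ.isProbabilityMeasure
  have hw : (fun x => μ.real {x}) ∈ stableMass ι :=
    ⟨fun _ => measureReal_nonneg, sum_measureReal_univ μ, hμ.stab⟩
  have htan : IsTangent (vecMulCLM (t • exclusionGenerator lam)) := by
    rw [vecMulCLM_exclusionGenerator]
    refine IsTangent.sum _ fun e _ => ?_
    obtain ⟨i, j, hij⟩ := exists_pairSwap_eq e
    rw [hij]
    exact isTangent_swap i j (mul_nonneg ht (hlam e))
  obtain ⟨h1, h2, h3⟩ := htan.exp_mem hw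
  rw [StrongRayleigh.exclusionLaw, vecMul_exp]
  exact isStrongRayleigh_ofMass h1 h2 h3

end Exclusion

end StrongRayleigh

/-! ### The theorem -/

theorem mainTheorem1 {ι : Type u} [Fintype ι] [DecidableEq ι]
    (μ : MeasureTheory.Measure (ι → Bool)) (hμ : StrongRayleigh.IsStrongRayleigh μ) :
    -- (i) negative association
    StrongRayleigh.NegativelyAssociated μ ∧
    -- (ii) stochastic inequalities and rank rescaling
    StrongRayleigh.HasStochIncreasingLevels μ ∧
    StrongRayleigh.HasStochCoveringProperty μ ∧
    StrongRayleigh.UltraLogConcave (Fintype.card ι) (StrongRayleigh.rankSeq μ) ∧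
    (∀ b : ℕ → ℝ, (∀ i ≤ Fintype.card ι, 0 ≤ b i) →
      StrongRayleigh.IsStable (StrongRayleigh.coeffPoly (Fintype.card ι) b) →
      0 < ∑ i ∈ Finset.range (Fintype.card ι + 1), b i * StrongRayleigh.rankSeq μ i →
      StrongRayleigh.IsStrongRayleigh (StrongRayleigh.rankRescale b μ)) ∧
    (∀ k : ℕ, μ {x | StrongRayleigh.rank x = k} ≠ 0 →
      StrongRayleigh.IsStrongRayleigh
        (ProbabilityTheory.cond μ {x | StrongRayleigh.rank x = k})) ∧
    (∀ k : ℕ, μ {x | k ≤ StrongRayleigh.rank x ∧ StrongRayleigh.rank x ≤ k + 1} ≠ 0 →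
      StrongRayleigh.IsStrongRayleigh
        (ProbabilityTheory.cond μ
          {x | k ≤ StrongRayleigh.rank x ∧ StrongRayleigh.rank x ≤ k + 1})) ∧
    -- (iii) closure properties
    (∀ (κ : Type v) [Fintype κ] [DecidableEq κ] (ν : MeasureTheory.Measure (κ → Bool)),
      StrongRayleigh.IsStrongRayleigh ν →
      StrongRayleigh.IsStrongRayleigh (StrongRayleigh.prodMeasure μ ν)) ∧
    (∀ S : Finset ι, StrongRayleigh.IsStrongRayleigh (StrongRayleigh.proj S μ)) ∧
    (∀ lam : ι → ℝ, (∀ j, 0 < lam j) →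
      StrongRayleigh.IsStrongRayleigh (StrongRayleigh.externalField lam μ)) ∧
    StrongRayleigh.IsStrongRayleigh (StrongRayleigh.totalSymm μ) ∧
    (∀ lam : Sym2 ι → ℝ, (∀ e, 0 ≤ lam e) → ∀ t : ℝ, 0 ≤ t →
      StrongRayleigh.IsStrongRayleigh (StrongRayleigh.exclusionLaw lam t μ)) := by
  refine ⟨hμ.negativelyAssociated, hμ.hasStochIncreasingLevels, hμ.hasStochCoveringProperty,
    hμ.ultraLogConcave, fun b hb hB hZ => hμ.rankRescale hb (fun s hs => ?_) hZ,
    fun k hk => ?_, fun k hk => hμ.cond_window (Nat.le_succ k) le_rfl hk,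
    fun κ _ _ ν hν => hμ.prodMeasure hν, hμ.proj, fun lam hlam => hμ.externalField hlam,
    hμ.totalSymm, fun lam hlam t ht => hμ.exclusionLaw hlam ht⟩
  · simpa [StrongRayleigh.coeffPoly] using hB (fun _ => s) fun _ => hs
  · have h : {x : ι → Bool | StrongRayleigh.rank x = k} =
        {x | k ≤ StrongRayleigh.rank x ∧ StrongRayleigh.rank x ≤ k} := by
      ext x
      exact eq_comm.trans le_antisymm_iff
    rw [h] at hk ⊢
    exact hμ.cond_window le_rfl (Nat.le_succ k) hk
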